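/- Let $n\ge 2$, let $\mathbb{H}^n$ be hyperbolic $n$-space (of curvature $-1$) with its distance $\mathrm{dist}$, and let $\{K_i\}$ be a sequence of $n$-dimensional geodesically convex compact subsets of $\mathbb{H}^n$ that converges in the Hausdorff sense to a convex compact set $K\subset\mathbb{H}^n$. For points $x,y\in\partial K_i$ let $D^{in}_i(x,y)$ be the induced intrinsic distance, i.e. the infimum of the lengths of the paths in $\partial K_i$ joining $x$ to $y$, and equip $\partial K_i$ with $D^{in}_i$. The dimension of a convex set is that of the smallest totally geodesic subspace containing it. These $(\partial K_i,D_i^{in})$ are non-empty compact metric spaces whenever they occur below, and so are the limit spaces; $\mathrm{GH}$ denotes Gromov--Hausdorff convergence. (1) If $\dim K=n$, then $\partial K_i\overset{GH}{\to}\partial K$, where $\partial K$ is equipped with its induced intrinsic metric. (2) If $\dim K=n-1$, then $\partial K_i\overset{GH}{\to}DK$, where the double $DK$ is the union of two copies of $K$ with corresponding points of their relative boundaries (their boundaries in the hyperplane spanned by $K$) identified, equipped with the intrinsic metric for which the two copies of $K$ are isometrically embedded: the distance of $x$ and $y$ is $\mathrm{dist}(x,y)$ in the same copy, and $\inf_z(\mathrm{dist}(x,z)+\mathrm{dist}(z,y))$,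 with $z$ in the relative boundary of $K$, in different copies. This metric is indeed intrinsic. (3) If $\dim K\le n-2$, then $\partial K_i\overset{GH}{\to}K$, where $K$ is equipped with the metric $\mathrm{dist}$ induced from $\mathbb{H}^n$, which is automatically intrinsic. (4) If $\dim K\le n-2$, then $$\lim_{i\to\infty}\ \sup_{x,y\in\partial K_i}\left|D^{in}_i(x,y)-\mathrm{dist}(x,y)\right|=0.$$ -/

import Mathlib

open Filter Topology GromovHausdorff
open scoped ENNReal RealInnerProductSpace

noncomputable section

/-- Hyperbolic `n`-space in the Klein model: the points are those of the open unit ball of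
Euclidean `n`-space. (A structure, so that it does not inherit the Euclidean metric.) -/
@[ext]
structure HypSpace (n : ℕ) where
  /-- The Klein coordinates of a point. -/
  coord : EuclideanSpace ℝ (Fin n)
  norm_coord_lt : ‖coord‖ < 1

namespace HypSpace

variable {n : ℕ}

/-- The hyperbolic cosine of the distance of two points,
`(1 - ⟪x, y⟫) / (√(1 - |x|²) √(1 - |y|²))`. -/
def coshDist (x y : HypSpace n) : ℝ :=
  (1 - ⟪x.coord, y.coord⟫) / (√(1 - ‖x.coord‖ ^ 2) * √(1 - ‖y.coord‖ ^ 2))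

/-- The hyperbolic distance (curvature `-1`), that is, the distance of the Riemannian metric
`ds² = |dx|² / (1 - |x|²) + ⟪x, dx⟫² / (1 - |x|²)²`. -/
instance : Dist (HypSpace n) := ⟨fun x y => Real.arcosh (coshDist x y)⟩

theorem dist_def (x y : HypSpace n) : dist x y = Real.arcosh (coshDist x y) := rfl

theorem one_sub_pos (x : HypSpace n) : 0 < 1 - ‖x.coord‖ ^ 2 := by
  have := x.norm_coord_lt
  have := norm_nonneg x.coord
  nlinarith

theorem inner_lt (x y : HypSpace n) : 0 < 1 - ⟪x.coord, y.coord⟫ := by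
  have h1 := real_inner_le_norm x.coord y.coord
  have := x.norm_coord_lt
  have := y.norm_coord_lt
  have := norm_nonneg x.coord
  have := norm_nonneg y.coord
  nlinarith

/-- The value at `x - z` of the (rescaled) Riemannian metric at `z`. -/
theorem gram_self (x z : HypSpace n) :
    (1 - ⟪x.coord, z.coord⟫) ^ 2 - (1 - ‖x.coord‖ ^ 2) * (1 - ‖z.coord‖ ^ 2)
      = ⟪x.coord - z.coord, z.coord⟫ ^ 2
        + (1 - ‖z.coord‖ ^ 2) * ‖x.coord - z.coord‖ ^ 2 := by
  rw [norm_sub_sq_real, inner_sub_left, real_inner_self_eq_norm_sq]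
  ring

theorem gram_mixed (x y z : HypSpace n) :
    (1 - ⟪x.coord, z.coord⟫) * (1 - ⟪z.coord, y.coord⟫)
        - (1 - ⟪x.coord, y.coord⟫) * (1 - ‖z.coord‖ ^ 2)
      = ⟪x.coord - z.coord, z.coord⟫ * ⟪y.coord - z.coord, z.coord⟫
        + (1 - ‖z.coord‖ ^ 2) * ⟪x.coord - z.coord, y.coord - z.coord⟫ := by
  simp only [inner_sub_left, inner_sub_right, real_inner_self_eq_norm_sq,
    real_inner_comm y.coord z.coord]
  ring

theorem one_le_coshDist (x y : HypSpace n) : 1 ≤ coshDist x y := by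
  have hx := one_sub_pos x
  have hy := one_sub_pos y
  rw [coshDist, ← Real.sqrt_mul hx.le, le_div_iff₀ (Real.sqrt_pos.2 (mul_pos hx hy)), one_mul]
  refine Real.sqrt_le_iff.2 ⟨(inner_lt x y).le, ?_⟩
  have h := gram_self x y
  have : 0 ≤ (1 - ‖y.coord‖ ^ 2) * ‖x.coord - y.coord‖ ^ 2 := by positivity
  nlinarith [sq_nonneg ⟪x.coord - y.coord, y.coord⟫]

theorem coshDist_sq_sub_one (x z : HypSpace n) :
    coshDist x z ^ 2 - 1 = (⟪x.coord - z.coord, z.coord⟫ ^ 2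
        + (1 - ‖z.coord‖ ^ 2) * ‖x.coord - z.coord‖ ^ 2)
          / ((1 - ‖x.coord‖ ^ 2) * (1 - ‖z.coord‖ ^ 2)) := by
  have hx := one_sub_pos x
  have hz := one_sub_pos z
  rw [← gram_self, coshDist, div_pow, mul_pow, Real.sq_sqrt hx.le, Real.sq_sqrt hz.le]
  field_simp

theorem coshDist_comm (x y : HypSpace n) : coshDist x y = coshDist y x := by
  rw [coshDist, coshDist, real_inner_comm, mul_comm]

theorem coshDist_self (x : HypSpace n) : coshDist x x = 1 := by
  have hx := one_sub_pos x
  rw [coshDist, real_inner_self_eq_norm_sq, Real.mul_self_sqrt hx.le, div_self hx.ne']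

theorem eq_of_coshDist_eq_one {x y : HypSpace n} (h : coshDist x y = 1) : x = y := by
  have hx := one_sub_pos x
  have hy := one_sub_pos y
  have h1 := coshDist_sq_sub_one x y
  rw [h, one_pow, sub_self, eq_comm, div_eq_zero_iff] at h1
  have h2 := h1.resolve_right (mul_pos hx hy).ne'
  have h3 : 0 ≤ (1 - ‖y.coord‖ ^ 2) * ‖x.coord - y.coord‖ ^ 2 := by positivity
  have h4 : (1 - ‖y.coord‖ ^ 2) * ‖x.coord - y.coord‖ ^ 2 = 0 := by
    nlinarith [sq_nonneg ⟪x.coord - y.coord, y.coord⟫]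
  have h5 := (mul_eq_zero.1 h4).resolve_left hy.ne'
  have h6 : ‖x.coord - y.coord‖ = 0 := by simpa using h5
  exact HypSpace.ext (sub_eq_zero.1 (norm_eq_zero.1 h6))

/-- The Cauchy–Schwarz inequality for the Riemannian metric at `z`. -/
theorem gram_cauchy (x y z : HypSpace n) :
    -(⟪x.coord - z.coord, z.coord⟫ * ⟪y.coord - z.coord, z.coord⟫
        + (1 - ‖z.coord‖ ^ 2) * ⟪x.coord - z.coord, y.coord - z.coord⟫)
      ≤ √((⟪x.coord - z.coord, z.coord⟫ ^ 2
            + (1 - ‖z.coord‖ ^ 2) * ‖x.coord - z.coord‖ ^ 2)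
          * (⟪y.coord - z.coord, z.coord⟫ ^ 2
            + (1 - ‖z.coord‖ ^ 2) * ‖y.coord - z.coord‖ ^ 2)) := by
  have hz := one_sub_pos z
  apply Real.le_sqrt_of_sq_le
  have hc := abs_real_inner_le_norm (x.coord - z.coord) (y.coord - z.coord)
  generalize ⟪x.coord - z.coord, z.coord⟫ = a at *
  generalize ⟪y.coord - z.coord, z.coord⟫ = b at *
  generalize ⟪x.coord - z.coord, y.coord - z.coord⟫ = c at *
  have hu := norm_nonneg (x.coord - z.coord)
  have hv := norm_nonneg (y.coord - z.coord)
  generalize ‖x.coord - z.coord‖ = u at *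
  generalize ‖y.coord - z.coord‖ = v at *
  generalize 1 - ‖z.coord‖ ^ 2 = g at *
  obtain ⟨hc1, hc2⟩ := abs_le.1 hc
  have h1 : c ^ 2 ≤ (u * v) ^ 2 := sq_le_sq' hc1 hc2
  have h2 : 2 * (a * b) * c ≤ (a * v) ^ 2 + (b * u) ^ 2 := by
    have : |(a * b) * c| ≤ |a * b| * (u * v) := by
      rw [abs_mul]
      exact mul_le_mul_of_nonneg_left hc (abs_nonneg _)
    have h3 := (abs_le.1 this).2
    have h4 : |a * b| * (u * v) = (|a| * v) * (|b| * u) := by rw [abs_mul]; ring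
    have h5 : (a * v) ^ 2 = (|a| * v) ^ 2 := by rw [mul_pow, mul_pow, sq_abs]
    have h6 : (b * u) ^ 2 = (|b| * u) ^ 2 := by rw [mul_pow, mul_pow, sq_abs]
    nlinarith [sq_nonneg (|a| * v - |b| * u)]
  nlinarith [mul_le_mul_of_nonneg_left h2 hz.le,
    mul_le_mul_of_nonneg_left h1 (mul_nonneg hz.le hz.le)]

theorem coshDist_le (x y z : HypSpace n) :
    coshDist x y ≤ coshDist x z * coshDist z y
      + √(coshDist x z ^ 2 - 1) * √(coshDist z y ^ 2 - 1) := by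
  have hx := one_sub_pos x
  have hy := one_sub_pos y
  have hz := one_sub_pos z
  have h1 := gram_cauchy x y z
  have h2 := gram_mixed x y z
  have hX := coshDist_sq_sub_one x z
  have hY := coshDist_sq_sub_one y z
  rw [← coshDist_comm z y] at hY
  set P := ⟪x.coord - z.coord, z.coord⟫ ^ 2
            + (1 - ‖z.coord‖ ^ 2) * ‖x.coord - z.coord‖ ^ 2 with hP
  set Q := ⟪y.coord - z.coord, z.coord⟫ ^ 2
            + (1 - ‖z.coord‖ ^ 2) * ‖y.coord - z.coord‖ ^ 2 with hQ
  have hP0 : 0 ≤ P := by positivity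
  rw [← h2, Real.sqrt_mul hP0] at h1
  rw [hX, hY, Real.sqrt_div' _ (mul_pos hx hz).le, Real.sqrt_div' _ (mul_pos hy hz).le,
    Real.sqrt_mul hx.le, Real.sqrt_mul hy.le]
  simp only [coshDist]
  have sx := Real.sqrt_pos.2 hx
  have sy := Real.sqrt_pos.2 hy
  have sz := Real.sqrt_pos.2 hz
  have ez := Real.sq_sqrt hz.le
  rw [← ez] at h1
  generalize √(1 - ‖x.coord‖ ^ 2) = a at *
  generalize √(1 - ‖y.coord‖ ^ 2) = b at *
  generalize √(1 - ‖z.coord‖ ^ 2) = c at *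
  rw [div_mul_div_comm, div_mul_div_comm, ← sub_nonneg]
  have : (1 - ⟪x.coord, z.coord⟫) * (1 - ⟪z.coord, y.coord⟫) / (a * c * (c * b))
      + √P * √Q / (a * c * (b * c)) - (1 - ⟪x.coord, y.coord⟫) / (a * b)
      = ((1 - ⟪x.coord, z.coord⟫) * (1 - ⟪z.coord, y.coord⟫) + √P * √Q
          - (1 - ⟪x.coord, y.coord⟫) * c ^ 2) / (a * b * c ^ 2) := by
    field_simp
  rw [this]
  apply div_nonneg _ (by positivity)
  linarith

instance : MetricSpace (HypSpace n) where
  dist_self x := by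
    rw [dist_def, coshDist_self, (Real.arcosh_eq_zero_iff le_rfl).2 rfl]
  dist_comm x y := by rw [dist_def, dist_def, coshDist_comm]
  dist_triangle x z y := by
    have h1 := Real.arcosh_nonneg (one_le_coshDist x z)
    have h2 := Real.arcosh_nonneg (one_le_coshDist z y)
    simp only [dist_def]
    rw [← Real.arcosh_cosh (add_nonneg h1 h2),
      Real.arcosh_le_arcosh (zero_lt_one.trans_le (one_le_coshDist x y)) (Real.cosh_pos _),
      Real.cosh_add, Real.cosh_arcosh (one_le_coshDist _ _),
      Real.cosh_arcosh (one_le_coshDist _ _), Real.sinh_arcosh (one_le_coshDist _ _),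
      Real.sinh_arcosh (one_le_coshDist _ _)]
    exact coshDist_le x y z
  eq_of_dist_eq_zero {x y} h :=
    eq_of_coshDist_eq_one ((Real.arcosh_eq_zero_iff (one_le_coshDist x y)).1 h)

/-- Geodesic convexity: with two points `x`, `y`, the set contains the geodesic segment
`{z | d(x, z) + d(z, y) = d(x, y)}` between them. -/
def IsConvex (K : Set (HypSpace n)) : Prop :=
  ∀ x ∈ K, ∀ y ∈ K, ∀ z, dist x z + dist z y = dist x y → z ∈ K

/-- The dimension of (the totally geodesic subspace spanned by) a set. In the Klein model the
totally geodesic subspaces are the traces of the affine subspaces on the open ball. -/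
def dim (K : Set (HypSpace n)) : ℕ :=
  Module.finrank ℝ (affineSpan ℝ (coord '' K)).direction

/-- The relative boundary of a set: its boundary in the totally geodesic subspace
that it spans. -/
def relBoundary (K : Set (HypSpace n)) : Set (HypSpace n) :=
  {x | x.coord ∈ intrinsicFrontier ℝ (coord '' K)}

/-- The identification on two copies of `K` that glues the copies along the relative
boundary. -/
def doubleSetoid (K : Set (HypSpace n)) : Setoid (K × Bool) where
  r p q := p.1 = q.1 ∧ (p.2 = q.2 ∨ (p.1 : HypSpace n) ∈ relBoundary K)
  iseqv :=
    { refl := fun _ => ⟨rfl, Or.inl rfl⟩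
      symm := fun {p q} h => ⟨h.1.symm, h.2.imp Eq.symm (fun h' => h.1 ▸ h')⟩
      trans := fun {p q r} h k => ⟨h.1.trans k.1, by
        rcases h.2 with h2 | h2
        · rcases k.2 with k2 | k2
          · exact Or.inl (h2.trans k2)
          · exact Or.inr (h.1 ▸ k2)
        · exact Or.inr h2⟩ }

/-- The double of `K`: two copies of `K`, glued along the relative boundary. -/
def Double (K : Set (HypSpace n)) : Type := Quotient (doubleSetoid K)

/-- The distance of the double in terms of representatives: the distance of `K` within each copy,
and `inf (d(x, z) + d(z, y))` over the relative boundary points `z` between the copies. -/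
def preDoubleEDist (K : Set (HypSpace n)) (p q : K × Bool) : ℝ≥0∞ :=
  if p.2 = q.2 then edist p.1 q.1
  else ⨅ z ∈ relBoundary K, edist (p.1 : HypSpace n) z + edist z (q.1 : HypSpace n)

theorem preDoubleEDist_comm (K : Set (HypSpace n)) (p q : K × Bool) :
    preDoubleEDist K p q = preDoubleEDist K q p := by
  simp only [preDoubleEDist, eq_comm (a := q.2), edist_comm q.1 p.1]
  split_ifs
  · rfl
  · refine iInf_congr fun z => iInf_congr fun _ => ?_
    rw [add_comm, edist_comm z (q.1 : HypSpace n), edist_comm (p.1 : HypSpace n) z]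

theorem iInf_relBoundary (K : Set (HypSpace n)) {x y : HypSpace n} (hx : x ∈ relBoundary K) :
    ⨅ z ∈ relBoundary K, edist x z + edist z y = edist x y := by
  apply le_antisymm
  · refine (iInf₂_le x hx).trans ?_
    simp
  · exact le_iInf₂ fun z _ => edist_triangle x z y

theorem preDoubleEDist_congr_left (K : Set (HypSpace n)) {p p' : K × Bool}
    (h : (doubleSetoid K).r p p') (q : K × Bool) :
    preDoubleEDist K p q = preDoubleEDist K p' q := by
  obtain ⟨x, a⟩ := p
  obtain ⟨x', a'⟩ := p'
  obtain ⟨y, b⟩ := q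
  obtain ⟨h1, h2⟩ := h
  simp only at h1 h2
  subst h1
  rcases h2 with rfl | h2
  · rfl
  · simp only [preDoubleEDist, iInf_relBoundary K h2, Subtype.edist_eq, ite_self]

/-- The metric of the double: the intrinsic metric for which both copies of `K` are
isometrically embedded. -/
def doubleEDist (K : Set (HypSpace n)) (p q : Double K) : ℝ≥0∞ :=
  Quotient.liftOn₂ p q (preDoubleEDist K) fun p q p' q' hp hq => by
    rw [preDoubleEDist_congr_left K hp, preDoubleEDist_comm, preDoubleEDist_congr_left K hq,
      preDoubleEDist_comm]

end HypSpace

/-- The intrinsic (inner) distance of a metric space: the infimum of the lengths of the paths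
between two points (`⊤` if there is no rectifiable one). -/
def innerEDist {X : Type*} [PseudoEMetricSpace X] (x y : X) : ℝ≥0∞ :=
  ⨅ γ : Path x y, eVariationOn γ Set.univ

/-- The distance function `d` is an intrinsic metric on `X`: a metric in which the distance of any
two points is the infimum of the lengths of the paths between them. -/
def IsIntrinsicMetric {X : Type*} (d : X → X → ℝ≥0∞) : Prop :=
  ∃ _m : MetricSpace X, (∀ x y, edist x y = d x y) ∧ ∀ x y : X, innerEDist x y = d x y

/-- Gromov–Hausdorff convergence of the spaces `(X i, d i)` to `(Y, e)`: these distance functions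
are finite and make the sets nonempty compact metric spaces, and the Gromov–Hausdorff distance
between them tends to zero. -/
def GHTendsto {X : ℕ → Type*} (d : ∀ i, X i → X i → ℝ≥0∞) {Y : Type*} (e : Y → Y → ℝ≥0∞) :
    Prop :=
  ∃ (_mX : ∀ i, MetricSpace (X i)) (_mY : MetricSpace Y)
    (_cX : ∀ i, CompactSpace (X i)) (_cY : CompactSpace Y)
    (_nX : ∀ i, Nonempty (X i)) (_nY : Nonempty Y),
    (∀ i, ∀ x y : X i, edist x y = d i x y) ∧ (∀ x y : Y, edist x y = e x y) ∧
      Tendsto (fun i => ghDist (X i) Y) atTop (𝓝 0)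

end

noncomputable section

namespace HypSpace

variable {n : ℕ}

/-! ### Comparison of the hyperbolic and the Euclidean distance -/

/-! In the Klein model geodesics are Euclidean segments and totally geodesic subspaces are traces of
affine subspaces, so convexity, dimension and relative boundary are those of a convex set in
Euclidean space. On a ball of radius `R < 1` the hyperbolic distance is at most `(1 - R ^ 2)⁻¹`
times the Euclidean one, so small errors can be estimated in coordinates.

The engine is the nearest-point projection to a convex body (`exists_projection`): it is 1-Lipschitz
and sends the complement of the interior to the boundary. Hence the inner distance of the boundary
is at most the length of any path that avoids the interior (`lenDist_frontier_le`), and upper bounds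
reduce to drawing a few segments outside the body. That the projection contracts follows from the
obtuse angles at nearest points, by a computation on the hyperboloid (`dist_le_dist_of_obtuse`).

If `K` has interior, a homothety of factor slightly above 1 moves its boundary clear of `K_i`, and
projection takes it to the boundary of `K_i`. The composite is nearly 1-Lipschitz for lengths. The
same construction from `K_i` to `K` is an almost inverse, because boundary points that are close in
space are close along the boundary (`lenDist_compl_interior_le`).

If `K` has no interior, `K_i` lies in a slab of height at most `δ` on either side of any hyperplane
containing `K`. A boundary point leaves the slab along a path of length `O(δ)`, first along its
outer normal and then along the normal `w` of the hyperplane; beyond the slab one moves along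
segments. In codimension at least two, `w` can be chosen so that two given points leave on the same
side. The inner and the ambient distance then differ by `O(δ)` uniformly
(`lenDist_frontier_le_edist_add`), and this one estimate yields both (3) and (4).

In codimension one the hyperplane is unique. Points of one side are joined over the slab, points of
opposite sides around a relative boundary point. Conversely, by connectedness, a boundary path from
the upper to the lower side meets a point whose line in direction `w` misses the interior, and such
a point is `O(δ)`-close to the relative boundary (`exists_mem_intrinsicFrontier_near`). So the
distances are those of the double up to `O(δ)`. -/

theorem cosh_dist (x y : HypSpace n) : Real.cosh (dist x y) = coshDist x y := by
  rw [dist_def, Real.cosh_arcosh (one_le_coshDist x y)]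

theorem sinh_dist (x y : HypSpace n) : Real.sinh (dist x y) = √(coshDist x y ^ 2 - 1) := by
  rw [dist_def, Real.sinh_arcosh (one_le_coshDist x y)]

theorem dist_le_iff_coshDist_le {x y z w : HypSpace n} :
    dist x y ≤ dist z w ↔ coshDist x y ≤ coshDist z w := by
  rw [dist_def, dist_def, Real.arcosh_le_arcosh]
  · exact zero_lt_one.trans_le (one_le_coshDist _ _)
  · exact zero_lt_one.trans_le (one_le_coshDist _ _)

/-- In `coshDist_sq_sub_one` the numerator is at least `(1 - ‖z‖²) ‖x - z‖²` and the denominator at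
most `1 - ‖z‖²`. No bound on the position of the points is needed in this direction. -/
theorem norm_coord_sub_le_sinh (x z : HypSpace n) :
    ‖x.coord - z.coord‖ ≤ Real.sinh (dist x z) := by
  have hx := one_sub_pos x
  have hz := one_sub_pos z
  rw [sinh_dist, coshDist_sq_sub_one]
  apply Real.le_sqrt_of_sq_le
  rw [le_div_iff₀ (mul_pos hx hz)]
  have h1 : (1 - ‖x.coord‖ ^ 2) * (1 - ‖z.coord‖ ^ 2) ≤ 1 - ‖z.coord‖ ^ 2 := by
    nlinarith [sq_nonneg ‖x.coord‖]
  nlinarith [sq_nonneg ⟪x.coord - z.coord, z.coord⟫, sq_nonneg ‖x.coord - z.coord‖]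

/-- Since `d ≤ sinh d`, it suffices to bound `coshDist_sq_sub_one`: by Cauchy–Schwarz its numerator
is at most `‖x - z‖²`, and its denominator is at least `(1 - R²)²`. -/
theorem dist_le_mul_norm {R : ℝ} (hR : R < 1) {x z : HypSpace n} (hx : ‖x.coord‖ ≤ R)
    (hz : ‖z.coord‖ ≤ R) : dist x z ≤ (1 - R ^ 2)⁻¹ * ‖x.coord - z.coord‖ := by
  have hx1 := one_sub_pos x
  have hz1 := one_sub_pos z
  have hR0 : 0 ≤ R := (norm_nonneg _).trans hx
  have hRR : 0 < 1 - R ^ 2 := by nlinarith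
  have hx2 : 1 - R ^ 2 ≤ 1 - ‖x.coord‖ ^ 2 := by
    have := norm_nonneg x.coord
    nlinarith
  have hz2 : 1 - R ^ 2 ≤ 1 - ‖z.coord‖ ^ 2 := by
    have := norm_nonneg z.coord
    nlinarith
  refine (Real.self_le_sinh_iff.2 dist_nonneg).trans ?_
  rw [sinh_dist, coshDist_sq_sub_one]
  apply Real.sqrt_le_iff.2 ⟨by positivity, ?_⟩
  rw [div_le_iff₀ (mul_pos hx1 hz1), mul_pow]
  have h1 : ⟪x.coord - z.coord, z.coord⟫ ^ 2 ≤ ‖x.coord - z.coord‖ ^ 2 * ‖z.coord‖ ^ 2 := by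
    rw [← mul_pow]
    exact sq_le_sq' (abs_le.1 (abs_real_inner_le_norm _ _)).1
      (abs_le.1 (abs_real_inner_le_norm _ _)).2
  have h2 : 1 ≤ (1 - R ^ 2)⁻¹ ^ 2 * ((1 - ‖x.coord‖ ^ 2) * (1 - ‖z.coord‖ ^ 2)) := by
    rw [inv_pow, ← div_eq_inv_mul, le_div_iff₀ (by positivity), one_mul, sq]
    exact mul_le_mul hx2 hz2 hRR.le hx1.le
  calc _ ≤ ‖x.coord - z.coord‖ ^ 2 := by nlinarith
    _ ≤ ‖x.coord - z.coord‖ ^ 2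
        * ((1 - R ^ 2)⁻¹ ^ 2 * ((1 - ‖x.coord‖ ^ 2) * (1 - ‖z.coord‖ ^ 2))) :=
      le_mul_of_one_le_right (by positivity) h2
    _ = _ := by ring

theorem continuous_coord : Continuous (coord : HypSpace n → _) := by
  rw [continuous_iff_continuousAt]
  intro x
  rw [ContinuousAt, tendsto_iff_norm_sub_tendsto_zero]
  have h : Tendsto (fun y : HypSpace n => Real.sinh (dist y x)) (𝓝 x) (𝓝 0) := by
    have : Continuous fun y : HypSpace n => Real.sinh (dist y x) :=
      Real.continuous_sinh.comp (continuous_id.dist continuous_const)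
    simpa using this.tendsto x
  exact squeeze_zero (fun _ => norm_nonneg _) (fun y => norm_coord_sub_le_sinh y x) h

theorem injective_coord : Function.Injective (coord : HypSpace n → _) := fun _ _ h =>
  HypSpace.ext h

/-- Allows interiors, and frontiers of compact sets, to be read off in coordinates. Openness uses
the Lipschitz bound on a ball whose radius lies strictly between the norm of the point and 1. -/
theorem isOpenEmbedding_coord : IsOpenEmbedding (coord : HypSpace n → _) := by
  refine .of_continuous_injective_isOpenMap continuous_coord injective_coord fun U hU => ?_
  rw [Metric.isOpen_iff]
  rintro _ ⟨x, hx, rfl⟩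
  obtain ⟨ε, hε, hεU⟩ := Metric.isOpen_iff.1 hU x hx
  obtain ⟨R, hxR, hR⟩ := exists_between x.norm_coord_lt
  have hRR : 0 < 1 - R ^ 2 := by nlinarith [norm_nonneg x.coord]
  refine ⟨min (R - ‖x.coord‖) ((1 - R ^ 2) * ε), lt_min (by linarith) (by positivity),
    fun y hy => ?_⟩
  rw [Metric.mem_ball, dist_eq_norm, lt_min_iff] at hy
  have hyR : ‖y‖ ≤ R := by
    have := norm_le_norm_add_norm_sub' y x.coord
    linarith
  refine ⟨⟨y, hyR.trans_lt hR⟩, hεU ?_, rfl⟩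
  rw [Metric.mem_ball]
  refine (dist_le_mul_norm (x := ⟨y, hyR.trans_lt hR⟩) hR hyR hxR.le).trans_lt ?_
  rw [← div_eq_inv_mul, div_lt_iff₀ hRR, mul_comm]
  exact hy.2

theorem mem_interior_iff_coord {K : Set (HypSpace n)} {x : HypSpace n} :
    x ∈ interior K ↔ x.coord ∈ interior (coord '' K) := by
  have := isOpenEmbedding_coord.isOpenMap.preimage_interior_eq_interior_preimage
    (continuous_coord (n := n)) (coord '' K)
  rw [Set.preimage_image_eq _ injective_coord] at this
  rw [← this, Set.mem_preimage]

theorem mem_image_coord {K : Set (HypSpace n)} {x : HypSpace n} :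
    x.coord ∈ coord '' K ↔ x ∈ K :=
  injective_coord.mem_set_image

theorem norm_lt_of_mem_image_coord {K : Set (HypSpace n)} {v : EuclideanSpace ℝ (Fin n)}
    (hv : v ∈ coord '' K) : ‖v‖ < 1 := by
  obtain ⟨x, -, rfl⟩ := hv
  exact x.norm_coord_lt

/-- The point with given Klein coordinates (the origin for vectors outside the unit ball). -/
def ofCoord (v : EuclideanSpace ℝ (Fin n)) : HypSpace n :=
  if h : ‖v‖ < 1 then ⟨v, h⟩ else ⟨0, by simp⟩

theorem coord_ofCoord {v : EuclideanSpace ℝ (Fin n)} (hv : ‖v‖ < 1) : (ofCoord v).coord = v := by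
  rw [ofCoord, dif_pos hv]

@[simp]
theorem ofCoord_coord (x : HypSpace n) : ofCoord x.coord = x :=
  injective_coord (coord_ofCoord x.norm_coord_lt)

theorem continuousOn_ofCoord :
    ContinuousOn (ofCoord : EuclideanSpace ℝ (Fin n) → _) (Metric.ball 0 1) := by
  have hp : ∀ v ∈ Metric.ball (0 : EuclideanSpace ℝ (Fin n)) 1, ‖v‖ < 1 := fun v hv => by
    simpa using hv
  intro v hv
  rw [ContinuousWithinAt, isOpenEmbedding_coord.tendsto_nhds_iff, coord_ofCoord (hp v hv)]
  exact (tendsto_id.mono_left nhdsWithin_le_nhds).congr'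
    (eventually_nhdsWithin_of_forall fun u hu => (coord_ofCoord (hp u hu)).symm)

theorem edist_ofCoord_le {R : ℝ} (hR : R < 1) {u v : EuclideanSpace ℝ (Fin n)} (hu : ‖u‖ ≤ R)
    (hv : ‖v‖ ≤ R) :
    edist (ofCoord u) (ofCoord v) ≤ ENNReal.ofReal ((1 - R ^ 2)⁻¹ * ‖u - v‖) := by
  rw [edist_dist]
  apply ENNReal.ofReal_le_ofReal
  have := dist_le_mul_norm (x := ofCoord u) (z := ofCoord v) hR
    (by rwa [coord_ofCoord (hu.trans_lt hR)]) (by rwa [coord_ofCoord (hv.trans_lt hR)])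
  rwa [coord_ofCoord (hu.trans_lt hR), coord_ofCoord (hv.trans_lt hR)] at this

/-! ### Geodesics -/

/-- Euclidean segments are geodesics of the Klein model. -/
theorem dist_add_dist_of_coord_eq {x y z : HypSpace n} {t : ℝ} (h0 : 0 ≤ t) (h1 : t ≤ 1)
    (hz : z.coord = x.coord + t • (y.coord - x.coord)) : dist x z + dist z y = dist x y := by
  have hx := one_sub_pos x
  have hy := one_sub_pos y
  have hzp := one_sub_pos z
  -- By the addition formula the claim is the equality case of `coshDist_le`.
  apply Real.cosh_injOn (add_nonneg dist_nonneg dist_nonneg) dist_nonneg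
  rw [Real.cosh_add, cosh_dist, cosh_dist, cosh_dist, sinh_dist, sinh_dist,
    coshDist_comm z y, coshDist_sq_sub_one, coshDist_sq_sub_one]
  have h2 := gram_mixed x y z
  set u := y.coord - x.coord with hu
  -- Both differences are multiples of `u`, so the Gram forms at `z` become `t² G` and `(1 - t)² G`
  -- and the square roots come out exactly.
  have e1 : x.coord - z.coord = (-t) • u := by rw [hz]; module
  have e2 : y.coord - z.coord = (1 - t) • u := by rw [hz, hu]; module
  rw [e1, e2] at h2
  rw [e1, e2]
  simp only [inner_smul_left, inner_smul_right, norm_smul, conj_trivial,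
    real_inner_self_eq_norm_sq, Real.norm_eq_abs, mul_pow, sq_abs] at h2 ⊢
  set G := ⟪u, z.coord⟫ ^ 2 + (1 - ‖z.coord‖ ^ 2) * ‖u‖ ^ 2 with hG
  have hG0 : 0 ≤ G := by positivity
  have e3 : (-t) ^ 2 * ⟪u, z.coord⟫ ^ 2 + (1 - ‖z.coord‖ ^ 2) * ((-t) ^ 2 * ‖u‖ ^ 2)
      = t ^ 2 * G := by rw [hG]; ring
  have e4 : (1 - t) ^ 2 * ⟪u, z.coord⟫ ^ 2 + (1 - ‖z.coord‖ ^ 2) * ((1 - t) ^ 2 * ‖u‖ ^ 2)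
      = (1 - t) ^ 2 * G := by rw [hG]; ring
  have e5 : (1 - ⟪x.coord, z.coord⟫) * (1 - ⟪z.coord, y.coord⟫)
      = (1 - ⟪x.coord, y.coord⟫) * (1 - ‖z.coord‖ ^ 2) - t * (1 - t) * G := by
    rw [hG]; linear_combination h2
  rw [e3, e4, Real.sqrt_div' _ (mul_pos hx hzp).le, Real.sqrt_div' _ (mul_pos hy hzp).le,
    Real.sqrt_mul hx.le, Real.sqrt_mul hy.le, Real.sqrt_mul (sq_nonneg _),
    Real.sqrt_mul (sq_nonneg _), Real.sqrt_sq h0, Real.sqrt_sq (by linarith)]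
  rw [coshDist_comm y z]
  simp only [coshDist]
  have sx := Real.sqrt_pos.2 hx
  have sy := Real.sqrt_pos.2 hy
  have sz := Real.sqrt_pos.2 hzp
  have ez := Real.sq_sqrt hzp.le
  have eG := Real.mul_self_sqrt hG0
  rw [← ez] at e5
  generalize √(1 - ‖x.coord‖ ^ 2) = a at *
  generalize √(1 - ‖y.coord‖ ^ 2) = b at *
  generalize √(1 - ‖z.coord‖ ^ 2) = c at *
  field_simp
  linear_combination e5 + t * (1 - t) * eG

theorem norm_lt_one_of_mem_segment {x y v : EuclideanSpace ℝ (Fin n)} (hx : ‖x‖ < 1)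
    (hy : ‖y‖ < 1) (hv : v ∈ segment ℝ x y) : ‖v‖ < 1 := by
  have := (convex_ball (0 : EuclideanSpace ℝ (Fin n)) 1).segment_subset
    (by simpa using hx) (by simpa using hy) hv
  simpa using this

theorem IsConvex.convex {K : Set (HypSpace n)} (hK : IsConvex K) : Convex ℝ (coord '' K) := by
  rw [convex_iff_segment_subset]
  rintro _ ⟨x, hx, rfl⟩ _ ⟨y, hy, rfl⟩ v hv
  have hv1 := norm_lt_one_of_mem_segment x.norm_coord_lt y.norm_coord_lt hv
  rw [segment_eq_image'] at hv
  obtain ⟨t, ⟨h0, h1⟩, rfl⟩ := hv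
  exact ⟨⟨_, hv1⟩, hK x hx y hy _ (dist_add_dist_of_coord_eq h0 h1 rfl), rfl⟩

/-! ### The hyperboloid -/

/-- The Minkowski form (of signature `+ - ⋯ -`). -/
def mink (u v : EuclideanSpace ℝ (Fin n) × ℝ) : ℝ := u.2 * v.2 - ⟪u.1, v.1⟫

theorem mink_comm (u v : EuclideanSpace ℝ (Fin n) × ℝ) : mink u v = mink v u := by
  rw [mink, mink, real_inner_comm, mul_comm]

theorem mink_add_left (u v w : EuclideanSpace ℝ (Fin n) × ℝ) :
    mink (u + v) w = mink u w + mink v w := by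
  simp only [mink, Prod.fst_add, Prod.snd_add, inner_add_left]
  ring

theorem mink_smul_left (c : ℝ) (u w : EuclideanSpace ℝ (Fin n) × ℝ) :
    mink (c • u) w = c * mink u w := by
  simp only [mink, Prod.smul_fst, Prod.smul_snd, inner_smul_left, smul_eq_mul, conj_trivial]
  ring

theorem mink_sub_left (u v w : EuclideanSpace ℝ (Fin n) × ℝ) :
    mink (u - v) w = mink u w - mink v w := by
  simp only [mink, Prod.fst_sub, Prod.snd_sub, inner_sub_left]
  ring

theorem mink_add_right (u v w : EuclideanSpace ℝ (Fin n) × ℝ) :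
    mink w (u + v) = mink w u + mink w v := by
  rw [mink_comm, mink_add_left, mink_comm u, mink_comm v]

theorem mink_smul_right (c : ℝ) (u w : EuclideanSpace ℝ (Fin n) × ℝ) :
    mink w (c • u) = c * mink w u := by
  rw [mink_comm, mink_smul_left, mink_comm]

theorem mink_sub_right (u v w : EuclideanSpace ℝ (Fin n) × ℝ) :
    mink w (u - v) = mink w u - mink w v := by
  rw [mink_comm, mink_sub_left, mink_comm u, mink_comm v]

/-- The point of the upper sheet of the hyperboloid that corresponds to a point of the Klein
model. -/
def hyperboloid (x : HypSpace n) : EuclideanSpace ℝ (Fin n) × ℝ :=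
  (√(1 - ‖x.coord‖ ^ 2))⁻¹ • (x.coord, 1)

theorem mink_hyperboloid (x y : HypSpace n) :
    mink (hyperboloid x) (hyperboloid y) = coshDist x y := by
  rw [hyperboloid, hyperboloid, mink_smul_left, mink_smul_right, mink, coshDist, div_eq_inv_mul,
    mul_inv]
  ring

/-- The complement of a timelike vector is spacelike: orthogonality to `p` makes the last coordinate
of `v` equal to `⟪v.1, p.coord⟫`, which is at most `‖v.1‖` in absolute value as `‖p.coord‖ < 1`. -/
theorem mink_self_nonpos {v : EuclideanSpace ℝ (Fin n) × ℝ} {p : HypSpace n}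
    (h : mink v (hyperboloid p) = 0) : mink v v ≤ 0 := by
  have hp := one_sub_pos p
  rw [hyperboloid, mink_smul_right, mul_eq_zero] at h
  have h := h.resolve_left (inv_pos.2 (Real.sqrt_pos.2 hp)).ne'
  rw [mink, mul_one, sub_eq_zero] at h
  rw [mink, h, real_inner_self_eq_norm_sq]
  have h1 : ⟪v.1, p.coord⟫ ^ 2 ≤ (‖v.1‖ * ‖p.coord‖) ^ 2 :=
    sq_le_sq' (abs_le.1 (abs_real_inner_le_norm _ _)).1 (abs_le.1 (abs_real_inner_le_norm _ _)).2
  nlinarith [sq_nonneg ‖v.1‖]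

/-- The Cauchy–Schwarz inequality on the tangent space at a point of the hyperboloid. -/
theorem mink_sq_le {u v : EuclideanSpace ℝ (Fin n) × ℝ} {p : HypSpace n}
    (hu : mink u (hyperboloid p) = 0) (hv : mink v (hyperboloid p) = 0) :
    mink u v ^ 2 ≤ mink u u * mink v v := by
  -- The quadratic polynomial `mink (u + t • v) (u + t • v)` in `t` is nonpositive, hence so is its
  -- discriminant.
  have h : ∀ t : ℝ, mink v v * (t * t) + 2 * mink u v * t + mink u u ≤ 0 := fun t => by
    have h0 : mink (u + t • v) (hyperboloid p) = 0 := by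
      rw [mink_add_left, mink_smul_left, hu, hv, mul_zero, add_zero]
    have h1 := mink_self_nonpos h0
    rw [mink_add_left, mink_add_right, mink_add_right, mink_smul_left, mink_smul_left,
      mink_smul_right, mink_smul_right, mink_comm v u] at h1
    linarith
  have := discrim_le_zero_of_nonpos h
  rw [discrim] at this
  linarith

/-- The real inequality behind `dist_le_dist_of_obtuse`: `a`, `ξ` and `b`, `η` are the coordinates
of the two outer points in the plane of the edge, `U`, `V`, `W` the Gram matrix of the rest. -/
theorem le_of_gram_bounds {a b c s ξ η U V W m : ℝ} (hs : 0 < s) (hss : s ^ 2 = c ^ 2 - 1)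
    (h1 : 1 ≤ c) (ha : 1 ≤ a) (hb : 1 ≤ b) (hξ : 0 ≤ ξ) (hyf : c * η ≤ -(b * s))
    (k1 : U = 1 - a * a + ξ * ξ) (k2 : V = 1 - b * b + η * η) (k3 : W = m - a * b + ξ * η)
    (n1 : U ≤ 0) (n2 : V ≤ 0) (n3 : W ^ 2 ≤ U * V) : c ≤ m := by
  -- `σ` and `τ` are the lengths of the components of the outer points normal to the plane of the
  -- edge; Cauchy–Schwarz becomes `-(σ * τ) ≤ W`.
  obtain ⟨σ, hσ, hσσ⟩ : ∃ σ : ℝ, 0 ≤ σ ∧ σ ^ 2 = -U :=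
    ⟨√(-U), Real.sqrt_nonneg _, Real.sq_sqrt (by linarith)⟩
  obtain ⟨τ, hτ, hττ⟩ : ∃ τ : ℝ, 0 ≤ τ ∧ τ ^ 2 = -V :=
    ⟨√(-V), Real.sqrt_nonneg _, Real.sq_sqrt (by linarith)⟩
  have h4 : -(σ * τ) ≤ W := by
    have : W ^ 2 ≤ (σ * τ) ^ 2 := by rw [mul_pow, hσσ, hττ]; linarith
    exact (abs_le_of_sq_le_sq' this (mul_nonneg hσ hτ)).1
  have hc1 : 0 < c := by linarith
  have hη : η ≤ 0 := by
    by_contra hη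
    push Not at hη
    have := mul_pos hc1 hη
    have := mul_pos (zero_lt_one.trans_le hb) hs
    linarith
  -- From `a² = 1 + σ² + ξ²` comes `A ≤ a`; inserting `c² η² ≥ b² (c² - 1)` into `b² = 1 + τ² + η²`
  -- gives `c T ≤ b`. So `m = W + a b - ξ η` is at least `c A T - σ τ`, and `1 ≤ A T - σ τ`
  -- concludes.
  obtain ⟨A, hA, hAA⟩ : ∃ A : ℝ, 0 ≤ A ∧ A ^ 2 = 1 + σ ^ 2 :=
    ⟨√(1 + σ ^ 2), Real.sqrt_nonneg _, Real.sq_sqrt (by positivity)⟩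
  obtain ⟨T, hT, hTT⟩ : ∃ T : ℝ, 0 ≤ T ∧ T ^ 2 = 1 + τ ^ 2 :=
    ⟨√(1 + τ ^ 2), Real.sqrt_nonneg _, Real.sq_sqrt (by positivity)⟩
  have haA : A ≤ a := (abs_le_of_sq_le_sq' (by nlinarith [sq_nonneg ξ]) (by linarith)).2
  have hbT : c * T ≤ b := by
    have h5 : (b * s) ^ 2 ≤ (c * η) ^ 2 := by
      rw [← neg_sq (c * η)]
      exact pow_le_pow_left₀ (by positivity) (by linarith) 2
    refine (abs_le_of_sq_le_sq' ?_ (by linarith)).2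
    rw [mul_pow, hTT, hττ, k2]
    rw [mul_pow, mul_pow, hss] at h5
    linarith
  have hAT : 1 ≤ A * T - σ * τ := by
    have : (1 + σ * τ) ^ 2 ≤ (A * T) ^ 2 := by
      rw [mul_pow, hAA, hTT]; nlinarith [sq_nonneg (σ - τ)]
    have := (abs_le_of_sq_le_sq' this (by positivity)).2
    linarith
  have h6 : A * (c * T) ≤ a * b := mul_le_mul haA hbT (by positivity) (by linarith)
  have h7 : c * 1 ≤ c * (A * T - σ * τ) := mul_le_mul_of_nonneg_left hAT hc1.le
  have h8 : σ * τ ≤ c * (σ * τ) := le_mul_of_one_le_left (mul_nonneg hσ hτ) h1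
  have h9 : ξ * η ≤ 0 := mul_nonpos_of_nonneg_of_nonpos hξ hη
  linarith

/-- If the quadrilateral `x p q y` has obtuse angles at `p` and `q`, then `d(p, q) ≤ d(x, y)`. -/
theorem dist_le_dist_of_obtuse {x y p q : HypSpace n}
    (hx : coshDist x p * coshDist p q ≤ coshDist x q)
    (hy : coshDist y q * coshDist p q ≤ coshDist y p) : dist p q ≤ dist x y := by
  rw [dist_le_iff_coshDist_le]
  rcases (one_le_coshDist p q).eq_or_lt with h1 | h1
  · rw [← h1]
    exact one_le_coshDist x y
  obtain ⟨s, hs, hss⟩ : ∃ s : ℝ, 0 < s ∧ s ^ 2 = coshDist p q ^ 2 - 1 :=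
    ⟨√(coshDist p q ^ 2 - 1), Real.sqrt_pos.2 (by nlinarith), Real.sq_sqrt (by nlinarith)⟩
  have ha := one_le_coshDist x p
  have hb := one_le_coshDist y p
  have ePP : mink (hyperboloid p) (hyperboloid p) = 1 := by rw [mink_hyperboloid, coshDist_self]
  have eQQ : mink (hyperboloid q) (hyperboloid q) = 1 := by rw [mink_hyperboloid, coshDist_self]
  have eXX : mink (hyperboloid x) (hyperboloid x) = 1 := by rw [mink_hyperboloid, coshDist_self]
  have eYY : mink (hyperboloid y) (hyperboloid y) = 1 := by rw [mink_hyperboloid, coshDist_self]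
  rw [← mink_hyperboloid] at h1 ha hb hss
  simp only [← mink_hyperboloid] at hx hy ⊢
  generalize hP : hyperboloid p = P at *
  generalize hyperboloid q = Q at *
  generalize hyperboloid x = X at *
  generalize hyperboloid y = Y at *
  generalize ePQ : mink P Q = c at *
  -- `f` is the unit tangent vector at `P` pointing to `Q`; together with `P` it spans the plane of
  -- the edge.
  obtain ⟨f, hf⟩ : ∃ f, f = s⁻¹ • (Q - c • P) := ⟨_, rfl⟩
  have eF : ∀ v, mink v f = s⁻¹ * (mink v Q - c * mink v P) := fun v => by
    rw [hf, mink_smul_right, mink_sub_right, mink_smul_right]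
  have ePf : mink P f = 0 := by rw [eF, ePQ, ePP]; ring
  have eFP : mink f P = 0 := by rw [mink_comm, ePf]
  have eFF : mink f f = -1 := by
    rw [eF, eFP, mink_comm f Q, eF, eQQ, mink_comm Q P, ePQ]
    field_simp
    linarith
  have hxf : 0 ≤ mink X f := by
    rw [eF]
    exact mul_nonneg (inv_pos.2 hs).le (by linarith)
  -- The obtuse angle at `q`, rewritten in the basis `P`, `f` by means of `s² = c² - 1`.
  have hyf : c * mink Y f ≤ -(mink Y P * s) := by
    have : mink Y Q = s * mink Y f + c * mink Y P := by
      rw [eF]; field_simp; ring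
    rw [this] at hy
    have h3 : s * (c * mink Y f) ≤ s * (-(mink Y P * s)) := by nlinarith
    exact le_of_mul_le_mul_left h3 hs
  clear hf eF
  -- Removing the components along `P` and `f` leaves vectors tangent at `p`, to which the
  -- semidefiniteness and Cauchy–Schwarz statements apply.
  have key : ∀ u v : EuclideanSpace ℝ (Fin n) × ℝ,
      mink (u - mink u P • P + mink u f • f) (v - mink v P • P + mink v f • f)
        = mink u v - mink u P * mink v P + mink u f * mink v f := by
    intro u v
    simp only [mink_add_left, mink_sub_left, mink_smul_left, mink_add_right, mink_sub_right,
      mink_smul_right, ePP, eFP, ePf, eFF, mink_comm P v, mink_comm f v]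
    ring
  have perp : ∀ u : EuclideanSpace ℝ (Fin n) × ℝ,
      mink (u - mink u P • P + mink u f • f) (hyperboloid p) = 0 := by
    intro u
    rw [hP, mink_add_left, mink_sub_left, mink_smul_left, mink_smul_left, ePP, eFP]
    ring
  have k1 := key X X
  have k2 := key Y Y
  rw [eXX] at k1
  rw [eYY] at k2
  exact le_of_gram_bounds hs hss h1.le ha hb hxf hyf k1 k2 (key X Y) (mink_self_nonpos (perp X))
    (mink_self_nonpos (perp Y)) (mink_sq_le (perp X) (perp Y))

/-! ### The nearest-point projection -/

theorem exists_nearest {K : Set (HypSpace n)} (hK : IsCompact K) (hne : K.Nonempty)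
    (x : HypSpace n) : ∃ p ∈ K, ∀ q ∈ K, dist x p ≤ dist x q :=
  hK.exists_isMinOn hne (continuous_const.dist continuous_id).continuousOn

/-- The angle of a nearest point of a convex set is obtuse. -/
theorem obtuse_of_nearest {K : Set (HypSpace n)} (hK : Convex ℝ (coord '' K)) {x p q : HypSpace n}
    (hp : p ∈ K) (hq : q ∈ K) (hmin : ∀ q ∈ K, dist x p ≤ dist x q) :
    coshDist x p * coshDist p q ≤ coshDist x q := by
  have hx1 := one_sub_pos x
  have hp1 := one_sub_pos p
  have hq1 := one_sub_pos q
  set α := 1 - ⟪x.coord, p.coord⟫ with hα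
  set β := 1 - ⟪x.coord, q.coord⟫ with hβ
  set γ := 1 - ⟪p.coord, q.coord⟫ with hγ
  have hα0 : 0 < α := inner_lt x p
  suffices h : α * γ ≤ β * (1 - ‖p.coord‖ ^ 2) by
    simp only [coshDist]
    rw [← hα, ← hβ, ← hγ]
    have sx := Real.sqrt_pos.2 hx1
    have sp := Real.sqrt_pos.2 hp1
    have sq := Real.sqrt_pos.2 hq1
    rw [← Real.mul_self_sqrt hp1.le] at h
    generalize √(1 - ‖x.coord‖ ^ 2) = a at *
    generalize √(1 - ‖p.coord‖ ^ 2) = b at *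
    generalize √(1 - ‖q.coord‖ ^ 2) = c at *
    rw [div_mul_div_comm, div_le_div_iff₀ (by positivity) (by positivity)]
    calc α * γ * (a * c) ≤ β * (b * b) * (a * c) := mul_le_mul_of_nonneg_right h (by positivity)
      _ = _ := by ring
  -- First variation: minimality of `p` against the point at parameter `t` of the segment to `q`,
  -- squared, cleared of denominators and divided by `t`. The limit `t → 0` is the obtuse-angle
  -- inequality.
  have key : ∀ t ∈ Set.Ioc (0 : ℝ) 1, 0 ≤ 2 * (1 - t) * α * (β * (1 - ‖p.coord‖ ^ 2) - α * γ)
      + t * (β ^ 2 * (1 - ‖p.coord‖ ^ 2) - α ^ 2 * (1 - ‖q.coord‖ ^ 2)) := by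
    rintro t ⟨ht0, ht1⟩
    have hmem := hK.add_smul_sub_mem (Set.mem_image_of_mem _ hp) (Set.mem_image_of_mem _ hq)
      ⟨ht0.le, ht1⟩
    obtain ⟨r, hr, hrc⟩ := hmem
    have hr1 := one_sub_pos r
    have hm := dist_le_iff_coshDist_le.1 (hmin r hr)
    have e1 : 1 - ⟪x.coord, r.coord⟫ = (1 - t) * α + t * β := by
      rw [hrc, inner_add_right, inner_smul_right, inner_sub_right, hα, hβ]; ring
    have e2 : 1 - ‖r.coord‖ ^ 2 = (1 - t) ^ 2 * (1 - ‖p.coord‖ ^ 2) + 2 * t * (1 - t) * γ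
        + t ^ 2 * (1 - ‖q.coord‖ ^ 2) := by
      rw [hrc, norm_add_sq_real, norm_smul, inner_smul_right, inner_sub_right, mul_pow,
        norm_sub_sq_real, real_inner_self_eq_norm_sq, Real.norm_eq_abs, sq_abs,
        real_inner_comm p.coord q.coord, hγ]
      ring
    have hm2 : α ^ 2 * (1 - ‖r.coord‖ ^ 2)
        ≤ (1 - ⟪x.coord, r.coord⟫) ^ 2 * (1 - ‖p.coord‖ ^ 2) := by
      have h1 := pow_le_pow_left₀ (zero_le_one.trans (one_le_coshDist x p)) hm 2
      simp only [coshDist, div_pow, mul_pow] at h1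
      rw [Real.sq_sqrt hx1.le, Real.sq_sqrt hp1.le, Real.sq_sqrt hr1.le,
        div_le_div_iff₀ (by positivity) (by positivity)] at h1
      rw [← hα] at h1
      have h2 : (1 - ‖x.coord‖ ^ 2) * (α ^ 2 * (1 - ‖r.coord‖ ^ 2)) ≤ (1 - ‖x.coord‖ ^ 2) *
          ((1 - ⟪x.coord, r.coord⟫) ^ 2 * (1 - ‖p.coord‖ ^ 2)) := by linarith
      exact le_of_mul_le_mul_left h2 hx1
    rw [e1, e2] at hm2
    have : 0 ≤ t * (2 * (1 - t) * α * (β * (1 - ‖p.coord‖ ^ 2) - α * γ)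
      + t * (β ^ 2 * (1 - ‖p.coord‖ ^ 2) - α ^ 2 * (1 - ‖q.coord‖ ^ 2))) := by linarith
    exact nonneg_of_mul_nonneg_right this ht0
  have hcont : Tendsto (fun t : ℝ => 2 * (1 - t) * α * (β * (1 - ‖p.coord‖ ^ 2) - α * γ)
      + t * (β ^ 2 * (1 - ‖p.coord‖ ^ 2) - α ^ 2 * (1 - ‖q.coord‖ ^ 2))) (𝓝[>] 0)
      (𝓝 (2 * (1 - 0) * α * (β * (1 - ‖p.coord‖ ^ 2) - α * γ)
      + 0 * (β ^ 2 * (1 - ‖p.coord‖ ^ 2) - α ^ 2 * (1 - ‖q.coord‖ ^ 2)))) := by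
    apply Tendsto.mono_left _ nhdsWithin_le_nhds
    apply Continuous.tendsto
    fun_prop
  have h0 := ge_of_tendsto hcont
    (by filter_upwards [Ioc_mem_nhdsGT (zero_lt_one' ℝ)] with t ht using key t ht)
  have : 0 ≤ (2 * α) * (β * (1 - ‖p.coord‖ ^ 2) - α * γ) := by linarith
  have := nonneg_of_mul_nonneg_right this (by positivity)
  linarith

/-- The nearest-point projection to a compact convex set: it does not increase distances, and
maps the points outside of the interior to the boundary. -/
theorem exists_projection {K : Set (HypSpace n)} (hK : IsCompact K) (hne : K.Nonempty)
    (hc : Convex ℝ (coord '' K)) : ∃ π : HypSpace n → HypSpace n,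
      (∀ x, π x ∈ K) ∧ (∀ x, ∀ q ∈ K, dist x (π x) ≤ dist x q) ∧ (∀ x ∈ K, π x = x) ∧
      LipschitzWith 1 π ∧ ∀ x, x ∉ interior K → π x ∈ frontier K := by
  choose π hπK hπ using exists_nearest hK hne
  have hfix : ∀ x ∈ K, π x = x := fun x hx => by
    have := hπ x x hx
    rw [dist_self] at this
    exact (dist_le_zero.1 this).symm
  refine ⟨π, hπK, hπ, hfix, ?_, fun x hx => ?_⟩
  · refine LipschitzWith.of_dist_le_mul fun x y => ?_
    rw [NNReal.coe_one, one_mul]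
    apply dist_le_dist_of_obtuse
    · exact obtuse_of_nearest hc (hπK x) (hπK y) (hπ x)
    · rw [coshDist_comm (π x)]
      exact obtuse_of_nearest hc (hπK y) (hπK x) (hπ y)
  -- If the projection were interior, a short step from it towards `x` would stay in `K` and come
  -- strictly closer to `x`.
  · rw [hK.isClosed.frontier_eq]
    refine ⟨hπK x, fun hint => ?_⟩
    have hne : π x ≠ x := fun h => hx (h ▸ hint)
    set p := π x with hp
    have h1 : ∀ᶠ t in 𝓝[>] (0 : ℝ), p.coord + t • (x.coord - p.coord) ∈ coord '' K := by
      have hcont : Tendsto (fun t : ℝ => p.coord + t • (x.coord - p.coord)) (𝓝[>] 0)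
          (𝓝 (p.coord + (0 : ℝ) • (x.coord - p.coord))) := by
        apply Tendsto.mono_left _ nhdsWithin_le_nhds
        apply Continuous.tendsto
        fun_prop
      rw [zero_smul, add_zero] at hcont
      exact hcont (mem_interior_iff_mem_nhds.1 (mem_interior_iff_coord.1 hint))
    obtain ⟨t, ⟨r, hr, hrc⟩, ht0, ht1⟩ := (h1.and (Ioc_mem_nhdsGT (zero_lt_one' ℝ))).exists
    have h2 := dist_add_dist_of_coord_eq ht0.le ht1 hrc
    have h3 := hπ x r hr
    rw [← hp, dist_comm x p, dist_comm x r] at h3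
    have h4 : p = r := dist_le_zero.1 (by linarith)
    rw [← h4, left_eq_add, smul_eq_zero] at hrc
    rcases hrc with h | h
    · exact ht0.ne' h
    · exact hne (injective_coord (sub_eq_zero.1 h)).symm

end HypSpace

/-! ### Lengths of paths -/

section Length

variable {X Y : Type*} [PseudoEMetricSpace X] [PseudoEMetricSpace Y]

/-- The infimum of the lengths of the paths between two points in a subset. -/
def lenDist (S : Set X) (x y : X) : ℝ≥0∞ :=
  ⨅ (γ : Path x y) (_ : ∀ t, γ t ∈ S), eVariationOn γ Set.univ

theorem edist_le_eVariationOn_path {x y : X} (γ : Path x y) :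
    edist x y ≤ eVariationOn γ Set.univ := by
  have := eVariationOn.edist_le γ (Set.mem_univ (0 : unitInterval)) (Set.mem_univ 1)
  rwa [γ.source, γ.target] at this

theorem lenDist_le_of_path {S : Set X} {x y : X} (γ : Path x y) (h : ∀ t, γ t ∈ S) :
    lenDist S x y ≤ eVariationOn γ Set.univ :=
  iInf₂_le γ h

theorem lenDist_eq_iInf_subtype (S : Set X) (x y : X) :
    lenDist S x y = ⨅ γ : {γ : Path x y // ∀ t, γ t ∈ S}, eVariationOn γ.1 Set.univ :=
  iInf_subtype' (p := fun γ : Path x y => ∀ t, γ t ∈ S)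
    (f := fun γ _ => eVariationOn γ Set.univ)

theorem edist_le_lenDist (S : Set X) (x y : X) : edist x y ≤ lenDist S x y :=
  le_iInf₂ fun γ _ => edist_le_eVariationOn_path γ

theorem innerEDist_eq_lenDist_univ (x y : X) : innerEDist x y = lenDist Set.univ x y := by
  simp [innerEDist, lenDist]

theorem edist_le_innerEDist (x y : X) : edist x y ≤ innerEDist x y := by
  rw [innerEDist_eq_lenDist_univ]
  exact edist_le_lenDist _ _ _

theorem lenDist_self {S : Set X} {x : X} (hx : x ∈ S) : lenDist S x x = 0 := by
  refine le_antisymm ((lenDist_le_of_path (Path.refl x) fun _ => hx).trans ?_) zero_le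
  apply le_of_eq
  apply eVariationOn.constant_on
  rintro _ ⟨_, -, rfl⟩ _ ⟨_, -, rfl⟩
  rfl

theorem lenDist_comm (S : Set X) (x y : X) : lenDist S x y = lenDist S y x := by
  have h : ∀ x y : X, lenDist S x y ≤ lenDist S y x := fun x y => by
    refine le_iInf₂ fun γ hγ => ?_
    refine (lenDist_le_of_path γ.symm fun t => hγ _).trans ?_
    exact eVariationOn.comp_le_of_antitoneOn γ unitInterval.symm
      (fun a _ b _ hab => unitInterval.symm_le_symm.2 hab) (fun _ _ => Set.mem_univ _)
  exact le_antisymm (h x y) (h y x)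

theorem eVariationOn_trans_le {x y z : X} (γ : Path x y) (γ' : Path y z) :
    eVariationOn (γ.trans γ') Set.univ
      ≤ eVariationOn γ Set.univ + eVariationOn γ' Set.univ := by
  set m : unitInterval := ⟨1 / 2, by norm_num, by norm_num⟩ with hm
  have hu : (Set.univ : Set unitInterval) = Set.Iic m ∪ Set.Ici m := Set.Iic_union_Ici.symm
  rw [hu, eVariationOn.union _ isGreatest_Iic isLeast_Ici, ← hu]
  have hcomp1 : Set.EqOn (γ.trans γ')
      (γ ∘ fun t : unitInterval => Set.projIcc (0 : ℝ) 1 zero_le_one (2 * t)) (Set.Iic m) := by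
    intro t ht
    have ht' : (t : ℝ) ≤ 1 / 2 := ht
    rw [Path.trans_apply, dif_pos ht', Function.comp_apply, Set.projIcc_of_mem]
  have hcomp2 : Set.EqOn (γ.trans γ')
      (γ' ∘ fun t : unitInterval => Set.projIcc (0 : ℝ) 1 zero_le_one (2 * t - 1))
      (Set.Ici m) := by
    intro t ht
    have ht' : 1 / 2 ≤ (t : ℝ) := ht
    rw [Path.trans_apply]
    -- At `t = 1/2` the concatenation still follows the first path; both formulas give the common
    -- point `y`.
    split_ifs with h
    · have h2 : (t : ℝ) = 1 / 2 := le_antisymm h ht'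
      simp only [Function.comp_apply, h2]
      norm_num
    · rw [Function.comp_apply, Set.projIcc_of_mem]
  rw [eVariationOn.congr hcomp1, eVariationOn.congr hcomp2]
  refine add_le_add (eVariationOn.comp_le_of_monotoneOn _ _ ?_ fun _ _ => Set.mem_univ _)
    (eVariationOn.comp_le_of_monotoneOn _ _ ?_ fun _ _ => Set.mem_univ _)
  · intro a _ b _ hab
    have : (a : ℝ) ≤ b := hab
    exact Set.monotone_projIcc _ (by linarith)
  · intro a _ b _ hab
    have : (a : ℝ) ≤ b := hab
    exact Set.monotone_projIcc _ (by linarith)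

theorem lenDist_triangle (S : Set X) (x y z : X) :
    lenDist S x z ≤ lenDist S x y + lenDist S y z := by
  rw [lenDist_eq_iInf_subtype S x y, lenDist_eq_iInf_subtype S y z]
  refine ENNReal.le_iInf_add_iInf fun γ γ' => ?_
  refine (lenDist_le_of_path (γ.1.trans γ'.1) fun t => ?_).trans (eVariationOn_trans_le γ.1 γ'.1)
  rw [Path.trans_apply]
  split_ifs
  · exact γ.2 _
  · exact γ'.2 _

/-- A Lipschitz bound on `S` alone suffices, as the competing paths stay in `S`. The case `C = 0`
has to be excluded: without paths in `S` the right side would be `0 * ⊤ = 0`. -/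
theorem lenDist_le_mul_of_lipschitzOn {S : Set X} {T : Set Y} {f : X → Y} {C : NNReal}
    (hC : C ≠ 0) (hf : LipschitzOnWith C f S) (hST : Set.MapsTo f S T) (x y : X) :
    lenDist T (f x) (f y) ≤ C * lenDist S x y := by
  rw [lenDist_eq_iInf_subtype S, ENNReal.mul_iInf_of_ne (by simpa using hC) ENNReal.coe_ne_top]
  refine le_iInf fun γ => ?_
  have hcont : Continuous (f ∘ γ.1) := hf.continuousOn.comp_continuous γ.1.continuous γ.2
  let γ' : Path (f x) (f y) := ⟨⟨f ∘ γ.1, hcont⟩, by simp, by simp⟩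
  exact (lenDist_le_of_path γ' fun t => hST (γ.2 t)).trans
    (LipschitzOnWith.comp_eVariationOn_le (g := γ.1) hf fun t _ => γ.2 t)

/-- Replaces paths in a subspace by ambient paths that stay in the set, so that paths in the
boundary and in the complement of the interior can be compared. -/
theorem innerEDist_subtype (S : Set X) (x y : S) : innerEDist x y = lenDist S (x : X) y := by
  apply le_antisymm
  · refine le_iInf₂ fun γ hγ => ?_
    exact iInf_le_of_le ⟨⟨fun t => ⟨γ t, hγ t⟩, γ.continuous.subtype_mk hγ⟩,
      Subtype.ext γ.source, Subtype.ext γ.target⟩ le_rfl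
  · refine le_iInf fun γ => ?_
    exact lenDist_le_of_path (γ.map continuous_subtype_val) fun t => (γ t).2

end Length

/-! ### Lengths of Klein segments and of projected paths -/

namespace HypSpace

variable {n : ℕ}

/-- Along a segment distances from the initial point add up, so the variation of the path is that of
the monotone real function `g`, which is the difference of its end values. -/
theorem lenDist_le_edist_of_segment {S : Set (HypSpace n)} {u v : EuclideanSpace ℝ (Fin n)}
    (hu : ‖u‖ < 1) (hv : ‖v‖ < 1) (h : ∀ w ∈ segment ℝ u v, ofCoord w ∈ S) :
    lenDist S (ofCoord u) (ofCoord v) ≤ edist (ofCoord u) (ofCoord v) := by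
  set c : unitInterval → EuclideanSpace ℝ (Fin n) := fun t => u + (t : ℝ) • (v - u) with hc
  have hseg : ∀ t, c t ∈ segment ℝ u v := fun t => by
    rw [segment_eq_image']
    exact ⟨t, t.2, rfl⟩
  have hlt : ∀ t, ‖c t‖ < 1 := fun t => norm_lt_one_of_mem_segment hu hv (hseg t)
  have hcont : Continuous fun t => ofCoord (c t) :=
    continuousOn_ofCoord.comp_continuous (by fun_prop) fun t => by simpa using hlt t
  let γ : Path (ofCoord u) (ofCoord v) :=
    ⟨⟨fun t => ofCoord (c t), hcont⟩, by simp [hc], by simp [hc]⟩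
  refine (lenDist_le_of_path γ fun t => h _ (hseg t)).trans ?_
  have hbet : ∀ s t : unitInterval, s ≤ t →
      dist (ofCoord u) (ofCoord (c s)) + dist (ofCoord (c s)) (ofCoord (c t))
        = dist (ofCoord u) (ofCoord (c t)) := by
    intro s t hst
    have hst' : (s : ℝ) ≤ t := hst
    rcases t.2.1.eq_or_lt with h0 | h0
    · have h1 : (s : ℝ) = 0 := le_antisymm (h0 ▸ hst') s.2.1
      simp [hc, ← h0, h1]
    -- `c s` has parameter `s / t` on the segment from `u` to `c t`; hence the separate case `t =
    -- 0`.
    · refine dist_add_dist_of_coord_eq (t := s / t) (div_nonneg s.2.1 t.2.1)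
        (div_le_one_of_le₀ hst' t.2.1) ?_
      rw [coord_ofCoord hu, coord_ofCoord (hlt _), coord_ofCoord (hlt _), hc]
      simp only [add_sub_cancel_left, smul_smul]
      rw [div_mul_cancel₀ _ h0.ne']
  set g : unitInterval → ℝ := fun t => dist (ofCoord u) (ofCoord (c t)) with hg
  have hmono : Monotone g := fun s t hst => by
    have := hbet s t hst
    have := dist_nonneg (x := ofCoord (c s)) (y := ofCoord (c t))
    simp only [hg]
    linarith
  have hvar : eVariationOn γ Set.univ = eVariationOn g Set.univ := by
    have hle : ∀ s t : unitInterval, s ≤ t → edist (γ t) (γ s) = edist (g t) (g s) := by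
      intro s t hst
      rw [edist_comm, edist_dist, edist_dist, Real.dist_eq,
        abs_of_nonneg (sub_nonneg.2 (hmono hst))]
      congr 1
      exact eq_sub_of_add_eq' (hbet s t hst)
    refine iSup_congr fun p => Finset.sum_congr rfl fun i _ => ?_
    exact hle _ _ (p.2.2.1 (Nat.le_succ i))
  rw [hvar]
  have h1 := hmono.monotoneOn (Set.univ)
  have h2 := (h1.eVariationOn_eq (Set.mem_univ (0 : unitInterval)) (Set.mem_univ 1)).le
  have h3 : (Set.univ : Set unitInterval) ∩ Set.Icc 0 1 = Set.univ := by
    rw [Set.univ_inter]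
    exact Set.eq_univ_of_forall fun t => ⟨t.2.1, t.2.2⟩
  rw [h3] at h2
  refine h2.trans ?_
  rw [edist_dist]
  simp [hg, hc]

theorem lenDist_le_of_segment {S : Set (HypSpace n)} {R : ℝ} (hR : R < 1)
    {u v : EuclideanSpace ℝ (Fin n)} (hu : ‖u‖ ≤ R) (hv : ‖v‖ ≤ R)
    (h : ∀ w ∈ segment ℝ u v, ofCoord w ∈ S) :
    lenDist S (ofCoord u) (ofCoord v) ≤ ENNReal.ofReal ((1 - R ^ 2)⁻¹ * ‖u - v‖) :=
  (lenDist_le_edist_of_segment (hu.trans_lt hR) (hv.trans_lt hR) h).trans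
    (edist_ofCoord_le hR hu hv)

/-- Geodesically convex sets carry an intrinsic metric. -/
theorem lenDist_eq_edist_of_convex {K : Set (HypSpace n)} (hK : Convex ℝ (coord '' K))
    {x y : HypSpace n} (hx : x ∈ K) (hy : y ∈ K) : lenDist K x y = edist x y := by
  apply le_antisymm _ (edist_le_lenDist _ _ _)
  rw [← ofCoord_coord x, ← ofCoord_coord y]
  refine lenDist_le_edist_of_segment x.norm_coord_lt y.norm_coord_lt fun w hw => ?_
  obtain ⟨z, hz, rfl⟩ :=
    hK.segment_subset (Set.mem_image_of_mem _ hx) (Set.mem_image_of_mem _ hy) hw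
  rwa [ofCoord_coord]

/-- Projecting a path outside of a convex body to the boundary does not increase its length. -/
theorem lenDist_frontier_le {K : Set (HypSpace n)} (hK : IsCompact K) (hne : K.Nonempty)
    (hc : Convex ℝ (coord '' K)) {x y : HypSpace n} (hx : x ∈ frontier K) (hy : y ∈ frontier K) :
    lenDist (frontier K) x y ≤ lenDist (interior K)ᶜ x y := by
  obtain ⟨π, -, -, hfix, hlip, hfr⟩ := exists_projection hK hne hc
  have h := lenDist_le_mul_of_lipschitzOn one_ne_zero (hlip.lipschitzOnWith (s := (interior K)ᶜ))
    (fun x hx => hfr x hx) x y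
  rwa [hfix x (hK.isClosed.frontier_subset hx), hfix y (hK.isClosed.frontier_subset hy),
    ENNReal.coe_one, one_mul] at h

end HypSpace

/-! ### Compact metrics and Gromov–Hausdorff convergence -/

/-- The distance function `d` makes `X` a nonempty compact metric space. -/
def IsCompactMetric {X : Type*} (d : X → X → ℝ≥0∞) : Prop :=
  ∃ _m : MetricSpace X, CompactSpace X ∧ Nonempty X ∧ ∀ x y, edist x y = d x y

/-- Here `hf` is continuity of `f`. Meant for spaces that receive a new metric, such as the inner
metric or that of the double, while compactness is known for another topology. -/
theorem compactSpace_of_surjective {Z Y : Type*} [TopologicalSpace Z] [CompactSpace Z]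
    [PseudoEMetricSpace Y] {f : Z → Y} (hs : Function.Surjective f)
    (hf : ∀ z, ∀ ε > 0, ∀ᶠ z' in 𝓝 z, edist (f z') (f z) < ε) : CompactSpace Y := by
  have hc : Continuous f := by
    rw [continuous_iff_continuousAt]
    exact fun z => EMetric.tendsto_nhds.2 (hf z)
  constructor
  rw [← hs.range_eq]
  exact isCompact_range hc

/-- Almost isometries with almost dense image make the Gromov–Hausdorff distance small. They need
not be continuous, so `g` may be built from arbitrary choices. -/
theorem ghTendsto_of_approx {X : ℕ → Type*} {d : ∀ i, X i → X i → ℝ≥0∞} {Y : Type*}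
    {e : Y → Y → ℝ≥0∞} (hX : ∀ i, IsCompactMetric (d i)) (hY : IsCompactMetric e)
    (h : ∀ ε > (0 : ℝ), ∀ᶠ i in atTop, ∃ g : Y → X i,
      (∀ y y', d i (g y) (g y') ≤ e y y' + ENNReal.ofReal ε ∧
        e y y' ≤ d i (g y) (g y') + ENNReal.ofReal ε) ∧
      ∀ x, ∃ y, d i x (g y) ≤ ENNReal.ofReal ε) : GHTendsto d e := by
  choose mX cX nX hX using hX
  obtain ⟨mY, cY, nY, hY⟩ := hY
  refine ⟨mX, mY, cX, cY, nX, nY, hX, hY, ?_⟩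
  rw [Metric.tendsto_atTop]
  intro ε hε
  obtain ⟨N, hN⟩ := eventually_atTop.1 (h (ε / 2) (half_pos hε))
  refine ⟨N, fun i hi => ?_⟩
  obtain ⟨g, hg1, hg2⟩ := hN i hi
  have hε2 : 0 ≤ ε / 2 := (half_pos hε).le
  -- The three terms are the density of the subset (0, as it is all of `Y`), half of the distortion,
  -- and the density of the image.
  have hle : ghDist Y (X i) ≤ 0 + ε / 2 / 2 + ε / 2 := by
    refine ghDist_le_of_approx_subsets (s := Set.univ) (fun y => g y.1) (fun y => ?_)
      (fun x => ?_) fun y y' => ?_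
    · exact ⟨y, Set.mem_univ y, (dist_self y).le⟩
    · obtain ⟨y, hy⟩ := hg2 x
      refine ⟨⟨y, Set.mem_univ y⟩, ?_⟩
      rwa [← hX, edist_dist, ENNReal.ofReal_le_ofReal_iff hε2] at hy
    · obtain ⟨h1, h2⟩ := hg1 y y'
      rw [← hX, ← hY, edist_dist, edist_dist, ← ENNReal.ofReal_add dist_nonneg hε2,
        ENNReal.ofReal_le_ofReal_iff (add_nonneg dist_nonneg hε2)] at h1 h2
      rw [abs_le]
      constructor
      · change _ ≤ dist (y : Y) y' - _
        linarith
      · change dist (y : Y) y' - _ ≤ _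
        linarith
  have hcomm : ghDist (X i) Y = ghDist Y (X i) := dist_comm _ _
  have h0 : 0 ≤ ghDist Y (X i) := dist_nonneg
  rw [Real.dist_eq, sub_zero, hcomm, abs_of_nonneg h0]
  linarith

/-! ### When the inner distance is a compact metric -/

section Inner

variable {X : Type*} [MetricSpace X]

theorem innerEDist_triangle (x y z : X) : innerEDist x z ≤ innerEDist x y + innerEDist y z := by
  simp only [innerEDist_eq_lenDist_univ]
  exact lenDist_triangle _ _ _ _

theorem innerEDist_comm (x y : X) : innerEDist x y = innerEDist y x := by
  simp only [innerEDist_eq_lenDist_univ]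
  exact lenDist_comm _ _ _

theorem innerEDist_self (x : X) : innerEDist x x = 0 := by
  rw [innerEDist_eq_lenDist_univ]
  exact lenDist_self (Set.mem_univ x)

/-- The points at finite inner distance from `x` form a clopen set, since `h` gives every point a
neighbourhood of finite inner radius. -/
theorem innerEDist_ne_top [PreconnectedSpace X]
    (h : ∀ x : X, ∀ ε > 0, ∀ᶠ y in 𝓝 x, innerEDist y x < ε) (x y : X) :
    innerEDist x y ≠ ⊤ := by
  have hcl : IsClopen {y | innerEDist x y < ⊤} := by
    constructor
    · rw [← isOpen_compl_iff, isOpen_iff_mem_nhds]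
      intro y hy
      filter_upwards [h y 1 one_pos] with z hz hz'
      exact hy ((innerEDist_triangle x z y).trans_lt
        (ENNReal.add_lt_top.2 ⟨hz', hz.trans ENNReal.one_lt_top⟩))
    · rw [isOpen_iff_mem_nhds]
      intro y hy
      filter_upwards [h y 1 one_pos] with z hz
      rw [innerEDist_comm] at hz
      exact (innerEDist_triangle x y z).trans_lt
        (ENNReal.add_lt_top.2 ⟨hy, hz.trans ENNReal.one_lt_top⟩)
  have hu := hcl.eq_univ ⟨x, by simp [innerEDist_self]⟩
  have : y ∈ {y | innerEDist x y < ⊤} := hu ▸ Set.mem_univ y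
  exact this.ne

/-- A distance function with finite values, for which a compact topology is fine enough, is a
compact metric. -/
theorem isCompactMetric_of_ne_top {Z Y : Type*} [TopologicalSpace Z] [CompactSpace Z] [Nonempty Z]
    (m : EMetricSpace Y) (hfin : ∀ x y : Y, edist x y ≠ ⊤) {f : Z → Y}
    (hs : Function.Surjective f) (hf : ∀ z, ∀ ε > 0, ∀ᶠ z' in 𝓝 z, edist (f z') (f z) < ε) :
    IsCompactMetric (fun x y : Y => edist x y) :=
  ⟨EMetricSpace.toMetricSpace hfin, compactSpace_of_surjective hs hf,
    Nonempty.map f inferInstance, fun _ _ => rfl⟩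

/-- By `h` the identity is continuous from the original topology to that of the inner distance, so
compactness carries over; distinct points stay apart because `edist ≤ innerEDist`. -/
theorem isCompactMetric_innerEDist [CompactSpace X] [PreconnectedSpace X] [Nonempty X]
    (h : ∀ x : X, ∀ ε > 0, ∀ᶠ y in 𝓝 x, innerEDist y x < ε) :
    IsCompactMetric (fun x y : X => innerEDist x y) := by
  let m : EMetricSpace X :=
    { edist := innerEDist
      edist_self := innerEDist_self
      edist_comm := innerEDist_comm
      edist_triangle := innerEDist_triangle
      eq_of_edist_eq_zero := fun {x y} hxy =>
        edist_le_zero.1 ((edist_le_innerEDist x y).trans hxy.le) }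
  exact isCompactMetric_of_ne_top (Z := X) m (innerEDist_ne_top h) (f := id)
    Function.surjective_id h

theorem isCompactMetric_edist [CompactSpace X] [Nonempty X] :
    IsCompactMetric (fun x y : X => edist x y) :=
  ⟨inferInstance, inferInstance, inferInstance, fun _ _ => rfl⟩

end Inner

/-! ### Convex sets in Euclidean space -/

section Convex

variable {E : Type*} [NormedAddCommGroup E] [InnerProductSpace ℝ E]

theorem Convex.exists_unit_separating [CompleteSpace E] {A T : Set E} (hA : Convex ℝ A)
    (hint : (interior A).Nonempty) (hT : Convex ℝ T) (hTne : T.Nonempty)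
    (hd : Disjoint (interior A) T) :
    ∃ ν : E, ‖ν‖ = 1 ∧ ∀ a ∈ A, ∀ b ∈ T, ⟪ν, a - b⟫ ≤ 0 := by
  obtain ⟨f, u, hf, h1, h2⟩ := geometric_hahn_banach_of_nonempty_interior hA hT hd hint hTne
  set v := (InnerProductSpace.toDual ℝ E).symm f with hv
  have hfv : ∀ x, ⟪v, x⟫ = f x := fun x => InnerProductSpace.toDual_symm_apply
  have hv0 : v ≠ 0 := by simpa [hv] using hf
  refine ⟨‖v‖⁻¹ • v, norm_smul_inv_norm hv0, fun a ha b hb => ?_⟩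
  rw [inner_smul_left, conj_trivial, hfv, map_sub]
  refine mul_nonpos_of_nonneg_of_nonpos (by positivity) ?_
  linarith [h1 a ha, h2 b hb]

theorem Convex.exists_unit_normal [CompleteSpace E] {A : Set E} (hA : Convex ℝ A)
    (hint : (interior A).Nonempty) {x : E} (hx : x ∉ interior A) :
    ∃ ν : E, ‖ν‖ = 1 ∧ ∀ a ∈ A, ⟪ν, a - x⟫ ≤ 0 := by
  obtain ⟨ν, h1, h2⟩ := hA.exists_unit_separating hint (convex_singleton x)
    (Set.singleton_nonempty x) (Set.disjoint_singleton_right.2 hx)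
  exact ⟨ν, h1, fun a ha => h2 a ha x rfl⟩

/-- Expanding by a homothety moves the points outside of a convex set away from it. -/
theorem Convex.notMem_of_norm_sub_homothety_lt {A : Set E} (hA : Convex ℝ A) {o x z : E} {r s : ℝ}
    (hball : Metric.ball o r ⊆ A) (hx : x ∉ interior A) (hs : 0 < s)
    (hz : ‖z - (x + s • (x - o))‖ < s * r) : z ∉ A := by
  intro hzA
  apply hx
  set e := z - (x + s • (x - o)) with he
  have h1 : o - s⁻¹ • e ∈ interior A := by
    apply interior_maximal hball Metric.isOpen_ball
    rw [Metric.mem_ball, dist_eq_norm, sub_sub_cancel_left, norm_neg, norm_smul, norm_inv,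
      Real.norm_of_nonneg hs.le, inv_mul_lt_iff₀ hs]
    exact hz
  -- From `(1 + s) x = z + s (o - s⁻¹ e)`, the point `x` is a proper convex combination of `z ∈ A`
  -- and an interior point, hence interior.
  have h2 := hA.combo_self_interior_mem_interior hzA h1 (a := (1 + s)⁻¹) (b := s * (1 + s)⁻¹)
    (by positivity) (by positivity) (by field_simp)
  convert h2 using 1
  have h3 : z = x + s • (x - o) + e := by rw [he]; abel
  rw [h3]
  match_scalars <;> field_simp <;> ring

/-- If `z` in the ball were missing from `A`, pushing it by `r` along a normal that separates it
from `A` would give a point of `C` at distance at least `r > δ` from all of `A`. -/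
theorem Convex.ball_subset_of_near [CompleteSpace E] {A C : Set E} (hA : Convex ℝ A)
    (hint : (interior A).Nonempty) {o : E} {r δ : ℝ} (hr : 0 < r) (hδ : δ < r)
    (hC : Metric.ball o (2 * r) ⊆ C)
    (hCA : ∀ k ∈ C, ∃ a ∈ A, ‖a - k‖ ≤ δ) : Metric.ball o r ⊆ A := by
  intro z hz
  by_contra hzA
  obtain ⟨ν, hν, hνA⟩ := hA.exists_unit_normal hint fun h => hzA (interior_subset h)
  obtain ⟨a, ha, hka⟩ := hCA (z + r • ν) (hC (by
    rw [Metric.mem_ball, dist_eq_norm] at hz ⊢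
    calc ‖z + r • ν - o‖ ≤ ‖z - o‖ + ‖r • ν‖ := by
          rw [add_sub_right_comm]; exact norm_add_le _ _
      _ < 2 * r := by
          rw [norm_smul, hν, Real.norm_of_nonneg hr.le]; linarith))
  have h1 := hνA a ha
  have h2 := (abs_le.1 (abs_real_inner_le_norm ν (a - (z + r • ν)))).1
  rw [hν, one_mul, ← sub_sub, inner_sub_right, inner_smul_right, real_inner_self_eq_norm_sq,
    hν] at h2
  rw [← sub_sub] at hka
  linarith

theorem IsCompact.exists_last_mem {A : Set E} (hA : IsCompact A) {a w : E} (ha : a ∈ A)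
    (hw : ‖w‖ = 1) : ∃ t : ℝ, 0 ≤ t ∧ a + t • w ∈ A ∧ ∀ s > t, a + s • w ∉ A := by
  have hcont : Continuous fun t : ℝ => a + t • w := by fun_prop
  have hcl : IsClosed ((fun t : ℝ => a + t • w) ⁻¹' A) := hA.isClosed.preimage hcont
  obtain ⟨B, hB⟩ := hA.isBounded.exists_norm_le
  have hbd : BddAbove ((fun t : ℝ => a + t • w) ⁻¹' A) := by
    refine ⟨B + ‖a‖, fun t ht => ?_⟩
    have h1 := hB _ ht
    have h2 : ‖t • w‖ ≤ ‖a + t • w‖ + ‖a‖ := by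
      calc ‖t • w‖ = ‖(a + t • w) - a‖ := by rw [add_sub_cancel_left]
        _ ≤ _ := norm_sub_le _ _
    rw [norm_smul, hw, mul_one] at h2
    exact (Real.le_norm_self t).trans (by linarith)
  have hne : (0 : ℝ) ∈ ((fun t : ℝ => a + t • w) ⁻¹' A) := by simpa using ha
  refine ⟨sSup ((fun t : ℝ => a + t • w) ⁻¹' A), le_csSup hbd hne, hcl.csSup_mem ⟨0, hne⟩ hbd,
    fun s hs hsA => ?_⟩
  exact absurd (le_csSup hbd hsA) (not_le.2 hs)

theorem notMem_interior_of_forall_notMem {A : Set E} {u w : E}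
    (h : ∀ s > (0 : ℝ), u + s • w ∉ A) : u ∉ interior A := by
  intro hu
  have hcont : Tendsto (fun t : ℝ => u + t • w) (𝓝[>] 0) (𝓝 (u + (0 : ℝ) • w)) := by
    apply Tendsto.mono_left _ nhdsWithin_le_nhds
    apply Continuous.tendsto
    fun_prop
  rw [zero_smul, add_zero] at hcont
  have h1 : ∀ᶠ t : ℝ in 𝓝[>] 0, u + t • w ∈ A := hcont (mem_interior_iff_mem_nhds.1 hu)
  obtain ⟨t, ht, ht0⟩ := (h1.and self_mem_nhdsWithin).exists
  exact h t ht0 ht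

/-! ### Relative boundaries -/

/-- The parameters in `[0, 1]` that land in `C` form a nonempty proper subset of a connected space,
which has a frontier point; its image lies in the frontier relative to the affine span. -/
theorem exists_mem_intrinsicFrontier_segment {C : Set E} {p q : E} (hp : p ∈ C)
    (hq : q ∈ affineSpan ℝ C) (hqC : q ∉ C) :
    ∃ z ∈ intrinsicFrontier ℝ C, z ∈ segment ℝ p q := by
  have hpC := subset_affineSpan ℝ C hp
  have hmem : ∀ t : ℝ, AffineMap.lineMap p q t ∈ affineSpan ℝ C := fun t =>
    AffineMap.lineMap_mem t hpC hq
  let g : unitInterval → affineSpan ℝ C := fun t => ⟨AffineMap.lineMap p q (t : ℝ), hmem t⟩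
  have hg : Continuous g :=
    (AffineMap.lineMap_continuous.comp continuous_subtype_val).subtype_mk _
  obtain ⟨t, ht⟩ : (frontier (g ⁻¹' ((↑) ⁻¹' C))).Nonempty := by
    rw [nonempty_frontier_iff]
    refine ⟨⟨0, by simpa [g] using hp⟩, fun h => ?_⟩
    have : (1 : unitInterval) ∈ g ⁻¹' ((↑) ⁻¹' C) := h ▸ Set.mem_univ _
    exact hqC (by simpa [g] using this)
  refine ⟨_, mem_intrinsicFrontier.2 ⟨g t, hg.frontier_preimage_subset _ ht, rfl⟩, ?_⟩
  rw [segment_eq_image_lineMap]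
  exact ⟨t, t.2, rfl⟩

/-- Near the points of the relative boundary of a closed convex set there are points with a relative
unit normal. -/
theorem exists_relative_normal_near [CompleteSpace E] {C : Set E} (hC : Convex ℝ C)
    (hcl : IsClosed C) {z : E} (hz : z ∈ intrinsicFrontier ℝ C) {η : ℝ} (hη : 0 < η) :
    ∃ p ∈ C, ‖p - z‖ ≤ η ∧ ∃ m ∈ (affineSpan ℝ C).direction, ‖m‖ = 1 ∧
      ∀ k ∈ C, ⟪m, k - p⟫ ≤ 0 := by
  have hzC := intrinsicFrontier_subset hcl hz
  obtain ⟨z', hz', rfl⟩ := mem_intrinsicFrontier.1 hz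
  have hzcl : z' ∈ closure ((↑) ⁻¹' C : Set (affineSpan ℝ C))ᶜ :=
    frontier_subset_closure (by rwa [frontier_compl])
  -- Take `q` in the affine span, outside `C` and close to `z'`. Its nearest point `p` in `C` has
  -- the relative normal `q - p` and lies within `2 ‖q - z'‖` of `z'`.
  obtain ⟨q, hq, hqz⟩ := Metric.mem_closure_iff.1 hzcl (η / 2) (half_pos hη)
  have hqC : (q : E) ∉ C := hq
  obtain ⟨p, hp, hmin⟩ := exists_norm_eq_iInf_of_complete_convex ⟨_, hzC⟩ hcl.isComplete hC (q : E)
  have hin := (norm_eq_iInf_iff_real_inner_le_zero hC hp).1 hmin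
  have hqp : (q : E) - p ≠ 0 := fun h => hqC (sub_eq_zero.1 h ▸ hp)
  have hle : ‖(q : E) - p‖ ≤ ‖(q : E) - z'‖ := by
    rw [hmin]
    exact ciInf_le ⟨0, by rintro _ ⟨_, rfl⟩; exact norm_nonneg _⟩ (⟨z', hzC⟩ : C)
  have hqz' : ‖(q : E) - z'‖ < η / 2 := by
    rw [← dist_eq_norm, dist_comm]
    exact hqz
  refine ⟨p, hp, ?_, ‖(q : E) - p‖⁻¹ • ((q : E) - p), ?_, norm_smul_inv_norm hqp, fun k hk => ?_⟩
  · calc ‖p - z'‖ = ‖((q : E) - z') - (q - p)‖ := by congr 1; abel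
      _ ≤ ‖(q : E) - z'‖ + ‖(q : E) - p‖ := norm_sub_le _ _
      _ ≤ η := by linarith
  · refine Submodule.smul_mem _ _ ?_
    exact AffineSubspace.vsub_mem_direction q.2 (subset_affineSpan ℝ C hp)
  · rw [inner_smul_left, conj_trivial]
    exact mul_nonpos_of_nonneg_of_nonpos (by positivity) (hin k hk)

/-- If the body `A` is close to the convex set `C` of codimension one with normal `w`, then a point
near `C`, whose line of direction `w` misses the interior of `A`, is close to the relative boundary
of `C`. -/
theorem exists_mem_intrinsicFrontier_near [CompleteSpace E] {A C : Set E} (hA : Convex ℝ A)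
    (hint : (interior A).Nonempty) {w : E} {δ : ℝ} (hδ : 0 < δ)
    (hdir : ∀ m : E, ⟪m, w⟫ = 0 → m ∈ (affineSpan ℝ C).direction)
    (hCA : ∀ k ∈ C, ∃ a ∈ A, ‖a - k‖ ≤ δ) {v p : E} (hp : p ∈ C) (hvp : ‖v - p‖ ≤ δ)
    (hline : ∀ t : ℝ, v + t • w ∉ interior A) :
    ∃ z ∈ intrinsicFrontier ℝ C, ‖z - v‖ ≤ 4 * δ := by
  have hT : Convex ℝ (Set.range fun t : ℝ => v + t • w) := by
    have : (Set.range fun t : ℝ => v + t • w)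
        = (AffineMap.lineMap v (v + w) : ℝ →ᵃ[ℝ] E) '' Set.univ := by
      rw [Set.image_univ]
      congr 1
      ext t
      simp [AffineMap.lineMap_apply, add_comm]
    rw [this]
    exact convex_univ.affine_image _
  obtain ⟨m, hm1, hm⟩ := hA.exists_unit_separating hint hT (Set.range_nonempty _) (by
    rw [Set.disjoint_right]
    rintro _ ⟨t, rfl⟩
    exact hline t)
  -- The functional `⟪m, ·⟫` is bounded below on the whole line, hence constant along it.
  have hmw : ⟪m, w⟫ = 0 := by
    by_contra h
    obtain ⟨a, ha⟩ := hint
    have h1 := hm a (interior_subset ha) _ ⟨(⟪m, a - v⟫ - 1) / ⟪m, w⟫, rfl⟩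
    rw [← sub_sub, inner_sub_right, inner_smul_right, div_mul_cancel₀ _ h] at h1
    linarith
  have hmA : ∀ a ∈ A, ⟪m, a - v⟫ ≤ 0 := fun a ha => hm a ha v ⟨0, by simp⟩
  -- Measured by `m` from `v`, points of `A` have height at most 0 and points of `C` at most `δ`,
  -- whereas this point has height at least `3 δ - ‖v - p‖ ≥ 2 δ`.
  have hq : p + (3 * δ) • m ∉ C := by
    intro hq
    obtain ⟨a, ha, hka⟩ := hCA _ hq
    have h1 := hmA a ha
    have h2 := (abs_le.1 (abs_real_inner_le_norm m (a - (p + (3 * δ) • m)))).1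
    have h3 := (abs_le.1 (abs_real_inner_le_norm m (v - p))).2
    have h4 : a - (p + (3 * δ) • m) = (a - v) + (v - p) - (3 * δ) • m := by abel
    rw [hm1, one_mul] at h2 h3
    have h5 : ⟪m, a - (p + (3 * δ) • m)⟫ = ⟪m, a - v⟫ + ⟪m, v - p⟫ - 3 * δ := by
      rw [h4, inner_sub_right, inner_add_right, inner_smul_right, real_inner_self_eq_norm_sq, hm1]
      ring
    linarith
  have hqs : p + (3 * δ) • m ∈ affineSpan ℝ C := by
    rw [add_comm]
    exact AffineSubspace.vadd_mem_of_mem_direction (Submodule.smul_mem _ _ (hdir m hmw))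
      (subset_affineSpan ℝ C hp)
  obtain ⟨z, hz, hzs⟩ := exists_mem_intrinsicFrontier_segment hp hqs hq
  refine ⟨z, hz, ?_⟩
  rw [segment_eq_image'] at hzs
  obtain ⟨t, ⟨ht0, ht1⟩, rfl⟩ := hzs
  calc ‖p + t • (p + (3 * δ) • m - p) - v‖ = ‖-(v - p) + t • (3 * δ) • m‖ := by
        congr 1; rw [add_sub_cancel_left]; abel
    _ ≤ ‖v - p‖ + t * (3 * δ) := by
        refine (norm_add_le _ _).trans ?_
        rw [norm_neg, norm_smul, norm_smul, hm1, Real.norm_of_nonneg ht0,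
          Real.norm_of_nonneg (by positivity), mul_one]
    _ ≤ 4 * δ := by nlinarith

end Convex

namespace HypSpace

variable {n : ℕ}

/-! ### Boundaries of convex bodies -/

theorem isCompact_image_coord {K : Set (HypSpace n)} (hK : IsCompact K) :
    IsCompact (coord '' K) :=
  hK.image continuous_coord

theorem exists_norm_coord_le {K : Set (HypSpace n)} (hK : IsCompact K) :
    ∃ R : ℝ, 0 < R ∧ R < 1 ∧ ∀ x ∈ K, ‖x.coord‖ ≤ R := by
  rcases K.eq_empty_or_nonempty with rfl | hne
  · exact ⟨1 / 2, by norm_num, by norm_num, by simp⟩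
  · obtain ⟨x, hx, hmax⟩ := hK.exists_isMaxOn hne
      (continuous_norm.comp continuous_coord).continuousOn
    obtain ⟨R, h1, h2⟩ := exists_between x.norm_coord_lt
    exact ⟨R, (norm_nonneg _).trans_lt h1, h2, fun y hy => (hmax hy).trans h1.le⟩

theorem ofCoord_mem_compl_interior {K : Set (HypSpace n)} {w : EuclideanSpace ℝ (Fin n)}
    (hw : ‖w‖ < 1) (h : w ∉ interior (coord '' K)) : ofCoord w ∈ (interior K)ᶜ := by
  rwa [Set.mem_compl_iff, mem_interior_iff_coord, coord_ofCoord hw]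

theorem mem_frontier_iff_coord {K : Set (HypSpace n)} (hK : IsCompact K) {x : HypSpace n} :
    x ∈ frontier K ↔ x.coord ∈ frontier (coord '' K) := by
  rw [hK.isClosed.frontier_eq, (isCompact_image_coord hK).isClosed.frontier_eq, Set.mem_sdiff,
    Set.mem_sdiff, mem_image_coord, mem_interior_iff_coord]

theorem nonempty_of_dim {K : Set (HypSpace n)} (hn : n ≠ 0) (hdim : dim K = n) : K.Nonempty := by
  rw [Set.nonempty_iff_ne_empty]
  rintro rfl
  apply hn
  rw [← hdim, dim]
  simp

theorem interior_nonempty_of_dim {K : Set (HypSpace n)} (hn : n ≠ 0) (hc : Convex ℝ (coord '' K))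
    (hdim : dim K = n) : (interior (coord '' K)).Nonempty := by
  rw [hc.interior_nonempty_iff_affineSpan_eq_top]
  have h1 : (affineSpan ℝ (coord '' K)).direction = ⊤ := by
    apply Submodule.eq_top_of_finrank_eq
    rw [finrank_euclideanSpace_fin]
    exact hdim
  rwa [AffineSubspace.direction_eq_top_iff_of_nonempty] at h1
  exact ((nonempty_of_dim hn hdim).image _).affineSpan ℝ

/-- Near points of the boundary of a convex body are near with respect to the inner distance. -/
theorem lenDist_compl_interior_le {K : Set (HypSpace n)} (hc : Convex ℝ (coord '' K))
    {o x y : EuclideanSpace ℝ (Fin n)} {r R R' : ℝ} (hr : 0 < r) (hR' : R' < 1)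
    (hball : Metric.ball o r ⊆ coord '' K) (hx : x ∉ interior (coord '' K))
    (hy : y ∉ interior (coord '' K)) (hxR : ‖x‖ ≤ R) (hyR : ‖y‖ ≤ R) (hoR : ‖o‖ ≤ R)
    (h1 : 4 / r * ‖x - y‖ ≤ R' - R) (h2 : 2 * ‖x - y‖ < r) :
    lenDist (interior K)ᶜ (ofCoord x) (ofCoord y)
      ≤ ENNReal.ofReal ((1 - R' ^ 2)⁻¹ * (8 / r + 2) * ‖x - y‖) := by
  have hR0 : 0 ≤ R := (norm_nonneg _).trans hxR
  set e := ‖x - y‖ with he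
  rcases (norm_nonneg (x - y)).eq_or_lt with he0 | he0
  · have hxy : x = y := sub_eq_zero.1 (norm_eq_zero.1 he0.symm)
    rw [hxy, lenDist_self]
    · exact zero_le
    · have hRR' : R ≤ R' := by
        rw [he, ← he0, mul_zero] at h1
        linarith
      exact ofCoord_mem_compl_interior (hyR.trans_lt (hRR'.trans_lt hR')) hy
  rw [← he] at he0
  have hre : 0 < 4 / r * e := by positivity
  have hRR' : R < R' := by linarith
  have hM : 0 < (1 - R' ^ 2)⁻¹ := by
    apply inv_pos.2
    nlinarith
  -- Both points are pushed outwards by the homothety and then joined. Since `s r = 2 e` exceeds `(1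
  -- + s) e`, the distance of the pushed points, the joining segment misses the interior.
  set s := 2 * e / r with hs
  have hs0 : 0 < s := by positivity
  have hs1 : s < 1 := by rwa [hs, div_lt_one hr]
  have hsr : s * r = 2 * e := by rw [hs]; field_simp
  have hs4 : s * 2 ≤ R' - R := by
    calc s * 2 = 4 / r * e := by rw [hs]; ring
      _ ≤ _ := h1
  have hsub : ∀ v : EuclideanSpace ℝ (Fin n), ‖v‖ ≤ R → ‖v - o‖ ≤ 2 := fun v hv =>
    (norm_sub_le _ _).trans (by linarith)
  have hnorm : ∀ v : EuclideanSpace ℝ (Fin n), ‖v‖ ≤ R → ‖v + s • (v - o)‖ ≤ R' := by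
    intro v hv
    calc ‖v + s • (v - o)‖ ≤ ‖v‖ + s * ‖v - o‖ := by
          refine (norm_add_le _ _).trans ?_
          rw [norm_smul, Real.norm_of_nonneg hs0.le]
      _ ≤ R + s * 2 := add_le_add hv (mul_le_mul_of_nonneg_left (hsub v hv) hs0.le)
      _ ≤ R' := by linarith
  have hleg : ∀ v : EuclideanSpace ℝ (Fin n), ‖v‖ ≤ R → v ∉ interior (coord '' K) →
      lenDist (interior K)ᶜ (ofCoord v) (ofCoord (v + s • (v - o)))
        ≤ ENNReal.ofReal ((1 - R' ^ 2)⁻¹ * (4 / r * e)) := by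
    intro v hv hvK
    refine (lenDist_le_of_segment hR' (hv.trans hRR'.le) (hnorm v hv) fun w hw => ?_).trans ?_
    · have hw1 := norm_lt_one_of_mem_segment (hv.trans_lt (hRR'.trans hR'))
        ((hnorm v hv).trans_lt hR') hw
      apply ofCoord_mem_compl_interior hw1
      rw [segment_eq_image'] at hw
      obtain ⟨t, ⟨ht0, ht1⟩, rfl⟩ := hw
      rcases ht0.eq_or_lt with rfl | ht0
      · simpa using hvK
      · refine fun h => hc.notMem_of_norm_sub_homothety_lt (s := t * s) hball hvK (by positivity)
          ?_ (interior_subset h)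
        simp only [add_sub_cancel_left, smul_smul, sub_self, norm_zero]
        positivity
    · apply ENNReal.ofReal_le_ofReal
      apply mul_le_mul_of_nonneg_left _ hM.le
      rw [sub_add_cancel_left, norm_neg, norm_smul, Real.norm_of_nonneg hs0.le]
      calc s * ‖v - o‖ ≤ s * 2 := mul_le_mul_of_nonneg_left (hsub v hv) hs0.le
        _ = 4 / r * e := by rw [hs]; ring
  have hdiff : (x + s • (x - o)) - (y + s • (y - o)) = (1 + s) • (x - y) := by module
  have hmid : lenDist (interior K)ᶜ (ofCoord (x + s • (x - o))) (ofCoord (y + s • (y - o)))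
      ≤ ENNReal.ofReal ((1 - R' ^ 2)⁻¹ * (2 * e)) := by
    refine (lenDist_le_of_segment hR' (hnorm x hxR) (hnorm y hyR) fun w hw => ?_).trans ?_
    · have hw1 := norm_lt_one_of_mem_segment ((hnorm x hxR).trans_lt hR')
        ((hnorm y hyR).trans_lt hR') hw
      apply ofCoord_mem_compl_interior hw1
      rw [segment_eq_image'] at hw
      obtain ⟨t, ⟨ht0, ht1⟩, rfl⟩ := hw
      refine fun h => hc.notMem_of_norm_sub_homothety_lt (s := s) hball hx hs0 ?_
        (interior_subset h)
      rw [add_sub_cancel_left, ← neg_sub, smul_neg, norm_neg, hdiff, norm_smul, norm_smul,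
        Real.norm_of_nonneg ht0, Real.norm_of_nonneg (by positivity), ← he, hsr]
      have h3 : t * ((1 + s) * e) ≤ 1 * ((1 + s) * e) :=
        mul_le_mul_of_nonneg_right ht1 (by positivity)
      nlinarith
    · apply ENNReal.ofReal_le_ofReal
      apply mul_le_mul_of_nonneg_left _ hM.le
      rw [hdiff, norm_smul, Real.norm_of_nonneg (by positivity), ← he]
      nlinarith
  calc _ ≤ lenDist (interior K)ᶜ (ofCoord x) (ofCoord (x + s • (x - o)))
        + (lenDist (interior K)ᶜ (ofCoord (x + s • (x - o))) (ofCoord (y + s • (y - o)))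
        + lenDist (interior K)ᶜ (ofCoord (y + s • (y - o))) (ofCoord y)) :=
      (lenDist_triangle _ _ _ _).trans (add_le_add_right (lenDist_triangle _ _ _ _) _)
    _ ≤ ENNReal.ofReal ((1 - R' ^ 2)⁻¹ * (4 / r * e))
        + (ENNReal.ofReal ((1 - R' ^ 2)⁻¹ * (2 * e))
        + ENNReal.ofReal ((1 - R' ^ 2)⁻¹ * (4 / r * e))) := by
      refine add_le_add (hleg x hxR hx) (add_le_add hmid ?_)
      rw [lenDist_comm]
      exact hleg y hyR hy
    _ = _ := by
      rw [← ENNReal.ofReal_add (by positivity) (by positivity),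
        ← ENNReal.ofReal_add (by positivity) (by positivity)]
      congr 1
      ring

/-- The boundary of a convex body is homeomorphic to the unit sphere, connected as `2 ≤ n`. Needed
for the finiteness of the inner distance. -/
theorem isConnected_frontier {K : Set (HypSpace n)} (hn : 2 ≤ n) (hK : IsCompact K)
    (hc : Convex ℝ (coord '' K)) (hint : (interior (coord '' K)).Nonempty) :
    IsConnected (frontier K) := by
  have hKc := isCompact_image_coord hK
  obtain ⟨h, -, -, h3⟩ :=
    exists_homeomorph_image_interior_closure_frontier_eq_unitBall hc hint hKc.isBounded
  have hrank : 1 < Module.rank ℝ (EuclideanSpace ℝ (Fin n)) := by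
    rw [← Module.finrank_eq_rank, finrank_euclideanSpace_fin]
    exact_mod_cast hn
  have h4 : frontier (coord '' K) = h.symm '' Metric.sphere 0 1 := by
    rw [← h3, ← Set.image_comp]
    simp
  have h5 : IsConnected (frontier (coord '' K)) := by
    rw [h4]
    exact (isConnected_sphere hrank 0 zero_le_one).image _ h.symm.continuous.continuousOn
  have h6 : frontier K = ofCoord '' frontier (coord '' K) := by
    ext x
    rw [mem_frontier_iff_coord hK]
    constructor
    · exact fun hx => ⟨_, hx, ofCoord_coord x⟩
    · rintro ⟨v, hv, rfl⟩
      rwa [coord_ofCoord (norm_lt_of_mem_image_coord (hKc.isClosed.frontier_subset hv))]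
  rw [h6]
  refine h5.image _ (continuousOn_ofCoord.mono fun v hv => ?_)
  simpa using norm_lt_of_mem_image_coord (hKc.isClosed.frontier_subset hv)

/-- The inner distance of the boundary of a convex body is a compact metric. -/
theorem isCompactMetric_frontier {K : Set (HypSpace n)} (hn : 2 ≤ n) (hK : IsCompact K)
    (hc : Convex ℝ (coord '' K)) (hint : (interior (coord '' K)).Nonempty) :
    IsCompactMetric (fun x y : frontier K => innerEDist x y) := by
  have hconn := isConnected_frontier hn hK hc hint
  have hfrK := hK.isClosed.frontier_subset
  have : CompactSpace (frontier K) := isCompact_iff_compactSpace.1 (hK.of_isClosed_subset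
    isClosed_frontier hfrK)
  have : PreconnectedSpace (frontier K) :=
    isPreconnected_iff_preconnectedSpace.1 hconn.isPreconnected
  have : Nonempty (frontier K) := hconn.nonempty.to_subtype
  have hne : K.Nonempty := hconn.nonempty.mono hfrK
  apply isCompactMetric_innerEDist
  intro x ε hε
  obtain ⟨R, hR0, hR1, hR⟩ := exists_norm_coord_le hK
  obtain ⟨R', hRR', hR'⟩ := exists_between hR1
  obtain ⟨o, ho⟩ := hint
  obtain ⟨r, hr, hball⟩ := Metric.isOpen_iff.1 isOpen_interior o ho
  obtain ⟨o', ho', rfl⟩ := interior_subset ho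
  have hcont : Tendsto (fun y : frontier K => ‖y.1.coord - x.1.coord‖) (𝓝 x) (𝓝 0) := by
    have : Continuous fun y : frontier K => ‖y.1.coord - x.1.coord‖ :=
      ((continuous_coord.comp continuous_subtype_val).sub continuous_const).norm
    simpa using this.tendsto x
  have h1 : Tendsto (fun y : frontier K => 4 / r * ‖y.1.coord - x.1.coord‖) (𝓝 x) (𝓝 0) := by
    simpa using hcont.const_mul (4 / r)
  have h2 : Tendsto (fun y : frontier K => 2 * ‖y.1.coord - x.1.coord‖) (𝓝 x) (𝓝 0) := by
    simpa using hcont.const_mul 2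
  have h3 : Tendsto (fun y : frontier K => ENNReal.ofReal ((1 - R' ^ 2)⁻¹ * (8 / r + 2)
      * ‖y.1.coord - x.1.coord‖)) (𝓝 x) (𝓝 0) := by
    simpa using ENNReal.tendsto_ofReal (hcont.const_mul ((1 - R' ^ 2)⁻¹ * (8 / r + 2)))
  filter_upwards [h1.eventually (gt_mem_nhds (sub_pos.2 hRR')), h2.eventually (gt_mem_nhds hr),
    h3.eventually (gt_mem_nhds hε)] with y hy1 hy2 hy3
  rw [innerEDist_subtype]
  refine (lenDist_frontier_le hK hne hc y.2 x.2).trans_lt (lt_of_le_of_lt ?_ hy3)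
  have hnot : ∀ z : frontier K, z.1.coord ∉ interior (coord '' K) := fun z hz =>
    z.2.2 (mem_interior_iff_coord.2 hz)
  have := lenDist_compl_interior_le hc hr hR' (hball.trans interior_subset) (hnot y) (hnot x)
    (hR _ (hfrK y.2)) (hR _ (hfrK x.2)) (hR _ ho') hy1.le hy2
  rwa [ofCoord_coord, ofCoord_coord] at this

end HypSpace

/-! ### Homotheties of the Klein model -/

/-- Turns a bound for the hyperbolic sine of distances, which is what the coordinates provide, into
a Lipschitz bound for the distances. -/
theorem Real.mul_sinh_le_sinh_mul {a d : ℝ} (ha : 1 ≤ a) (hd : 0 ≤ d) :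
    a * Real.sinh d ≤ Real.sinh (a * d) := by
  have h : MonotoneOn (fun t => Real.sinh (a * t) - a * Real.sinh t) (Set.Ici 0) := by
    refine monotoneOn_of_deriv_nonneg (convex_Ici 0) (by fun_prop) (by fun_prop) fun t ht => ?_
    rw [interior_Ici, Set.mem_Ioi] at ht
    have h1 : HasDerivAt (fun t => Real.sinh (a * t) - a * Real.sinh t)
        (Real.cosh (a * t) * a - a * Real.cosh t) t := by
      have h2 : HasDerivAt (fun t : ℝ => a * t) a t := by simpa using (hasDerivAt_id t).const_mul a
      exact h2.sinh.sub ((Real.hasDerivAt_sinh t).const_mul a)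
    rw [h1.deriv]
    have h3 : Real.cosh t ≤ Real.cosh (a * t) := by
      rw [Real.cosh_le_cosh, abs_of_pos ht, abs_of_nonneg (by positivity)]
      nlinarith
    nlinarith
  have := h Set.self_mem_Ici (Set.mem_Ici.2 hd) hd
  simp only [mul_zero, Real.sinh_zero, sub_zero] at this
  linarith

theorem Real.exists_sinh_le {η : ℝ} (hη : 0 < η) : ∃ ρ > 0, Real.sinh ρ ≤ η := by
  have h : Tendsto Real.sinh (𝓝[>] 0) (𝓝 0) := by
    have := Real.continuous_sinh.tendsto 0
    rw [Real.sinh_zero] at this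
    exact this.mono_left nhdsWithin_le_nhds
  obtain ⟨ρ, h1, h2⟩ := ((h.eventually (gt_mem_nhds hη)).and self_mem_nhdsWithin).exists
  exact ⟨ρ, h2, le_of_lt h1⟩

namespace HypSpace

variable {n : ℕ}

/-- The homothety of factor `1 + s` about `o`, in Klein coordinates. -/
def expand (o : EuclideanSpace ℝ (Fin n)) (s : ℝ) (x : HypSpace n) : HypSpace n :=
  ofCoord (x.coord + s • (x.coord - o))

theorem norm_expand_le {o v : EuclideanSpace ℝ (Fin n)} {R s : ℝ} (hR : R < 1) (ho : ‖o‖ ≤ R)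
    (hv : ‖v‖ ≤ R) (hs : 0 ≤ s) : ‖v + s • (v - o)‖ ≤ R + s * 2 := by
  refine (norm_add_le _ _).trans ?_
  rw [norm_smul, Real.norm_of_nonneg hs]
  refine add_le_add hv (mul_le_mul_of_nonneg_left ?_ hs)
  exact (norm_sub_le _ _).trans (by linarith)

/-- The homothety multiplies `x - z` by `1 + s` and changes squared norms and inner products by
`O(s)`. Relative to `1 - ‖·‖² ≥ 1 - R²` such changes are of order `s / (1 - R²)`, which explains the
factor; it tends to 1 as `s → 0`. -/
theorem sinh_dist_expand_le {R s : ℝ} (hR : R < 1) (hs : 0 ≤ s) (hs1 : R + s * 2 < 1)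
    (hs2 : 4 * (s / (1 - R ^ 2)) < 1) {o : EuclideanSpace ℝ (Fin n)} (ho : ‖o‖ ≤ R)
    {x z : HypSpace n} (hx : ‖x.coord‖ ≤ R) (hz : ‖z.coord‖ ≤ R) :
    Real.sinh (dist (expand o s x) (expand o s z)) ^ 2
      ≤ (1 + s) ^ 2 * (1 + 8 * (s / (1 - R ^ 2))) / (1 - 4 * (s / (1 - R ^ 2))) ^ 2
        * Real.sinh (dist x z) ^ 2 := by
  have hR0 : 0 ≤ R := (norm_nonneg _).trans ho
  have hd : 0 < 1 - R ^ 2 := by nlinarith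
  set κ := s / (1 - R ^ 2) with hκ
  have hκs : κ * (1 - R ^ 2) = s := by rw [hκ]; field_simp
  have hκ0 : 0 ≤ κ := div_nonneg hs hd.le
  have hx1 := one_sub_pos x
  have hz1 := one_sub_pos z
  have hxc : (expand o s x).coord = x.coord + s • (x.coord - o) :=
    coord_ofCoord ((norm_expand_le hR ho hx hs).trans_lt hs1)
  have hzc : (expand o s z).coord = z.coord + s • (z.coord - o) :=
    coord_ofCoord ((norm_expand_le hR ho hz hs).trans_lt hs1)
  set x' := expand o s x
  set z' := expand o s z
  have hx1' := one_sub_pos x'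
  have hz1' := one_sub_pos z'
  have hmove : ∀ y y' : HypSpace n, ‖y.coord‖ ≤ R → y'.coord = y.coord + s • (y.coord - o) →
      ‖y'.coord - y.coord‖ ≤ 2 * s := by
    intro y y' hy h
    rw [h, add_sub_cancel_left, norm_smul, Real.norm_of_nonneg hs, mul_comm]
    exact mul_le_mul_of_nonneg_right ((norm_sub_le _ _).trans (by linarith)) hs
  have hsum : ∀ y y' : HypSpace n, ‖y'.coord + y.coord‖ ≤ 2 := fun y y' =>
    (norm_add_le _ _).trans (by linarith [y.norm_coord_lt, y'.norm_coord_lt])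
  have hsq : ∀ y y' : HypSpace n, ‖y.coord‖ ≤ R → y'.coord = y.coord + s • (y.coord - o) →
      |‖y'.coord‖ ^ 2 - ‖y.coord‖ ^ 2| ≤ 4 * s := by
    intro y y' hy h
    have e : ‖y'.coord‖ ^ 2 - ‖y.coord‖ ^ 2 = ⟪y'.coord - y.coord, y'.coord + y.coord⟫ := by
      rw [inner_add_right, inner_sub_left, inner_sub_left, real_inner_self_eq_norm_sq,
        real_inner_self_eq_norm_sq, real_inner_comm y.coord y'.coord]
      ring
    rw [e]
    refine (abs_real_inner_le_norm _ _).trans ?_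
    calc _ ≤ (2 * s) * 2 :=
          mul_le_mul (hmove y y' hy h) (hsum y y') (norm_nonneg _) (by positivity)
      _ = 4 * s := by ring
  have hden : ∀ y y' : HypSpace n, ‖y.coord‖ ≤ R → y'.coord = y.coord + s • (y.coord - o) →
      (1 - ‖y.coord‖ ^ 2) * (1 - 4 * κ) ≤ 1 - ‖y'.coord‖ ^ 2 := by
    intro y y' hy h
    have h1 := (abs_le.1 (hsq y y' hy h)).2
    have h2 : 1 - R ^ 2 ≤ 1 - ‖y.coord‖ ^ 2 := by
      have := norm_nonneg y.coord
      nlinarith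
    have h3 : κ * (1 - R ^ 2) ≤ κ * (1 - ‖y.coord‖ ^ 2) := mul_le_mul_of_nonneg_left h2 hκ0
    linarith
  set u := x.coord - z.coord with hu
  have hu' : x'.coord - z'.coord = (1 + s) • u := by rw [hxc, hzc, hu]; module
  rw [sinh_dist, sinh_dist, Real.sq_sqrt, Real.sq_sqrt, coshDist_sq_sub_one, coshDist_sq_sub_one,
    ← hu, hu', inner_smul_left, norm_smul, conj_trivial, Real.norm_of_nonneg (by positivity)]
  rotate_left
  · nlinarith [one_le_coshDist x z]
  · nlinarith [one_le_coshDist x' z']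
  have hN : (1 - R ^ 2) * ‖u‖ ^ 2 ≤ ⟪u, z.coord⟫ ^ 2 + (1 - ‖z.coord‖ ^ 2) * ‖u‖ ^ 2 := by
    have h2 : 1 - R ^ 2 ≤ 1 - ‖z.coord‖ ^ 2 := by
      have := norm_nonneg z.coord
      nlinarith
    nlinarith [sq_nonneg ⟪u, z.coord⟫, sq_nonneg ‖u‖]
  have hin : ⟪u, z'.coord⟫ ^ 2 ≤ ⟪u, z.coord⟫ ^ 2 + 4 * s * ‖u‖ ^ 2 := by
    have e : ⟪u, z'.coord⟫ ^ 2 - ⟪u, z.coord⟫ ^ 2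
        = ⟪u, z'.coord - z.coord⟫ * ⟪u, z'.coord + z.coord⟫ := by
      rw [inner_sub_right, inner_add_right]; ring
    have h1 : ⟪u, z'.coord - z.coord⟫ * ⟪u, z'.coord + z.coord⟫
        ≤ (‖u‖ * (2 * s)) * (‖u‖ * 2) := by
      refine (le_abs_self _).trans ?_
      rw [abs_mul]
      refine mul_le_mul ((abs_real_inner_le_norm _ _).trans ?_)
        ((abs_real_inner_le_norm _ _).trans ?_) (abs_nonneg _) (by positivity)
      · exact mul_le_mul_of_nonneg_left (hmove z z' hz hzc) (norm_nonneg _)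
      · exact mul_le_mul_of_nonneg_left (hsum z z') (norm_nonneg _)
    nlinarith
  have hnum : ((1 + s) * ⟪u, z'.coord⟫) ^ 2 + (1 - ‖z'.coord‖ ^ 2) * ((1 + s) * ‖u‖) ^ 2
      ≤ (1 + s) ^ 2 * (1 + 8 * κ)
        * (⟪u, z.coord⟫ ^ 2 + (1 - ‖z.coord‖ ^ 2) * ‖u‖ ^ 2) := by
    have h1 := (abs_le.1 (hsq z z' hz hzc)).1
    have h2 : (1 - ‖z'.coord‖ ^ 2) * ‖u‖ ^ 2 ≤ (1 - ‖z.coord‖ ^ 2 + 4 * s) * ‖u‖ ^ 2 :=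
      mul_le_mul_of_nonneg_right (by linarith) (sq_nonneg _)
    have h3 : 8 * κ * ((1 - R ^ 2) * ‖u‖ ^ 2)
        ≤ 8 * κ * (⟪u, z.coord⟫ ^ 2 + (1 - ‖z.coord‖ ^ 2) * ‖u‖ ^ 2) :=
      mul_le_mul_of_nonneg_left hN (by positivity)
    have h4 : 8 * κ * ((1 - R ^ 2) * ‖u‖ ^ 2) = 8 * s * ‖u‖ ^ 2 := by
      rw [← hκs]; ring
    rw [h4] at h3
    calc _ = (1 + s) ^ 2 * (⟪u, z'.coord⟫ ^ 2 + (1 - ‖z'.coord‖ ^ 2) * ‖u‖ ^ 2) := by ring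
      _ ≤ (1 + s) ^ 2 * ((1 + 8 * κ)
          * (⟪u, z.coord⟫ ^ 2 + (1 - ‖z.coord‖ ^ 2) * ‖u‖ ^ 2)) :=
        mul_le_mul_of_nonneg_left (by linarith) (sq_nonneg _)
      _ = _ := by ring
  have h14 : 0 < 1 - 4 * κ := by linarith
  have hD : (1 - 4 * κ) ^ 2 * ((1 - ‖x.coord‖ ^ 2) * (1 - ‖z.coord‖ ^ 2))
      ≤ (1 - ‖x'.coord‖ ^ 2) * (1 - ‖z'.coord‖ ^ 2) := by
    calc _ = ((1 - ‖x.coord‖ ^ 2) * (1 - 4 * κ)) * ((1 - ‖z.coord‖ ^ 2) * (1 - 4 * κ)) := by ring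
      _ ≤ _ := mul_le_mul (hden x x' hx hxc) (hden z z' hz hzc) (by positivity) hx1'.le
  rw [div_mul_div_comm]
  exact div_le_div₀ (by positivity) hnum (by positivity) hD

/-- On compact sets, homotheties of factor close to `1` have Lipschitz constant close to `1`. -/
theorem exists_dist_expand_le {R a : ℝ} (hR0 : 0 ≤ R) (hR : R < 1) (ha : 1 < a) :
    ∃ s₀ > 0, ∀ s, 0 ≤ s → s ≤ s₀ → ∀ o : EuclideanSpace ℝ (Fin n), ‖o‖ ≤ R →
      ∀ x z : HypSpace n, ‖x.coord‖ ≤ R → ‖z.coord‖ ≤ R →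
        dist (expand o s x) (expand o s z) ≤ a * dist x z := by
  have hd : 0 < 1 - R ^ 2 := by nlinarith
  have hF : ContinuousAt (fun s : ℝ => (1 + s) ^ 2 * (1 + 8 * (s / (1 - R ^ 2)))
      / (1 - 4 * (s / (1 - R ^ 2))) ^ 2) 0 := by
    refine ContinuousAt.div (by fun_prop) (by fun_prop) (by simp)
  have h1 : ∀ᶠ s : ℝ in 𝓝 0, (1 + s) ^ 2 * (1 + 8 * (s / (1 - R ^ 2)))
      / (1 - 4 * (s / (1 - R ^ 2))) ^ 2 < a ^ 2 := by
    refine hF.eventually (gt_mem_nhds ?_)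
    simp only [add_zero, zero_div, mul_zero, sub_zero, one_pow, mul_one, div_one]
    nlinarith
  have h2 : ∀ᶠ s : ℝ in 𝓝 0, R + s * 2 < 1 := by
    have : ContinuousAt (fun s : ℝ => R + s * 2) 0 := by fun_prop
    exact this.eventually (gt_mem_nhds (by simpa using hR))
  have h3 : ∀ᶠ s : ℝ in 𝓝 0, 4 * (s / (1 - R ^ 2)) < 1 := by
    have : ContinuousAt (fun s : ℝ => 4 * (s / (1 - R ^ 2))) 0 := by fun_prop
    exact this.eventually (gt_mem_nhds (by simp))
  obtain ⟨t, ht, hball⟩ := Metric.eventually_nhds_iff.1 (h1.and (h2.and h3))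
  refine ⟨t / 2, half_pos ht, fun s hs0 hs o ho x z hx hz => ?_⟩
  obtain ⟨h1, h2, h3⟩ := hball (y := s) (by
    rw [Real.dist_eq, sub_zero, abs_of_nonneg hs0]
    linarith)
  have h4 := sinh_dist_expand_le hR hs0 h2 h3 ho hx hz
  have h5 : 0 ≤ Real.sinh (dist x z) := Real.sinh_nonneg_iff.2 dist_nonneg
  have h6 : Real.sinh (dist (expand o s x) (expand o s z)) ^ 2
      ≤ (a * Real.sinh (dist x z)) ^ 2 := by
    rw [mul_pow]
    exact h4.trans (mul_le_mul_of_nonneg_right h1.le (sq_nonneg _))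
  have h7 := (abs_le_of_sq_le_sq' h6 (by positivity)).2
  exact Real.sinh_le_sinh.1 (h7.trans (Real.mul_sinh_le_sinh_mul ha.le dist_nonneg))

/-! ### Hausdorff convergence in coordinates -/

/-- Mutual closeness of two sets in Klein coordinates. -/
def Near (δ : ℝ) (A C : Set (EuclideanSpace ℝ (Fin n))) : Prop :=
  (∀ a ∈ A, ∃ k ∈ C, ‖a - k‖ ≤ δ) ∧ ∀ k ∈ C, ∃ a ∈ A, ‖a - k‖ ≤ δ

theorem Near.symm {δ : ℝ} {A C : Set (EuclideanSpace ℝ (Fin n))} (h : Near δ A C) :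
    Near δ C A :=
  ⟨fun k hk => by simpa only [norm_sub_rev k] using h.2 k hk,
    fun a ha => by simpa only [norm_sub_rev _ a] using h.1 a ha⟩

theorem eventually_near {Ks : ℕ → Set (HypSpace n)} {K : Set (HypSpace n)}
    (hlim : Tendsto (fun i => Metric.hausdorffEDist (Ks i) K) atTop (𝓝 0)) {δ : ℝ} (hδ : 0 < δ) :
    ∀ᶠ i in atTop, Near δ (coord '' Ks i) (coord '' K) := by
  obtain ⟨ρ, hρ, hsinh⟩ := Real.exists_sinh_le hδ
  have hle : ∀ x y : HypSpace n, edist x y < ENNReal.ofReal ρ → ‖x.coord - y.coord‖ ≤ δ := by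
    intro x y h
    rw [edist_dist, ENNReal.ofReal_lt_ofReal_iff hρ] at h
    exact (norm_coord_sub_le_sinh x y).trans ((Real.sinh_le_sinh.2 h.le).trans hsinh)
  filter_upwards [hlim.eventually (gt_mem_nhds (ENNReal.ofReal_pos.2 hρ))] with i hi
  constructor
  · rintro _ ⟨x, hx, rfl⟩
    obtain ⟨y, hy, hxy⟩ := Metric.exists_edist_lt_of_hausdorffEDist_lt hx hi
    exact ⟨_, Set.mem_image_of_mem _ hy, hle x y hxy⟩
  · rintro _ ⟨y, hy, rfl⟩
    rw [Metric.hausdorffEDist_comm] at hi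
    obtain ⟨x, hx, hxy⟩ := Metric.exists_edist_lt_of_hausdorffEDist_lt hy hi
    rw [edist_comm] at hxy
    exact ⟨_, Set.mem_image_of_mem _ hx, hle x y hxy⟩

end HypSpace

/-- A diameter bound, which converts the multiplicative error of nearly 1-Lipschitz maps into an
additive one. -/
theorem IsCompactMetric.exists_le {X : Type*} {d : X → X → ℝ≥0∞} (h : IsCompactMetric d) :
    ∃ B : ℝ, 0 ≤ B ∧ ∀ x y, d x y ≤ ENNReal.ofReal B := by
  obtain ⟨_, _, _, hd⟩ := h
  obtain ⟨B, hB⟩ := Metric.isBounded_iff.1 (isCompact_univ (X := X)).isBounded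
  refine ⟨max B 0, le_max_right _ _, fun x y => ?_⟩
  rw [← hd, edist_dist]
  exact ENNReal.ofReal_le_ofReal ((hB (Set.mem_univ x) (Set.mem_univ y)).trans (le_max_left _ _))

namespace HypSpace

variable {n : ℕ}

/-! ### Limits with interior -/

/-- Expanding the boundary of a convex body `K` and projecting it to the boundary of a body `K'`
that is close to `K`. -/
theorem exists_boundary_map {K K' : Set (HypSpace n)} (hK : IsClosed K) (hK' : IsCompact K')
    (hne' : K'.Nonempty) (hc : Convex ℝ (coord '' K)) (hc' : Convex ℝ (coord '' K'))
    {o : EuclideanSpace ℝ (Fin n)} {r s δ R R' a : ℝ} (hR' : R' < 1)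
    (hKR : ∀ x ∈ K, ‖x.coord‖ ≤ R) (hKR' : ∀ x ∈ K', ‖x.coord‖ ≤ R) (ho : ‖o‖ ≤ R)
    (hball : Metric.ball o r ⊆ coord '' K) (hs : 0 < s) (hsR : R + s * 2 ≤ R')
    (hδ : δ < s * r) (hnear : Near δ (coord '' K') (coord '' K)) (ha : 0 < a)
    (hlip : ∀ x z : HypSpace n, ‖x.coord‖ ≤ R → ‖z.coord‖ ≤ R →
      dist (expand o s x) (expand o s z) ≤ a * dist x z) :
    ∃ g : HypSpace n → HypSpace n, (∀ x ∈ frontier K, g x ∈ frontier K') ∧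
      (∀ x y, lenDist (frontier K') (g x) (g y) ≤ ENNReal.ofReal a * lenDist (frontier K) x y) ∧
      ∀ x ∈ frontier K, dist (g x) x ≤ (1 - R' ^ 2)⁻¹ * (4 * s + δ) := by
  obtain ⟨π, -, hπmin, -, hπlip, hπfr⟩ := exists_projection hK' hne' hc'
  have hRR : R < 1 := by linarith
  have hR0 : 0 ≤ R := (norm_nonneg _).trans ho
  have hcoord : ∀ x ∈ K, (expand o s x).coord = x.coord + s • (x.coord - o) := fun x hx =>
    coord_ofCoord ((norm_expand_le hRR ho (hKR x hx) hs.le).trans_lt (hsR.trans_lt hR'))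
  have hmaps : Set.MapsTo (π ∘ expand o s) (frontier K) (frontier K') := by
    intro x hx
    apply hπfr
    rw [mem_interior_iff_coord, hcoord x (hK.frontier_subset hx)]
    intro hmem
    -- The expanded point is at distance at least `s r > δ` from `K`, so it is outside `K'`.
    obtain ⟨k, hk, hxk⟩ := hnear.1 _ (interior_subset hmem)
    refine hc.notMem_of_norm_sub_homothety_lt hball (fun h => hx.2 (mem_interior_iff_coord.2 h)) hs
      ?_ hk
    rw [norm_sub_rev]
    exact hxk.trans_lt hδ
  refine ⟨π ∘ expand o s, hmaps, ?_, fun x hx => ?_⟩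
  · refine fun x y => lenDist_le_mul_of_lipschitzOn (C := a.toNNReal) (by simpa using ha) ?_ hmaps
      x y
    have h1 : LipschitzOnWith a.toNNReal (expand o s) (frontier K) :=
      LipschitzOnWith.of_dist_le_mul fun x hx z hz => by
        rw [Real.coe_toNNReal _ ha.le]
        exact hlip x z (hKR x (hK.frontier_subset hx)) (hKR z (hK.frontier_subset hz))
    simpa using hπlip.comp_lipschitzOnWith h1
  · have hxK := hK.frontier_subset hx
    obtain ⟨_, ⟨q, hq, rfl⟩, hqx⟩ := hnear.2 _ (Set.mem_image_of_mem _ hxK)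
    have hE : ‖(expand o s x).coord‖ ≤ R' := by
      rw [hcoord x hxK]
      exact (norm_expand_le hRR ho (hKR x hxK) hs.le).trans hsR
    have hRR' : R ≤ R' := by linarith
    have hM : 0 < (1 - R' ^ 2)⁻¹ := by
      apply inv_pos.2
      nlinarith
    have hmove : ‖(expand o s x).coord - x.coord‖ ≤ 2 * s := by
      rw [hcoord x hxK, add_sub_cancel_left, norm_smul, Real.norm_of_nonneg hs.le, mul_comm]
      exact mul_le_mul_of_nonneg_right ((norm_sub_le _ _).trans (by linarith [hKR x hxK])) hs.le
    have h1 := dist_le_mul_norm hR' hE ((hKR x hxK).trans hRR')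
    have h2 := dist_le_mul_norm hR' hE ((hKR' q hq).trans hRR')
    have h3 : ‖(expand o s x).coord - q.coord‖ ≤ 2 * s + δ := by
      calc _ = ‖((expand o s x).coord - x.coord) - (q.coord - x.coord)‖ := by congr 1; abel
        _ ≤ _ := (norm_sub_le _ _).trans (add_le_add hmove hqx)
    -- The projection moves the expanded point no farther than `q`, a point of `K'` near `x`.
    calc dist (π (expand o s x)) x ≤ dist (expand o s x) (π (expand o s x))
          + dist (expand o s x) x := dist_triangle_left _ _ _
      _ ≤ (1 - R' ^ 2)⁻¹ * (2 * s + δ) + (1 - R' ^ 2)⁻¹ * (2 * s) := by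
        refine add_le_add ((hπmin _ q hq).trans (h2.trans ?_)) (h1.trans ?_)
        · exact mul_le_mul_of_nonneg_left h3 hM.le
        · exact mul_le_mul_of_nonneg_left hmove hM.le
      _ = _ := by ring

theorem lenDist_frontier_le_of_dist_le {K : Set (HypSpace n)} (hK : IsCompact K)
    (hc : Convex ℝ (coord '' K)) {o : EuclideanSpace ℝ (Fin n)} {r R R' ρ η : ℝ} (hr : 0 < r)
    (hR0 : 0 ≤ R') (hR' : R' < 1) (hball : Metric.ball o r ⊆ coord '' K)
    (hKR : ∀ x ∈ K, ‖x.coord‖ ≤ R) (hoR : ‖o‖ ≤ R) (hρ : Real.sinh ρ ≤ η)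
    (h1 : 4 / r * η ≤ R' - R) (h2 : 2 * η < r) {x y : HypSpace n} (hx : x ∈ frontier K)
    (hy : y ∈ frontier K) (hxy : dist x y ≤ ρ) :
    lenDist (frontier K) x y ≤ ENNReal.ofReal ((1 - R' ^ 2)⁻¹ * (8 / r + 2) * η) := by
  have hxK := hK.isClosed.frontier_subset hx
  have hyK := hK.isClosed.frontier_subset hy
  refine (lenDist_frontier_le hK ⟨x, hxK⟩ hc hx hy).trans ?_
  have hη : ‖x.coord - y.coord‖ ≤ η :=
    (norm_coord_sub_le_sinh x y).trans ((Real.sinh_le_sinh.2 hxy).trans hρ)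
  have h := lenDist_compl_interior_le hc hr hR' hball (fun h => hx.2 (mem_interior_iff_coord.2 h))
    (fun h => hy.2 (mem_interior_iff_coord.2 h)) (hKR x hxK) (hKR y hyK) hoR
    ((mul_le_mul_of_nonneg_left hη (by positivity)).trans h1) (by linarith)
  rw [ofCoord_coord, ofCoord_coord] at h
  refine h.trans (ENNReal.ofReal_le_ofReal (mul_le_mul_of_nonneg_left hη ?_))
  have : 0 < 1 - R' ^ 2 := by nlinarith
  positivity

/-- The maps `g` from `∂K` to `∂K_i` and `h` back increase lengths by a factor of at most `1 + b`
and move points little in space. So `h ∘ g` and `g ∘ h` move points little along the boundaries: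
distances under `g` are controlled from both sides, and `h` shows that its image is almost dense. -/
theorem ghTendsto_frontier (hn : 2 ≤ n) {Ks : ℕ → Set (HypSpace n)} {K : Set (HypSpace n)}
    (hKs : ∀ i, IsCompact (Ks i)) (hK : IsCompact K) (hcs : ∀ i, Convex ℝ (coord '' Ks i))
    (hc : Convex ℝ (coord '' K)) (hints : ∀ i, (interior (coord '' Ks i)).Nonempty)
    (hint : (interior (coord '' K)).Nonempty)
    (hlim : Tendsto (fun i => Metric.hausdorffEDist (Ks i) K) atTop (𝓝 0)) :
    GHTendsto (fun i (x y : frontier (Ks i)) => innerEDist x y)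
        (fun x y : frontier K => innerEDist x y) := by
  have hcomp := isCompactMetric_frontier hn hK hc hint
  refine ghTendsto_of_approx (fun i => isCompactMetric_frontier hn (hKs i) (hcs i) (hints i))
    hcomp fun ε hε => ?_
  obtain ⟨B, hB0, hB⟩ := hcomp.exists_le
  obtain ⟨R₀, hR₀0, hR₀1, hR₀⟩ := exists_norm_coord_le hK
  obtain ⟨R, hR₀R, hR1⟩ := exists_between hR₀1
  obtain ⟨R', hRR', hR'1⟩ := exists_between hR1
  have hKR : ∀ x ∈ K, ‖x.coord‖ ≤ R := fun x hx => (hR₀ x hx).trans hR₀R.le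
  have hM : 0 < (1 - R' ^ 2)⁻¹ := by
    apply inv_pos.2
    nlinarith
  obtain ⟨o, ho⟩ := hint
  obtain ⟨r₂, hr₂, hball₂⟩ := Metric.isOpen_iff.1 isOpen_interior o ho
  obtain ⟨r, hr, hrr₂⟩ : ∃ r > 0, 2 * r = r₂ := ⟨r₂ / 2, half_pos hr₂, by ring⟩
  rw [← hrr₂] at hball₂
  have hball₂ := hball₂.trans interior_subset
  have hball : Metric.ball o r ⊆ coord '' K :=
    (Metric.ball_subset_ball (by linarith)).trans hball₂
  have hoR : ‖o‖ ≤ R := by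
    obtain ⟨o', ho', rfl⟩ := interior_subset ho
    exact hKR o' ho'
  set L := (1 - R' ^ 2)⁻¹ * (8 / r + 2) with hL
  have hL0 : 0 < L := by positivity
  -- Boundary points at Euclidean distance `η` will be within `ε / 4` along the boundary; `ρ` is a
  -- hyperbolic distance that ensures this `η`.
  obtain ⟨η, hη0, hη1, hη2, hηL⟩ : ∃ η > 0, 4 / r * η ≤ R' - R ∧ 2 * η < r ∧ L * η ≤ ε / 4 := by
    refine ⟨min ((R' - R) / (4 / r)) (min (r / 4) (ε / 4 / L)), ?_, ?_, ?_, ?_⟩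
    · have := sub_pos.2 hRR'
      positivity
    · rw [mul_comm, ← le_div_iff₀ (by positivity)]
      exact min_le_left _ _
    · have := (min_le_right ((R' - R) / (4 / r)) (min (r / 4) (ε / 4 / L))).trans
        (min_le_left _ _)
      linarith
    · rw [mul_comm, ← le_div_iff₀ hL0]
      exact (min_le_right _ _).trans (min_le_right _ _)
  obtain ⟨ρ, hρ0, hρ⟩ := Real.exists_sinh_le hη0
  -- The factor is `2 B` because the error also applies to distances in `∂K_i`, known only to be at
  -- most `(1 + b) B`.
  obtain ⟨b, hb0, hb1, hbB⟩ : ∃ b : ℝ, 0 < b ∧ b ≤ 1 ∧ b * (2 * B) ≤ ε / 2 := by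
    refine ⟨min 1 (ε / 2 / (2 * B + 1)), by positivity, min_le_left _ _, ?_⟩
    calc _ ≤ ε / 2 / (2 * B + 1) * (2 * B + 1) :=
          mul_le_mul (min_le_right _ _) (by linarith) (by positivity) (by positivity)
      _ = ε / 2 := by field_simp
  obtain ⟨s₀, hs₀, hlip⟩ := exists_dist_expand_le (hR₀0.le.trans hR₀R.le) hR1
    (lt_add_of_pos_right 1 hb0)
  obtain ⟨s, hs0, hss₀, hsR, hsρ⟩ : ∃ s > 0, s ≤ s₀ ∧ R + s * 2 ≤ R' ∧
      (1 - R' ^ 2)⁻¹ * (4 * s) ≤ ρ / 4 := by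
    refine ⟨min s₀ (min ((R' - R) / 2) (ρ / 4 / ((1 - R' ^ 2)⁻¹ * 4))), ?_, min_le_left _ _, ?_,
      ?_⟩
    · have := sub_pos.2 hRR'
      positivity
    · have := (min_le_right s₀ (min ((R' - R) / 2) (ρ / 4 / ((1 - R' ^ 2)⁻¹ * 4)))).trans
        (min_le_left _ _)
      linarith
    · rw [← mul_assoc, mul_comm, ← le_div_iff₀ (by positivity)]
      exact (min_le_right _ _).trans (min_le_right _ _)
  -- In turn: expanded boundaries clear the other body, `K_i` contains the ball of radius `r`, `K_i`
  -- stays within radius `R`, and, with the choice of `s`, the maps move points by at most `ρ / 2`.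
  obtain ⟨δ, hδ0, hδs, hδr, hδR, hδρ⟩ : ∃ δ > 0, δ < s * r ∧ δ < r ∧ δ ≤ R - R₀ ∧
      (1 - R' ^ 2)⁻¹ * δ ≤ ρ / 4 := by
    refine ⟨min (min (s * r / 2) (r / 2)) (min (R - R₀) (ρ / 4 / (1 - R' ^ 2)⁻¹)), ?_, ?_, ?_, ?_,
      ?_⟩
    · have := sub_pos.2 hR₀R
      positivity
    · refine ((min_le_left _ _).trans (min_le_left _ _)).trans_lt ?_
      exact half_lt_self (by positivity)
    · exact ((min_le_left _ _).trans (min_le_right _ _)).trans_lt (half_lt_self hr)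
    · exact (min_le_right _ _).trans (min_le_left _ _)
    · rw [mul_comm, ← le_div_iff₀ hM]
      exact (min_le_right _ _).trans (min_le_right _ _)
  filter_upwards [eventually_near hlim hδ0] with i hi
  have hKiR : ∀ x ∈ Ks i, ‖x.coord‖ ≤ R := by
    intro x hx
    obtain ⟨_, ⟨k, hk, rfl⟩, hxk⟩ := hi.1 _ (Set.mem_image_of_mem _ hx)
    have := norm_le_norm_add_norm_sub' x.coord k.coord
    linarith [hR₀ k hk]
  have hballi : Metric.ball o r ⊆ coord '' Ks i :=
    (hcs i).ball_subset_of_near (hints i) hr hδr hball₂ hi.2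
  have hne : K.Nonempty := Set.Nonempty.of_image ⟨o, interior_subset ho⟩
  have hnei : (Ks i).Nonempty := ((hints i).mono interior_subset).of_image
  obtain ⟨g, hgm, hgl, hgd⟩ := exists_boundary_map hK.isClosed (hKs i) hnei hc (hcs i) hR'1 hKR
    hKiR hoR hball hs0 hsR hδs hi (by linarith) (hlip s hs0.le hss₀ o hoR)
  obtain ⟨h, hhm, hhl, hhd⟩ := exists_boundary_map (hKs i).isClosed hK hne (hcs i) hc hR'1 hKiR
    hKR hoR hballi hs0 hsR hδs hi.symm (by linarith) (hlip s hs0.le hss₀ o hoR)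
  have hsmall : (1 - R' ^ 2)⁻¹ * (4 * s + δ) ≤ ρ / 2 := by
    rw [mul_add]
    linarith
  have hb : ENNReal.ofReal (1 + b) = 1 + ENNReal.ofReal b := by
    rw [ENNReal.ofReal_add zero_le_one hb0.le, ENNReal.ofReal_one]
  have hloc : ∀ x ∈ frontier K, lenDist (frontier K) x (h (g x)) ≤ ENNReal.ofReal (ε / 4) := by
    intro x hx
    refine (lenDist_frontier_le_of_dist_le hK hc hr (by linarith) hR'1 hball hKR hoR hρ hη1 hη2
      hx (hhm _ (hgm x hx)) ?_).trans (ENNReal.ofReal_le_ofReal hηL)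
    have h1 := hgd x hx
    have h2 := hhd _ (hgm x hx)
    have := dist_triangle (h (g x)) (g x) x
    rw [dist_comm]
    linarith
  have hloc' : ∀ x ∈ frontier (Ks i),
      lenDist (frontier (Ks i)) x (g (h x)) ≤ ENNReal.ofReal (ε / 4) := by
    intro x hx
    refine (lenDist_frontier_le_of_dist_le (hKs i) (hcs i) hr (by linarith) hR'1 hballi hKiR hoR
      hρ hη1 hη2 hx (hgm _ (hhm x hx)) ?_).trans (ENNReal.ofReal_le_ofReal hηL)
    have h1 := hhd x hx
    have h2 := hgd _ (hhm x hx)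
    have := dist_triangle (g (h x)) (h x) x
    rw [dist_comm]
    linarith
  refine ⟨fun x => ⟨g x, hgm x x.2⟩, fun x y => ?_, fun x => ⟨⟨h x, hhm x x.2⟩, ?_⟩⟩
  · have hBxy := hB x y
    simp only [innerEDist_subtype] at hBxy ⊢
    have h1 : lenDist (frontier (Ks i)) (g x) (g y)
        ≤ lenDist (frontier K) (x : HypSpace n) y + ENNReal.ofReal (b * B) := by
      refine (hgl x y).trans ?_
      rw [hb, add_mul, one_mul, ENNReal.ofReal_mul hb0.le]
      gcongr
    refine ⟨h1.trans ?_, ?_⟩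
    · gcongr
      nlinarith
    · have h2 : lenDist (frontier (Ks i)) (g x) (g y) ≤ ENNReal.ofReal (2 * B) := by
        refine h1.trans ((add_le_add_left hBxy _).trans ?_)
        rw [← ENNReal.ofReal_add hB0 (by positivity)]
        apply ENNReal.ofReal_le_ofReal
        nlinarith
      have h3 : lenDist (frontier K) (h (g x)) (h (g y))
          ≤ lenDist (frontier (Ks i)) (g x) (g y) + ENNReal.ofReal (ε / 2) := by
        refine (hhl (g x) (g y)).trans ?_
        rw [hb, add_mul, one_mul]
        gcongr
        calc _ ≤ ENNReal.ofReal b * ENNReal.ofReal (2 * B) := by gcongr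
          _ = ENNReal.ofReal (b * (2 * B)) := (ENNReal.ofReal_mul hb0.le).symm
          _ ≤ _ := ENNReal.ofReal_le_ofReal hbB
      have h4 := hloc y y.2
      rw [lenDist_comm] at h4
      calc lenDist (frontier K) (x : HypSpace n) y
          ≤ lenDist (frontier K) (x : HypSpace n) (h (g x))
            + (lenDist (frontier K) (h (g x)) (h (g y))
            + lenDist (frontier K) (h (g y)) y) :=
          (lenDist_triangle _ _ _ _).trans (add_le_add_right (lenDist_triangle _ _ _ _) _)
        _ ≤ ENNReal.ofReal (ε / 4) + ((lenDist (frontier (Ks i)) (g x) (g y)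
            + ENNReal.ofReal (ε / 2)) + ENNReal.ofReal (ε / 4)) :=
          add_le_add (hloc x x.2) (add_le_add h3 h4)
        _ = lenDist (frontier (Ks i)) (g x) (g y) + (ENNReal.ofReal (ε / 4)
            + ENNReal.ofReal (ε / 2) + ENNReal.ofReal (ε / 4)) := by ring
        _ = _ := by
          rw [← ENNReal.ofReal_add (by positivity) (by positivity),
            ← ENNReal.ofReal_add (by positivity) (by positivity)]
          congr 2
          ring
  · simp only [innerEDist_subtype]
    exact (hloc' x x.2).trans (ENNReal.ofReal_le_ofReal (by linarith))

/-! ### Convex bodies close to a convex set without interior -/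

/-- The convex body `K'` is `δ`-close to the set `K`, and both are well inside the ball of radius
`R`. -/
structure CloseBody (K' K : Set (HypSpace n)) (δ R : ℝ) : Prop where
  compact : IsCompact K'
  convex : Convex ℝ (coord '' K')
  interior_nonempty : (interior (coord '' K')).Nonempty
  near : Near δ (coord '' K') (coord '' K)
  pos : 0 < δ
  lt_one : R < 1
  -- The margin `10 δ` keeps all auxiliary points, displaced by at most `6 δ`, inside the ball of
  -- radius `R`.
  norm_le' : ∀ v ∈ coord '' K', ‖v‖ + 10 * δ ≤ R
  norm_le : ∀ v ∈ coord '' K, ‖v‖ + 10 * δ ≤ R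

/-- `w` is a unit normal of the affine subspace through `k₀` spanned by `K`. -/
structure IsUnitNormal (K : Set (HypSpace n)) (k₀ w : EuclideanSpace ℝ (Fin n)) : Prop where
  norm_eq : ‖w‖ = 1
  inner_eq : ∀ k ∈ coord '' K, ⟪w, k - k₀⟫ = 0

theorem IsUnitNormal.neg {K : Set (HypSpace n)} {k₀ w : EuclideanSpace ℝ (Fin n)}
    (h : IsUnitNormal K k₀ w) : IsUnitNormal K k₀ (-w) :=
  ⟨by rw [norm_neg, h.norm_eq], fun k hk => by rw [inner_neg_left, h.inner_eq k hk, neg_zero]⟩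

theorem exists_unit_orthogonal {S : Submodule ℝ (EuclideanSpace ℝ (Fin n))}
    (hS : Module.finrank ℝ S < n) :
    ∃ w : EuclideanSpace ℝ (Fin n), ‖w‖ = 1 ∧ ∀ v ∈ S, ⟪w, v⟫ = 0 := by
  have h1 := S.finrank_add_finrank_orthogonal
  rw [finrank_euclideanSpace_fin] at h1
  have : Nontrivial Sᗮ := Module.nontrivial_of_finrank_pos (R := ℝ) (by omega)
  obtain ⟨⟨w, hw⟩, hw0⟩ := exists_ne (0 : Sᗮ)
  have hw0 : w ≠ 0 := fun h => hw0 (Subtype.ext h)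
  refine ⟨‖w‖⁻¹ • w, norm_smul_inv_norm hw0, fun v hv => ?_⟩
  rw [inner_smul_left, Submodule.inner_left_of_mem_orthogonal hv hw, mul_zero]

theorem isUnitNormal_of_direction {K : Set (HypSpace n)} {k₀ w : EuclideanSpace ℝ (Fin n)}
    (hk₀ : k₀ ∈ coord '' K) (hw : ‖w‖ = 1)
    (h : ∀ v ∈ (affineSpan ℝ (coord '' K)).direction, ⟪w, v⟫ = 0) : IsUnitNormal K k₀ w :=
  ⟨hw, fun _ hk => h _ (AffineSubspace.vsub_mem_direction (subset_affineSpan ℝ _ hk)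
    (subset_affineSpan ℝ _ hk₀))⟩

theorem exists_isUnitNormal {K : Set (HypSpace n)} {k₀ : EuclideanSpace ℝ (Fin n)}
    (hk₀ : k₀ ∈ coord '' K) (hdim : dim K < n) : ∃ w, IsUnitNormal K k₀ w := by
  obtain ⟨w, hw, h⟩ := exists_unit_orthogonal hdim
  exact ⟨w, isUnitNormal_of_direction hk₀ hw h⟩

/-- In codimension two, two points lie on the same side of some hyperplane through `K`. -/
theorem exists_isUnitNormal_nonneg {K : Set (HypSpace n)} {k₀ : EuclideanSpace ℝ (Fin n)}
    (hk₀ : k₀ ∈ coord '' K) (hdim : dim K + 2 ≤ n) (u v : EuclideanSpace ℝ (Fin n)) :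
    ∃ w, IsUnitNormal K k₀ w ∧ 0 ≤ ⟪w, u⟫ ∧ 0 ≤ ⟪w, v⟫ := by
  -- Adjoining `u` to the direction of `K` still leaves a proper subspace. A normal of it ignores
  -- `u`, so its sign is free to suit `v`.
  obtain ⟨w, hw, h⟩ := exists_unit_orthogonal
    (S := (affineSpan ℝ (coord '' K)).direction ⊔ Submodule.span ℝ {u}) (by
      have h1 := Submodule.finrank_add_le_finrank_add_finrank
        (affineSpan ℝ (coord '' K)).direction (Submodule.span ℝ {u})
      have h2 := finrank_span_le_card (R := ℝ) ({u} : Set (EuclideanSpace ℝ (Fin n)))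
      rw [Set.toFinset_singleton, Finset.card_singleton] at h2
      rw [dim] at hdim
      omega)
  have hN := isUnitNormal_of_direction hk₀ hw fun v hv => h v (Submodule.mem_sup_left hv)
  have hu : ⟪w, u⟫ = 0 := h u (Submodule.mem_sup_right (Submodule.mem_span_singleton_self u))
  rcases le_total 0 ⟪w, v⟫ with hv | hv
  · exact ⟨w, hN, hu.ge, hv⟩
  · exact ⟨-w, hN.neg, by rw [inner_neg_left, hu, neg_zero], by rw [inner_neg_left]; linarith⟩

namespace CloseBody

variable {K' K : Set (HypSpace n)} {δ R : ℝ} {k₀ w : EuclideanSpace ℝ (Fin n)}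

theorem const_pos (h : CloseBody K' K δ R) : 0 < (1 - R ^ 2)⁻¹ := by
  obtain ⟨v, hv⟩ := h.interior_nonempty
  have h1 := h.norm_le' v (interior_subset hv)
  have h2 := norm_nonneg v
  have h3 := h.pos
  have h4 := h.lt_one
  apply inv_pos.2
  nlinarith

theorem inner_le (h : CloseBody K' K δ R) (hw : IsUnitNormal K k₀ w) {a : EuclideanSpace ℝ (Fin n)}
    (ha : a ∈ coord '' K') : ⟪w, a - k₀⟫ ≤ δ := by
  obtain ⟨k, hk, hak⟩ := h.near.1 a ha
  have h1 := real_inner_le_norm w (a - k)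
  rw [hw.norm_eq, one_mul] at h1
  have h2 := hw.inner_eq k hk
  rw [← sub_add_sub_cancel a k k₀, inner_add_right]
  linarith

theorem neg_le_inner (h : CloseBody K' K δ R) (hw : IsUnitNormal K k₀ w)
    {a : EuclideanSpace ℝ (Fin n)} (ha : a ∈ coord '' K') : -δ ≤ ⟪w, a - k₀⟫ := by
  have := h.inner_le hw.neg ha
  rw [inner_neg_left] at this
  linarith

/-- Segments in a half-space that misses the body. -/
theorem lenDist_le_of_halfspace {m b u v : EuclideanSpace ℝ (Fin n)} {c : ℝ}
    (hA : ∀ a ∈ coord '' K', ⟪m, a - b⟫ ≤ c) (hu1 : ‖u‖ < 1) (hv1 : ‖v‖ < 1)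
    (hu : c < ⟪m, u - b⟫) (hv : c < ⟪m, v - b⟫) :
    lenDist (interior K')ᶜ (ofCoord u) (ofCoord v) ≤ edist (ofCoord u) (ofCoord v) := by
  refine lenDist_le_edist_of_segment hu1 hv1 fun z hz => ?_
  refine ofCoord_mem_compl_interior (norm_lt_one_of_mem_segment hu1 hv1 hz) fun hzA => ?_
  have hconv : Convex ℝ {z : EuclideanSpace ℝ (Fin n) | c < ⟪m, z - b⟫} := by
    have : {z : EuclideanSpace ℝ (Fin n) | c < ⟪m, z - b⟫}
        = {z | c + ⟪m, b⟫ < (innerSL ℝ m) z} := by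
      ext z
      simp only [Set.mem_ofPred_eq, inner_sub_right, innerSL_apply_apply]
      constructor <;> intro <;> linarith
    rw [this]
    exact convex_halfSpace_gt (innerSL ℝ m).isLinear _
  exact absurd (hA z (interior_subset hzA)) (not_le.2 (hconv.segment_subset hu hv hz))

/-- The body has height at most `δ` with respect to `w`, so the segment between two points of height
at least `2 δ` misses it. -/
theorem lenDist_le_of_high (h : CloseBody K' K δ R) (hw : IsUnitNormal K k₀ w)
    {u v : EuclideanSpace ℝ (Fin n)} (hu1 : ‖u‖ ≤ R) (hv1 : ‖v‖ ≤ R)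
    (hu : 2 * δ ≤ ⟪w, u - k₀⟫) (hv : 2 * δ ≤ ⟪w, v - k₀⟫) :
    lenDist (interior K')ᶜ (ofCoord u) (ofCoord v) ≤ edist (ofCoord u) (ofCoord v) := by
  have := h.pos
  exact lenDist_le_of_halfspace (fun a ha => h.inner_le hw ha) (hu1.trans_lt h.lt_one)
    (hv1.trans_lt h.lt_one) (by linarith) (by linarith)

theorem edist_le (h : CloseBody K' K δ R) {u v : EuclideanSpace ℝ (Fin n)} {c : ℝ} (hu : ‖u‖ ≤ R)
    (hv : ‖v‖ ≤ R) (huv : ‖u - v‖ ≤ c) :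
    edist (ofCoord u) (ofCoord v) ≤ ENNReal.ofReal ((1 - R ^ 2)⁻¹ * c) :=
  (edist_ofCoord_le h.lt_one hu hv).trans
    (ENNReal.ofReal_le_ofReal (mul_le_mul_of_nonneg_left huv h.const_pos.le))

/-- From a boundary point one gets above the body by moving first in the direction of the outer
normal at the point, then in the direction of a normal of `K`. -/
theorem lenDist_exit_le (h : CloseBody K' K δ R) (hw : IsUnitNormal K k₀ w)
    {x ν : EuclideanSpace ℝ (Fin n)} (hx : x ∈ coord '' K') (hxi : x ∉ interior (coord '' K'))
    (hν : ‖ν‖ = 1) (hνA : ∀ a ∈ coord '' K', ⟪ν, a - x⟫ ≤ 0)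
    (hside : 0 ≤ ⟪w, x + (3 * δ) • ν - k₀⟫) :
    lenDist (interior K')ᶜ (ofCoord x) (ofCoord (x + (3 * δ) • ν + (2 * δ) • w))
      ≤ ENNReal.ofReal ((1 - R ^ 2)⁻¹ * (5 * δ)) := by
  have hδ := h.pos
  have hM := h.const_pos
  have hxR := h.norm_le' x hx
  set x' := x + (3 * δ) • ν with hx'
  have hn1 : ∀ t : ℝ, 0 ≤ t → ‖t • ν‖ = t := fun t ht => by
    rw [norm_smul, hν, mul_one, Real.norm_of_nonneg ht]
  have hn2 : ∀ t : ℝ, 0 ≤ t → ‖t • w‖ = t := fun t ht => by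
    rw [norm_smul, hw.norm_eq, mul_one, Real.norm_of_nonneg ht]
  have hx'R : ‖x'‖ ≤ R := by
    have := norm_add_le x ((3 * δ) • ν)
    rw [hn1 _ (by positivity)] at this
    linarith
  have hx''R : ‖x' + (2 * δ) • w‖ ≤ R := by
    have h1 := norm_add_le x ((3 * δ) • ν)
    have h2 := norm_add_le x' ((2 * δ) • w)
    rw [hn1 _ (by positivity)] at h1
    rw [hn2 _ (by positivity)] at h2
    linarith
  have hR1 := h.lt_one
  have hleg1 : lenDist (interior K')ᶜ (ofCoord x) (ofCoord x')
      ≤ ENNReal.ofReal ((1 - R ^ 2)⁻¹ * (3 * δ)) := by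
    refine (lenDist_le_edist_of_segment (by linarith) (by linarith) fun z hz => ?_).trans
      (h.edist_le (by linarith) hx'R ?_)
    · refine ofCoord_mem_compl_interior
        (norm_lt_one_of_mem_segment (by linarith) (by linarith) hz) fun hzA => ?_
      rw [segment_eq_image'] at hz
      obtain ⟨t, ⟨ht0, -⟩, rfl⟩ := hz
      rcases ht0.eq_or_lt with rfl | ht0
      · exact hxi (by simpa using hzA)
      · have h1 := hνA _ (interior_subset hzA)
        rw [hx', add_sub_cancel_left, add_sub_cancel_left, inner_smul_right, inner_smul_right,
          real_inner_self_eq_norm_sq, hν] at h1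
        have : 0 < t * (3 * δ * 1 ^ 2) := by positivity
        linarith
    · rw [hx', sub_add_cancel_left, norm_neg, hn1 _ (by positivity)]
  have hleg2 : lenDist (interior K')ᶜ (ofCoord x') (ofCoord (x' + (2 * δ) • w))
      ≤ ENNReal.ofReal ((1 - R ^ 2)⁻¹ * (2 * δ)) := by
    refine (lenDist_le_edist_of_segment (by linarith) (by linarith) fun z hz => ?_).trans
      (h.edist_le hx'R hx''R ?_)
    · refine ofCoord_mem_compl_interior
        (norm_lt_one_of_mem_segment (by linarith) (by linarith) hz) fun hzA => ?_
      rw [segment_eq_image'] at hz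
      obtain ⟨t, ⟨ht0, -⟩, rfl⟩ := hz
      simp only [add_sub_cancel_left, smul_smul] at hzA
      set s := t * (2 * δ) with hs
      have hs0 : 0 ≤ s := by positivity
      -- If the second leg met the body it would pass within `δ` of some `k` in `K`. Moving back
      -- along `w` to `x'`, of nonnegative height, does not increase the distance to `k`, so `x'`
      -- would be within `2 δ` of the body; but the normal `ν` keeps it at distance at least `3 δ`.
      obtain ⟨k, hk, hzk⟩ := h.near.1 _ (interior_subset hzA)
      obtain ⟨a, ha, hak⟩ := h.near.2 k hk
      have h1 : ‖x' - k‖ ≤ δ := by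
        have e1 : ‖x' + s • w - k‖ ^ 2
            = ‖x' - k‖ ^ 2 + 2 * (s * ⟪w, x' - k₀⟫) + s ^ 2 := by
          rw [add_sub_right_comm, norm_add_sq_real, hn2 s hs0, inner_smul_right,
            real_inner_comm, ← sub_add_sub_cancel x' k₀ k, inner_add_right,
            ← neg_sub k k₀, inner_neg_right, hw.inner_eq k hk, neg_zero, add_zero]
        have e2 : 0 ≤ s * ⟪w, x' - k₀⟫ := mul_nonneg hs0 hside
        have e3 : ‖x' - k‖ ^ 2 ≤ δ ^ 2 := by
          have := pow_le_pow_left₀ (norm_nonneg _) hzk 2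
          nlinarith
        exact (abs_le_of_sq_le_sq' e3 hδ.le).2
      have h2 := hνA a ha
      have h3 := real_inner_le_norm ν (x' - a)
      have h4 : ‖x' - a‖ ≤ δ + δ := by
        rw [← sub_add_sub_cancel x' k a]
        refine (norm_add_le _ _).trans (add_le_add h1 ?_)
        rwa [norm_sub_rev]
      rw [hν, one_mul, hx', add_sub_right_comm, inner_add_right, inner_smul_right,
        real_inner_self_eq_norm_sq, hν, ← neg_sub a x, inner_neg_right, neg_sub,
        ← add_sub_right_comm, ← hx'] at h3
      linarith
    · rw [sub_add_cancel_left, norm_neg, hn2 _ (by positivity)]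
  calc _ ≤ _ := lenDist_triangle _ _ (ofCoord x') _
    _ ≤ _ := add_le_add hleg1 hleg2
    _ = _ := by
      rw [← ENNReal.ofReal_add (by positivity) (by positivity)]
      congr 1
      ring

/-- Over every point of `K` there is a point of the upper side of the boundary of the body. -/
theorem exists_upper (h : CloseBody K' K δ R) (hw : IsUnitNormal K k₀ w)
    {p : EuclideanSpace ℝ (Fin n)} (hp : p ∈ coord '' K) :
    ∃ u ∈ coord '' K', ‖u - p‖ ≤ 3 * δ ∧ (∀ s > (0 : ℝ), u + s • w ∉ coord '' K') ∧
      lenDist (interior K')ᶜ (ofCoord u) (ofCoord (p + (3 * δ) • w))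
        ≤ ENNReal.ofReal ((1 - R ^ 2)⁻¹ * (6 * δ)) := by
  have hδ := h.pos
  have hM := h.const_pos
  have hR1 := h.lt_one
  have hn2 : ∀ t : ℝ, 0 ≤ t → ‖t • w‖ = t := fun t ht => by
    rw [norm_smul, hw.norm_eq, mul_one, Real.norm_of_nonneg ht]
  obtain ⟨a, ha, hap⟩ := h.near.2 p hp
  obtain ⟨t, ht0, htA, ht⟩ := (isCompact_image_coord h.compact).exists_last_mem ha hw.norm_eq
  have hww : ∀ s : ℝ, ⟪w, s • w⟫ = s := fun s => by
    rw [inner_smul_right, real_inner_self_eq_norm_sq, hw.norm_eq]; ring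
  -- The body has thickness at most `2 δ` in the direction `w`.
  have ht2 : t ≤ 2 * δ := by
    have h1 := h.inner_le hw htA
    have h2 := h.neg_le_inner hw ha
    rw [add_sub_right_comm, inner_add_right, hww] at h1
    linarith
  set u := a + t • w with hu
  have hup : ‖u - p‖ ≤ 3 * δ := by
    rw [hu, add_sub_right_comm]
    refine (norm_add_le _ _).trans ?_
    rw [hn2 t ht0]
    linarith
  have hlast : ∀ s > (0 : ℝ), u + s • w ∉ coord '' K' := fun s hs => by
    rw [hu, add_assoc, ← add_smul]
    exact ht _ (by linarith)
  refine ⟨u, htA, hup, hlast, ?_⟩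
  have huR := h.norm_le' u htA
  have hpR := h.norm_le p hp
  have hlift : ∀ v : EuclideanSpace ℝ (Fin n), ‖v‖ + 10 * δ ≤ R → ‖v + (3 * δ) • w‖ ≤ R := by
    intro v hv
    have := norm_add_le v ((3 * δ) • w)
    rw [hn2 _ (by positivity)] at this
    linarith
  have hleg1 : lenDist (interior K')ᶜ (ofCoord u) (ofCoord (u + (3 * δ) • w))
      ≤ ENNReal.ofReal ((1 - R ^ 2)⁻¹ * (3 * δ)) := by
    have hu1 : ‖u‖ < 1 := by linarith
    have hu2 : ‖u + (3 * δ) • w‖ < 1 := (hlift u huR).trans_lt hR1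
    refine (lenDist_le_edist_of_segment hu1 hu2 fun z hz => ?_).trans
      (h.edist_le (by linarith) (hlift u huR) ?_)
    · refine ofCoord_mem_compl_interior (norm_lt_one_of_mem_segment hu1 hu2 hz) fun hzA => ?_
      rw [segment_eq_image'] at hz
      obtain ⟨s, ⟨hs0, -⟩, rfl⟩ := hz
      simp only [add_sub_cancel_left, smul_smul] at hzA
      rcases hs0.eq_or_lt with rfl | hs0
      · rw [zero_mul, zero_smul, add_zero] at hzA
        exact notMem_interior_of_forall_notMem hlast hzA
      · exact hlast _ (by positivity) (interior_subset hzA)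
    · rw [sub_add_cancel_left, norm_neg, hn2 _ (by positivity)]
  have hleg2 : lenDist (interior K')ᶜ (ofCoord (u + (3 * δ) • w)) (ofCoord (p + (3 * δ) • w))
      ≤ ENNReal.ofReal ((1 - R ^ 2)⁻¹ * (3 * δ)) := by
    refine (h.lenDist_le_of_high hw (hlift u huR) (hlift p hpR) ?_ ?_).trans
      (h.edist_le (hlift u huR) (hlift p hpR) ?_)
    · have := h.neg_le_inner hw htA
      rw [add_sub_right_comm, inner_add_right, hww]
      linarith
    · have := hw.inner_eq p hp
      rw [add_sub_right_comm, inner_add_right, hww]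
      linarith
    · rwa [add_sub_add_right_eq_sub]
  calc _ ≤ _ := lenDist_triangle _ _ (ofCoord (u + (3 * δ) • w)) _
    _ ≤ _ := add_le_add hleg1 hleg2
    _ = _ := by
      rw [← ENNReal.ofReal_add (by positivity) (by positivity)]
      congr 1
      ring

end CloseBody

theorem exists_eventually_closeBody {Ks : ℕ → Set (HypSpace n)} {K : Set (HypSpace n)}
    (hKs : ∀ i, IsCompact (Ks i)) (hK : IsCompact K) (hcs : ∀ i, Convex ℝ (coord '' Ks i))
    (hints : ∀ i, (interior (coord '' Ks i)).Nonempty)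
    (hlim : Tendsto (fun i => Metric.hausdorffEDist (Ks i) K) atTop (𝓝 0)) {ε : ℝ} (hε : 0 < ε) :
    ∃ δ R : ℝ, (1 - R ^ 2)⁻¹ * (40 * δ) ≤ ε ∧ ∀ᶠ i in atTop, CloseBody (Ks i) K δ R := by
  obtain ⟨R₀, hR₀0, hR₀1, hR₀⟩ := exists_norm_coord_le hK
  obtain ⟨R, hR₀R, hR1⟩ := exists_between hR₀1
  have hM : 0 < (1 - R ^ 2)⁻¹ := by
    apply inv_pos.2
    nlinarith
  -- `K_i` has radius at most `R₀ + δ`, so the margin `10 δ` requires `11 δ ≤ R - R₀`, which the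
  -- divisor 20 ensures.
  refine ⟨min (ε / ((1 - R ^ 2)⁻¹ * 40)) ((R - R₀) / 20), R, ?_, ?_⟩
  · rw [← mul_assoc, mul_comm, ← le_div_iff₀ (by positivity)]
    exact min_le_left _ _
  · set δ := min (ε / ((1 - R ^ 2)⁻¹ * 40)) ((R - R₀) / 20) with hδ
    have hδ0 : 0 < δ := by
      have := sub_pos.2 hR₀R
      positivity
    have hδR : δ ≤ (R - R₀) / 20 := min_le_right _ _
    filter_upwards [eventually_near hlim hδ0] with i hi
    refine ⟨hKs i, hcs i, hints i, hi, hδ0, hR1, fun v hv => ?_, ?_⟩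
    · obtain ⟨_, ⟨k, hk, rfl⟩, hvk⟩ := hi.1 v hv
      have := norm_le_norm_add_norm_sub' v k.coord
      linarith [hR₀ k hk]
    · rintro _ ⟨k, hk, rfl⟩
      linarith [hR₀ k hk]

namespace CloseBody

variable {K' K : Set (HypSpace n)} {δ R : ℝ}

theorem coord_mem_of_mem_frontier (h : CloseBody K' K δ R) {x : HypSpace n}
    (hx : x ∈ frontier K') : x.coord ∈ coord '' K' ∧ x.coord ∉ interior (coord '' K') :=
  ⟨Set.mem_image_of_mem _ (h.compact.isClosed.frontier_subset hx),
    fun hi => hx.2 (mem_interior_iff_coord.2 hi)⟩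

theorem mem_frontier_of_coord (h : CloseBody K' K δ R) {x : HypSpace n}
    (hx : x.coord ∈ coord '' K') (hxi : x.coord ∉ interior (coord '' K')) : x ∈ frontier K' := by
  rw [h.compact.isClosed.frontier_eq]
  exact ⟨mem_image_coord.1 hx, fun hi => hxi (mem_interior_iff_coord.1 hi)⟩

theorem lenDist_frontier_le (h : CloseBody K' K δ R) {x y : HypSpace n} (hx : x ∈ frontier K')
    (hy : y ∈ frontier K') :
    lenDist (frontier K') x y ≤ lenDist (interior K')ᶜ x y :=
  HypSpace.lenDist_frontier_le h.compact ⟨x, h.compact.isClosed.frontier_subset hx⟩ h.convex hx hy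

/-- If `K` has codimension at least two, then the inner distance of the boundary of a body close
to `K` is close to the distance. -/
theorem lenDist_frontier_le_edist_add (h : CloseBody K' K δ R) (hdim : dim K + 2 ≤ n)
    {x y : HypSpace n} (hx : x ∈ frontier K') (hy : y ∈ frontier K') :
    lenDist (frontier K') x y ≤ edist x y + ENNReal.ofReal ((1 - R ^ 2)⁻¹ * (20 * δ)) := by
  have hδ := h.pos
  have hM := h.const_pos
  refine (h.lenDist_frontier_le hx hy).trans ?_
  obtain ⟨hxA, hxi⟩ := h.coord_mem_of_mem_frontier hx
  obtain ⟨hyA, hyi⟩ := h.coord_mem_of_mem_frontier hy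
  obtain ⟨k₀, hk₀, -⟩ := h.near.1 _ hxA
  obtain ⟨ν, hν, hνA⟩ := h.convex.exists_unit_normal h.interior_nonempty hxi
  obtain ⟨ξ, hξ, hξA⟩ := h.convex.exists_unit_normal h.interior_nonempty hyi
  -- Codimension two enters here: one normal has both displaced endpoints on its nonnegative side,
  -- so both leave the slab on the same side.
  obtain ⟨w, hw, hwx, hwy⟩ := exists_isUnitNormal_nonneg hk₀ hdim
    (x.coord + (3 * δ) • ν - k₀) (y.coord + (3 * δ) • ξ - k₀)
  have hex := h.lenDist_exit_le hw hxA hxi hν hνA hwx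
  have hey := h.lenDist_exit_le hw hyA hyi hξ hξA hwy
  have hmove : ∀ v ν : EuclideanSpace ℝ (Fin n), ‖ν‖ = 1 →
      ‖v + (3 * δ) • ν + (2 * δ) • w - v‖ ≤ 5 * δ := by
    intro v ν hν
    rw [add_assoc, add_sub_cancel_left]
    refine (norm_add_le _ _).trans ?_
    rw [norm_smul, norm_smul, hν, hw.norm_eq, Real.norm_of_nonneg (by positivity),
      Real.norm_of_nonneg (by positivity)]
    linarith
  have hheight : ∀ v : EuclideanSpace ℝ (Fin n), 0 ≤ ⟪w, v - k₀⟫ →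
      2 * δ ≤ ⟪w, v + (2 * δ) • w - k₀⟫ := by
    intro v hv
    rw [add_sub_right_comm, inner_add_right, inner_smul_right, real_inner_self_eq_norm_sq,
      hw.norm_eq]
    linarith
  set x'' := x.coord + (3 * δ) • ν + (2 * δ) • w with hx''
  set y'' := y.coord + (3 * δ) • ξ + (2 * δ) • w with hy''
  have hxm := hmove x.coord ν hν
  have hym := hmove y.coord ξ hξ
  rw [← hx''] at hxm
  rw [← hy''] at hym
  have hxR := h.norm_le' _ hxA
  have hyR := h.norm_le' _ hyA
  have hx''R : ‖x''‖ ≤ R := by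
    have := norm_le_norm_add_norm_sub' x'' x.coord
    linarith
  have hy''R : ‖y''‖ ≤ R := by
    have := norm_le_norm_add_norm_sub' y'' y.coord
    linarith
  have hmid : lenDist (interior K')ᶜ (ofCoord x'') (ofCoord y'')
      ≤ ENNReal.ofReal ((1 - R ^ 2)⁻¹ * (5 * δ)) + (edist x y
        + ENNReal.ofReal ((1 - R ^ 2)⁻¹ * (5 * δ))) := by
    refine (h.lenDist_le_of_high hw hx''R hy''R (hheight _ hwx) (hheight _ hwy)).trans ?_
    have e1 := h.edist_le hx''R (by linarith) hxm
    have e2 := h.edist_le (by linarith) hy''R ((norm_sub_rev _ _).trans_le hym)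
    rw [ofCoord_coord] at e1 e2
    exact (edist_triangle _ x _).trans (add_le_add e1 ((edist_triangle _ y _).trans
      (add_le_add le_rfl e2)))
  rw [ofCoord_coord] at hex hey
  rw [lenDist_comm] at hey
  calc lenDist (interior K')ᶜ x y ≤ lenDist (interior K')ᶜ x (ofCoord x'')
        + (lenDist (interior K')ᶜ (ofCoord x'') (ofCoord y'')
        + lenDist (interior K')ᶜ (ofCoord y'') y) :=
      (lenDist_triangle _ _ _ _).trans (add_le_add_right (lenDist_triangle _ _ _ _) _)
    _ ≤ _ := add_le_add hex (add_le_add hmid hey)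
    _ = edist x y + (ENNReal.ofReal ((1 - R ^ 2)⁻¹ * (5 * δ))
        + ENNReal.ofReal ((1 - R ^ 2)⁻¹ * (5 * δ)) + ENNReal.ofReal ((1 - R ^ 2)⁻¹ * (5 * δ))
        + ENNReal.ofReal ((1 - R ^ 2)⁻¹ * (5 * δ))) := by ring
    _ = _ := by
      rw [← ENNReal.ofReal_add (by positivity) (by positivity),
        ← ENNReal.ofReal_add (by positivity) (by positivity),
        ← ENNReal.ofReal_add (by positivity) (by positivity)]
      congr 2
      ring

theorem edist_le_of_norm_sub_le (h : CloseBody K' K δ R) {x y : HypSpace n} {c : ℝ}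
    (hx : x.coord ∈ coord '' K' ∪ coord '' K) (hy : y.coord ∈ coord '' K' ∪ coord '' K)
    (hxy : ‖x.coord - y.coord‖ ≤ c) : edist x y ≤ ENNReal.ofReal ((1 - R ^ 2)⁻¹ * c) := by
  have hδ := h.pos
  have hn : ∀ v ∈ coord '' K' ∪ coord '' K, ‖v‖ ≤ R := by
    rintro v (hv | hv)
    · linarith [h.norm_le' v hv]
    · linarith [h.norm_le v hv]
  have := h.edist_le (hn _ hx) (hn _ hy) hxy
  rwa [ofCoord_coord, ofCoord_coord] at this

end CloseBody

/-- Any choice of a boundary point within `3 δ` of each point of `K` is an almost isometry, because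
inner and ambient distances of the boundary nearly agree. -/
theorem ghTendsto_frontier_of_dim_add_two_le (hn : 2 ≤ n) {Ks : ℕ → Set (HypSpace n)}
    {K : Set (HypSpace n)} (hKs : ∀ i, IsCompact (Ks i)) (hK : IsCompact K) (hne : K.Nonempty)
    (hcs : ∀ i, Convex ℝ (coord '' Ks i)) (hints : ∀ i, (interior (coord '' Ks i)).Nonempty)
    (hdim : dim K + 2 ≤ n)
    (hlim : Tendsto (fun i => Metric.hausdorffEDist (Ks i) K) atTop (𝓝 0)) :
    GHTendsto (fun i (x y : frontier (Ks i)) => innerEDist x y) (fun x y : K => edist x y) := by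
  have : CompactSpace K := isCompact_iff_compactSpace.1 hK
  have : Nonempty K := hne.to_subtype
  refine ghTendsto_of_approx (fun i => isCompactMetric_frontier hn (hKs i) (hcs i) (hints i))
    isCompactMetric_edist fun ε hε => ?_
  obtain ⟨δ, R, hδR, hev⟩ := exists_eventually_closeBody hKs hK hcs hints hlim hε
  filter_upwards [hev] with i h
  have hδ := h.pos
  have hM := h.const_pos
  obtain ⟨k₀, hk₀⟩ := hne
  obtain ⟨w, hw⟩ := exists_isUnitNormal (Set.mem_image_of_mem coord hk₀) (by omega : dim K < n)
  have hg : ∀ p : K, ∃ u ∈ frontier (Ks i), ‖u.coord - p.1.coord‖ ≤ 3 * δ := by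
    intro p
    obtain ⟨_, ⟨u, hu, rfl⟩, hup, hlast, -⟩ :=
      h.exists_upper hw (Set.mem_image_of_mem coord p.2)
    exact ⟨u, h.mem_frontier_of_coord (Set.mem_image_of_mem _ hu)
      (notMem_interior_of_forall_notMem hlast), hup⟩
  choose g hg hgp using hg
  have hK : ∀ p : K, p.1.coord ∈ coord '' Ks i ∪ coord '' K := fun p =>
    Or.inr (Set.mem_image_of_mem _ p.2)
  have hfr : ∀ x ∈ frontier (Ks i), x.coord ∈ coord '' Ks i ∪ coord '' K := fun x hx =>
    Or.inl (h.coord_mem_of_mem_frontier hx).1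
  have hclose : ∀ p : K, edist (g p) p ≤ ENNReal.ofReal ((1 - R ^ 2)⁻¹ * (3 * δ)) := fun p =>
    h.edist_le_of_norm_sub_le (hfr _ (hg p)) (hK p) (hgp p)
  refine ⟨fun p => ⟨g p, hg p⟩, fun p q => ?_, fun x => ?_⟩
  · simp only [innerEDist_subtype]
    have hp := hclose p
    have hq := hclose q
    constructor
    · calc _ ≤ _ := h.lenDist_frontier_le_edist_add hdim (hg p) (hg q)
        _ ≤ (edist (g p) p + (edist p q + edist (q : HypSpace n) (g q)))
            + ENNReal.ofReal ((1 - R ^ 2)⁻¹ * (20 * δ)) := by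
          refine add_le_add_left ?_ _
          exact (edist_triangle _ (p : HypSpace n) _).trans
            (add_le_add le_rfl (edist_triangle _ (q : HypSpace n) _))
        _ ≤ (ENNReal.ofReal ((1 - R ^ 2)⁻¹ * (3 * δ)) + (edist p q
            + ENNReal.ofReal ((1 - R ^ 2)⁻¹ * (3 * δ))))
            + ENNReal.ofReal ((1 - R ^ 2)⁻¹ * (20 * δ)) := by
          rw [edist_comm (q : HypSpace n)]
          gcongr
        _ = edist p q + (ENNReal.ofReal ((1 - R ^ 2)⁻¹ * (3 * δ))
            + ENNReal.ofReal ((1 - R ^ 2)⁻¹ * (3 * δ))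
            + ENNReal.ofReal ((1 - R ^ 2)⁻¹ * (20 * δ))) := by ring
        _ ≤ _ := by
          rw [← ENNReal.ofReal_add (by positivity) (by positivity),
            ← ENNReal.ofReal_add (by positivity) (by positivity)]
          gcongr
          nlinarith [mul_pos hM hδ]
    · calc edist p q ≤ edist (p : HypSpace n) (g p) + (edist (g p) (g q) + edist (g q) q) :=
          (edist_triangle (p : HypSpace n) (g p) q).trans
            (add_le_add le_rfl (edist_triangle _ (g q) _))
        _ ≤ ENNReal.ofReal ((1 - R ^ 2)⁻¹ * (3 * δ)) + (lenDist (frontier (Ks i)) (g p) (g q)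
            + ENNReal.ofReal ((1 - R ^ 2)⁻¹ * (3 * δ))) := by
          rw [edist_comm (p : HypSpace n)]
          gcongr
          exact edist_le_lenDist _ _ _
        _ = lenDist (frontier (Ks i)) (g p) (g q) + (ENNReal.ofReal ((1 - R ^ 2)⁻¹ * (3 * δ))
            + ENNReal.ofReal ((1 - R ^ 2)⁻¹ * (3 * δ))) := by ring
        _ ≤ _ := by
          rw [← ENNReal.ofReal_add (by positivity) (by positivity)]
          gcongr
          nlinarith [mul_pos hM hδ]
  · obtain ⟨_, ⟨p, hp, rfl⟩, hxp⟩ := h.near.1 _ (h.coord_mem_of_mem_frontier x.2).1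
    refine ⟨⟨p, hp⟩, ?_⟩
    simp only [innerEDist_subtype]
    have h1 : edist (x : HypSpace n) (g ⟨p, hp⟩) ≤ ENNReal.ofReal ((1 - R ^ 2)⁻¹ * (4 * δ)) := by
      refine h.edist_le_of_norm_sub_le (hfr _ x.2) (hfr _ (hg _)) ?_
      have := norm_sub_le (x.1.coord - p.coord) ((g ⟨p, hp⟩).coord - p.coord)
      rw [sub_sub_sub_cancel_right] at this
      linarith [hgp ⟨p, hp⟩]
    refine (h.lenDist_frontier_le_edist_add hdim x.2 (hg _)).trans
      ((add_le_add_left h1 _).trans ?_)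
    rw [← ENNReal.ofReal_add (by positivity) (by positivity)]
    apply ENNReal.ofReal_le_ofReal
    nlinarith [mul_pos hM hδ]

/-- The estimate `lenDist_frontier_le_edist_add` is uniform in the two points. Of the two truncated
differences, whose maximum plays the role of the absolute value, the second vanishes. -/
theorem tendsto_iSup_innerEDist_sub_edist {Ks : ℕ → Set (HypSpace n)}
    {K : Set (HypSpace n)} (hKs : ∀ i, IsCompact (Ks i)) (hK : IsCompact K)
    (hcs : ∀ i, Convex ℝ (coord '' Ks i)) (hints : ∀ i, (interior (coord '' Ks i)).Nonempty)
    (hdim : dim K + 2 ≤ n)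
    (hlim : Tendsto (fun i => Metric.hausdorffEDist (Ks i) K) atTop (𝓝 0)) :
    Tendsto (fun i => ⨆ (x : frontier (Ks i)) (y : frontier (Ks i)),
      max (innerEDist x y - edist x y) (edist x y - innerEDist x y)) atTop (𝓝 0) := by
  rw [ENNReal.tendsto_nhds_zero]
  intro ε hε
  obtain ⟨ε', hε'0, hε'⟩ : ∃ ε' : ℝ, 0 < ε' ∧ ENNReal.ofReal ε' ≤ ε := by
    obtain ⟨r, hr0, hr⟩ := ENNReal.lt_iff_exists_nnreal_btwn.1 hε
    exact ⟨r, by simpa using hr0, by simpa using hr.le⟩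
  obtain ⟨δ, R, hδR, hev⟩ := exists_eventually_closeBody hKs hK hcs hints hlim hε'0
  filter_upwards [hev] with i h
  have hδ := h.pos
  have hM := h.const_pos
  refine iSup₂_le fun x y => max_le ?_ ?_
  · rw [tsub_le_iff_left, innerEDist_subtype]
    refine (h.lenDist_frontier_le_edist_add hdim x.2 y.2).trans ?_
    refine add_le_add le_rfl (le_trans (ENNReal.ofReal_le_ofReal ?_) hε')
    nlinarith [mul_pos hM hδ]
  · rw [tsub_eq_zero_of_le (edist_le_innerEDist x y)]
    exact zero_le

/-! ### The double -/

/-- The point of the double represented by a point of one of the copies. -/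
def Double.mk (K : Set (HypSpace n)) (p : K × Bool) : Double K := Quotient.mk (doubleSetoid K) p

theorem Double.surjective_mk (K : Set (HypSpace n)) : Function.Surjective (Double.mk K) :=
  Quotient.exists_rep

theorem doubleEDist_mk (K : Set (HypSpace n)) (p q : K × Bool) :
    doubleEDist K (Double.mk K p) (Double.mk K q) = preDoubleEDist K p q := rfl

theorem relBoundary_subset {K : Set (HypSpace n)} (hK : IsCompact K) : relBoundary K ⊆ K :=
  fun _ hx => mem_image_coord.1 (intrinsicFrontier_subset (isCompact_image_coord hK).isClosed hx)

theorem isClosed_relBoundary (K : Set (HypSpace n)) : IsClosed (relBoundary K) :=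
  (isClosed_intrinsicFrontier (AffineSubspace.closed_of_finiteDimensional _)).preimage
    continuous_coord

/-- A nonzero direction exists, and moving by a vector of length 2 leaves the unit ball, so a
segment from `K` crosses the relative boundary. A single point has none, and its two copies would be
at infinite distance. -/
theorem relBoundary_nonempty {K : Set (HypSpace n)} (hK : IsCompact K) (hne : K.Nonempty)
    (hdim : dim K ≠ 0) : (relBoundary K).Nonempty := by
  obtain ⟨x, hx⟩ := hne
  have hxC := Set.mem_image_of_mem coord hx
  have hxs := subset_affineSpan ℝ _ hxC
  have : Nontrivial (affineSpan ℝ (coord '' K)).direction :=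
    Module.nontrivial_of_finrank_pos (R := ℝ) (Nat.pos_of_ne_zero hdim)
  obtain ⟨⟨v, hv⟩, hv0⟩ := exists_ne (0 : (affineSpan ℝ (coord '' K)).direction)
  have hv0 : v ≠ 0 := fun h => hv0 (Subtype.ext h)
  obtain ⟨z, hz, -⟩ := exists_mem_intrinsicFrontier_segment hxC
    (q := (2 / ‖v‖) • v +ᵥ x.coord)
    (AffineSubspace.vadd_mem_of_mem_direction (Submodule.smul_mem _ _ hv) hxs) (fun hq => by
      have h1 := norm_lt_of_mem_image_coord hq
      have h2 := norm_sub_le ((2 / ‖v‖) • v + x.coord) x.coord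
      rw [add_sub_cancel_right, norm_smul, norm_div, norm_norm, div_mul_cancel₀ _
        (norm_ne_zero_iff.2 hv0), Real.norm_ofNat] at h2
      rw [vadd_eq_add] at h1
      linarith [x.norm_coord_lt])
  have hzC := intrinsicFrontier_subset (isCompact_image_coord hK).isClosed hz
  obtain ⟨y, -, rfl⟩ := hzC
  exact ⟨y, hz⟩

theorem edist_le_preDoubleEDist (K : Set (HypSpace n)) (p q : K × Bool) :
    edist p.1 q.1 ≤ preDoubleEDist K p q := by
  rw [preDoubleEDist]
  split_ifs
  · exact le_rfl
  · exact le_iInf₂ fun z _ => edist_triangle _ z _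

theorem preDoubleEDist_triangle_of_eq (K : Set (HypSpace n)) {p q r : K × Bool} (h : p.2 = q.2) :
    preDoubleEDist K p r ≤ preDoubleEDist K p q + preDoubleEDist K q r := by
  rw [preDoubleEDist, preDoubleEDist, preDoubleEDist, if_pos h, h]
  split_ifs
  · exact edist_triangle _ _ _
  · simp only [ENNReal.add_iInf]
    refine iInf₂_mono fun z _ => ?_
    rw [← add_assoc]
    exact add_le_add_left (edist_triangle _ _ _) _

/-- With two copies only, either some leg stays within a copy, or both legs change copies and the
endpoints share one; then the ambient triangle inequality suffices. -/
theorem preDoubleEDist_triangle (K : Set (HypSpace n)) (p q r : K × Bool) :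
    preDoubleEDist K p r ≤ preDoubleEDist K p q + preDoubleEDist K q r := by
  by_cases hpq : p.2 = q.2
  · exact preDoubleEDist_triangle_of_eq K hpq
  · by_cases hqr : q.2 = r.2
    · rw [preDoubleEDist_comm K p r, preDoubleEDist_comm K p q, preDoubleEDist_comm K q r, add_comm]
      exact preDoubleEDist_triangle_of_eq K hqr.symm
    · have hpr : p.2 = r.2 := by
        revert hpq hqr
        generalize p.2 = a
        generalize q.2 = b
        generalize r.2 = c
        revert a b c
        decide
      calc preDoubleEDist K p r = edist p.1 r.1 := if_pos hpr
        _ ≤ edist p.1 q.1 + edist q.1 r.1 := edist_triangle _ _ _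
        _ ≤ _ := add_le_add (edist_le_preDoubleEDist K p q) (edist_le_preDoubleEDist K q r)

theorem preDoubleEDist_self (K : Set (HypSpace n)) (p : K × Bool) : preDoubleEDist K p p = 0 := by
  rw [preDoubleEDist, if_pos rfl, edist_self]

/-- A vanishing infimum between different copies puts the point into the closure of the relative
boundary, which is closed. -/
theorem rel_of_preDoubleEDist_eq_zero {K : Set (HypSpace n)} {p q : K × Bool}
    (h : preDoubleEDist K p q = 0) : (doubleSetoid K).r p q := by
  have h1 : p.1 = q.1 := edist_le_zero.1 ((edist_le_preDoubleEDist K p q).trans h.le)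
  refine ⟨h1, ?_⟩
  by_cases h2 : p.2 = q.2
  · exact Or.inl h2
  · right
    rw [preDoubleEDist, if_neg h2] at h
    rw [← (isClosed_relBoundary K).closure_eq, Metric.mem_closure_iff_infEDist_zero]
    refine le_antisymm (le_trans ?_ h.le) zero_le
    exact iInf₂_mono fun z _ => le_self_add

theorem preDoubleEDist_ne_top {K : Set (HypSpace n)} (hne : (relBoundary K).Nonempty)
    (p q : K × Bool) : preDoubleEDist K p q ≠ ⊤ := by
  rw [preDoubleEDist]
  split_ifs
  · exact edist_ne_top _ _
  · obtain ⟨z, hz⟩ := hne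
    exact ne_top_of_le_ne_top (ENNReal.add_ne_top.2 ⟨edist_ne_top _ _, edist_ne_top _ _⟩)
      (iInf₂_le z hz)

/-- The metric of the double, as a metric space structure. -/
abbrev doubleEMetricSpace (K : Set (HypSpace n)) : EMetricSpace (Double K) where
  edist := doubleEDist K
  edist_self x := by
    obtain ⟨p, rfl⟩ := Double.surjective_mk K x
    exact preDoubleEDist_self K p
  edist_comm x y := by
    obtain ⟨p, rfl⟩ := Double.surjective_mk K x
    obtain ⟨q, rfl⟩ := Double.surjective_mk K y
    exact preDoubleEDist_comm K p q
  edist_triangle x y z := by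
    obtain ⟨p, rfl⟩ := Double.surjective_mk K x
    obtain ⟨q, rfl⟩ := Double.surjective_mk K y
    obtain ⟨r, rfl⟩ := Double.surjective_mk K z
    exact preDoubleEDist_triangle K p q r
  eq_of_edist_eq_zero {x y} h := by
    obtain ⟨p, rfl⟩ := Double.surjective_mk K x
    obtain ⟨q, rfl⟩ := Double.surjective_mk K y
    exact Quotient.sound (s := doubleSetoid K) (rel_of_preDoubleEDist_eq_zero h)

theorem doubleEDist_ne_top {K : Set (HypSpace n)} (hne : (relBoundary K).Nonempty)
    (x y : Double K) : doubleEDist K x y ≠ ⊤ := by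
  obtain ⟨p, rfl⟩ := Double.surjective_mk K x
  obtain ⟨q, rfl⟩ := Double.surjective_mk K y
  exact preDoubleEDist_ne_top hne p q

theorem isCompactMetric_double {K : Set (HypSpace n)} (hK : IsCompact K) (hne : K.Nonempty)
    (hbd : (relBoundary K).Nonempty) : IsCompactMetric (doubleEDist K) := by
  have : CompactSpace K := isCompact_iff_compactSpace.1 hK
  have : Nonempty K := hne.to_subtype
  refine isCompactMetric_of_ne_top (Z := K × Bool) (doubleEMetricSpace K) (doubleEDist_ne_top hbd)
    (Double.surjective_mk K) fun z ε hε => ?_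
  have h1 : ∀ᶠ z' in 𝓝 z, z'.2 = z.2 :=
    continuous_snd.tendsto z ((isOpen_discrete ({z.2} : Set Bool)).mem_nhds rfl)
  have h2 : ∀ᶠ z' in 𝓝 z, edist z'.1 z.1 < ε :=
    EMetric.tendsto_nhds.1 (continuous_fst.tendsto z) ε hε
  filter_upwards [h1, h2] with z' h1 h2
  change preDoubleEDist K z' z < ε
  rwa [preDoubleEDist, if_pos h1]

/-- The metric of the double is intrinsic. -/
theorem isIntrinsicMetric_double {K : Set (HypSpace n)} (hK : IsCompact K)
    (hc : Convex ℝ (coord '' K)) (hbd : (relBoundary K).Nonempty) :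
    IsIntrinsicMetric (doubleEDist K) := by
  let m : MetricSpace (Double K) :=
    @EMetricSpace.toMetricSpace _ (doubleEMetricSpace K) (doubleEDist_ne_top hbd)
  have hm : ∀ x y : Double K, edist x y = doubleEDist K x y := fun _ _ => rfl
  refine ⟨m, hm, fun x y => le_antisymm ?_ ((hm x y).symm.le.trans (edist_le_innerEDist x y))⟩
  -- Each copy is a 1-Lipschitz image of `K`, whose metric is intrinsic by convexity. Paths between
  -- the copies are glued at relative boundary points.
  have hcopy : ∀ (b : Bool) (x y : K),
      innerEDist (Double.mk K (x, b)) (Double.mk K (y, b)) ≤ edist x y := by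
    intro b x y
    have hlip : LipschitzWith 1 fun x : K => Double.mk K (x, b) := by
      intro x y
      rw [hm, doubleEDist_mk, preDoubleEDist, if_pos rfl, ENNReal.coe_one, one_mul]
    have h1 := lenDist_le_mul_of_lipschitzOn one_ne_zero (hlip.lipschitzOnWith (s := Set.univ))
      (Set.mapsTo_univ _ _) x y
    rw [ENNReal.coe_one, one_mul, ← innerEDist_eq_lenDist_univ, ← innerEDist_eq_lenDist_univ,
      innerEDist_subtype, lenDist_eq_edist_of_convex hc x.2 y.2] at h1
    exact h1
  obtain ⟨⟨x, a⟩, rfl⟩ := Double.surjective_mk K x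
  obtain ⟨⟨y, b⟩, rfl⟩ := Double.surjective_mk K y
  rw [doubleEDist_mk, preDoubleEDist]
  split_ifs with hab
  · simp only at hab
    rw [hab]
    exact hcopy b x y
  · refine le_iInf₂ fun z hz => ?_
    have hzK := relBoundary_subset hK hz
    have hglue : Double.mk K (⟨z, hzK⟩, a) = Double.mk K (⟨z, hzK⟩, b) :=
      Quotient.sound (s := doubleSetoid K) ⟨rfl, Or.inr hz⟩
    refine (innerEDist_triangle _ (Double.mk K (⟨z, hzK⟩, a)) _).trans
      (add_le_add (hcopy a x ⟨z, hzK⟩) ?_)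
    rw [hglue]
    exact hcopy b ⟨z, hzK⟩ y

end HypSpace

theorem edist_add_edist_le_eVariationOn_path {X : Type*} [PseudoEMetricSpace X] {x y : X}
    (γ : Path x y) (t : unitInterval) :
    edist x (γ t) + edist (γ t) y ≤ eVariationOn γ Set.univ := by
  have hu : (Set.univ : Set unitInterval) = Set.Iic t ∪ Set.Ici t := Set.Iic_union_Ici.symm
  rw [hu, eVariationOn.union _ isGreatest_Iic isLeast_Ici]
  have h1 := eVariationOn.edist_le γ (s := Set.Iic t) (x := 0) (y := t) t.2.1 Set.self_mem_Iic
  have h2 := eVariationOn.edist_le γ (s := Set.Ici t) (x := t) (y := 1) Set.self_mem_Ici t.2.2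
  rw [γ.source] at h1
  rw [γ.target] at h2
  exact add_le_add h1 h2

namespace HypSpace

variable {n : ℕ}

/-! ### Limits of codimension one -/

theorem IsUnitNormal.direction_le {K : Set (HypSpace n)} {k₀ w : EuclideanSpace ℝ (Fin n)}
    (hw : IsUnitNormal K k₀ w) :
    (affineSpan ℝ (coord '' K)).direction ≤ (Submodule.span ℝ {w})ᗮ := by
  rw [direction_affineSpan, vectorSpan, Submodule.span_le]
  rintro _ ⟨k, hk, l, hl, rfl⟩
  rw [SetLike.mem_coe, Submodule.mem_orthogonal_singleton_iff_inner_right]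
  change ⟪w, k - l⟫ = 0
  rw [← sub_sub_sub_cancel_right k l k₀, inner_sub_right, hw.inner_eq k hk, hw.inner_eq l hl,
    sub_zero]

/-- In codimension one the direction of `K` fills the orthogonal complement of `w`, by equality of
dimensions. -/
theorem mem_direction_of_inner_eq_zero {K : Set (HypSpace n)} {k₀ w : EuclideanSpace ℝ (Fin n)}
    (hdim : dim K + 1 = n) (hw : IsUnitNormal K k₀ w) {m : EuclideanSpace ℝ (Fin n)}
    (hm : ⟪m, w⟫ = 0) : m ∈ (affineSpan ℝ (coord '' K)).direction := by
  have hw0 : w ≠ 0 := by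
    rintro rfl
    simpa using hw.norm_eq
  have h1 := (Submodule.span ℝ {w}).finrank_add_finrank_orthogonal
  rw [finrank_euclideanSpace_fin, finrank_span_singleton hw0] at h1
  rw [Submodule.eq_of_le_of_finrank_eq hw.direction_le (by rw [dim] at hdim; omega),
    Submodule.mem_orthogonal_singleton_iff_inner_left]
  exact hm

theorem inner_eq_zero_of_mem_direction {K : Set (HypSpace n)} {k₀ w : EuclideanSpace ℝ (Fin n)}
    (hw : IsUnitNormal K k₀ w) {m : EuclideanSpace ℝ (Fin n)}
    (hm : m ∈ (affineSpan ℝ (coord '' K)).direction) : ⟪m, w⟫ = 0 := by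
  exact Submodule.mem_orthogonal_singleton_iff_inner_left.1 (hw.direction_le hm)

/-- A path in the boundary of a convex body from the upper to the lower side (with respect to the
direction `w`) passes through a point whose line of direction `w` misses the interior. -/
theorem exists_line_notMem_interior {A : Set (EuclideanSpace ℝ (Fin n))} (hA : Convex ℝ A)
    {w : EuclideanSpace ℝ (Fin n)} {c : unitInterval → EuclideanSpace ℝ (Fin n)}
    (hc : Continuous c) (hcA : ∀ t, c t ∉ interior A)
    (h0 : ∀ s > (0 : ℝ), c 0 + s • w ∉ interior A)
    (h1 : ∀ s > (0 : ℝ), c 1 + s • -w ∉ interior A) :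
    ∃ t, ∀ s : ℝ, c t + s • w ∉ interior A := by
  have hclosed : ∀ w : EuclideanSpace ℝ (Fin n),
      IsClosed {t | ∀ s > (0 : ℝ), c t + s • w ∉ interior A} := by
    intro w
    simp only [Set.ofPred_forall]
    refine isClosed_iInter fun s => isClosed_iInter fun _ => ?_
    exact (isOpen_interior.preimage (by fun_prop : Continuous fun t => c t + s • w)).isClosed_compl
  -- If both half-lines from `c t` met the interior, convexity would put `c t` into it. So two
  -- closed sets cover the interval, each containing an endpoint, and connectedness gives a common
  -- point.
  have hcover : (Set.univ : Set unitInterval) ⊆ {t | ∀ s > (0 : ℝ), c t + s • w ∉ interior A}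
      ∪ {t | ∀ s > (0 : ℝ), c t + s • -w ∉ interior A} := by
    intro t _
    by_contra h
    simp only [Set.mem_union, Set.mem_ofPred_eq, not_or, not_forall, not_not] at h
    obtain ⟨⟨a, ha, haA⟩, b, hb, hbA⟩ := h
    apply hcA t
    have := hA.interior haA hbA (a := b / (a + b)) (b := a / (a + b)) (by positivity)
      (by positivity) (by field_simp; ring)
    convert this using 1
    match_scalars <;> field_simp <;> ring
  obtain ⟨t, -, ht1, ht2⟩ := isPreconnected_closed_iff.1 (isPreconnected_univ (α := unitInterval))
    _ _ (hclosed w) (hclosed (-w)) hcover ⟨0, Set.mem_univ _, h0⟩ ⟨1, Set.mem_univ _, h1⟩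
  refine ⟨t, fun s => ?_⟩
  rcases lt_trichotomy s 0 with hs | rfl | hs
  · have := ht2 (-s) (by linarith)
    rwa [smul_neg, neg_smul, neg_neg] at this
  · simpa using hcA t
  · exact ht1 s hs

namespace CloseBody

variable {K' K : Set (HypSpace n)} {δ R : ℝ} {k₀ w : EuclideanSpace ℝ (Fin n)}

theorem norm_lift_le (h : CloseBody K' K δ R) (hw : ‖w‖ = 1) {v : EuclideanSpace ℝ (Fin n)}
    (hv : v ∈ coord '' K' ∪ coord '' K) : ‖v + (3 * δ) • w‖ ≤ R := by
  have hδ := h.pos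
  have h1 : ‖v‖ + 10 * δ ≤ R := hv.elim (h.norm_le' v) (h.norm_le v)
  have h2 := norm_add_le v ((3 * δ) • w)
  rw [norm_smul, hw, Real.norm_of_nonneg (by positivity)] at h2
  linarith

theorem lenDist_lift_le (h : CloseBody K' K δ R) (hw : IsUnitNormal K k₀ w) {p q : HypSpace n}
    (hp : p ∈ K) (hq : q ∈ K) :
    lenDist (interior K')ᶜ (ofCoord (p.coord + (3 * δ) • w)) (ofCoord (q.coord + (3 * δ) • w))
      ≤ edist p q + ENNReal.ofReal ((1 - R ^ 2)⁻¹ * (6 * δ)) := by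
  have hδ := h.pos
  have hM := h.const_pos
  have hn : ∀ p ∈ K, ‖p.coord + (3 * δ) • w‖ ≤ R := fun p hp =>
    h.norm_lift_le hw.norm_eq (Or.inr (Set.mem_image_of_mem _ hp))
  have hn0 : ∀ p ∈ K, ‖p.coord‖ ≤ R := fun p hp => by
    linarith [h.norm_le _ (Set.mem_image_of_mem coord hp)]
  have hh : ∀ p ∈ K, 2 * δ ≤ ⟪w, p.coord + (3 * δ) • w - k₀⟫ := by
    intro p hp
    rw [add_sub_right_comm, inner_add_right, inner_smul_right, real_inner_self_eq_norm_sq,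
      hw.norm_eq, hw.inner_eq _ (Set.mem_image_of_mem coord hp)]
    linarith
  have he : ∀ p ∈ K, edist (ofCoord (p.coord + (3 * δ) • w)) p
      ≤ ENNReal.ofReal ((1 - R ^ 2)⁻¹ * (3 * δ)) := by
    intro p hp
    have := h.edist_le (hn p hp) (hn0 p hp) (c := 3 * δ) (by
      rw [add_sub_cancel_left, norm_smul, hw.norm_eq, Real.norm_of_nonneg (by positivity), mul_one])
    rwa [ofCoord_coord] at this
  have hq' := he q hq
  rw [edist_comm] at hq'
  refine (h.lenDist_le_of_high hw (hn p hp) (hn q hq) (hh p hp) (hh q hq)).trans ?_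
  calc _ ≤ _ := (edist_triangle _ p _).trans (add_le_add (he p hp) ((edist_triangle _ q _).trans
        (add_le_add le_rfl hq')))
    _ = edist p q + (ENNReal.ofReal ((1 - R ^ 2)⁻¹ * (3 * δ))
        + ENNReal.ofReal ((1 - R ^ 2)⁻¹ * (3 * δ))) := by ring
    _ = _ := by
      rw [← ENNReal.ofReal_add (by positivity) (by positivity)]
      congr 2
      ring

/-- Near the relative boundary of `K` one gets from the upper to the lower side of a body. -/
theorem lenDist_around_edge_le (h : CloseBody K' K δ R) (hw : IsUnitNormal K k₀ w)
    {p : HypSpace n} (hp : p ∈ K) {m : EuclideanSpace ℝ (Fin n)} (hm : ‖m‖ = 1)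
    (hmK : ∀ k ∈ coord '' K, ⟪m, k - p.coord⟫ ≤ 0) (hmw : ⟪m, w⟫ = 0) :
    lenDist (interior K')ᶜ (ofCoord (p.coord + (3 * δ) • w)) (ofCoord (p.coord + (3 * δ) • -w))
      ≤ ENNReal.ofReal ((1 - R ^ 2)⁻¹ * (12 * δ)) := by
  have hδ := h.pos
  have hM := h.const_pos
  have hpC := Set.mem_image_of_mem coord hp
  have hpR := h.norm_le _ hpC
  -- At height `3 δ`, move sideways by `3 δ` beyond the edge. The statement is for any normal, to be
  -- used on both sides.
  have hleg : ∀ w, IsUnitNormal K k₀ w → ⟪m, w⟫ = 0 →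
      ‖p.coord + (3 * δ) • w + (3 * δ) • m‖ ≤ R ∧
      lenDist (interior K')ᶜ (ofCoord (p.coord + (3 * δ) • w))
        (ofCoord (p.coord + (3 * δ) • w + (3 * δ) • m))
        ≤ ENNReal.ofReal ((1 - R ^ 2)⁻¹ * (3 * δ)) := by
    intro w hw hmw
    have hn1 := h.norm_lift_le hw.norm_eq (Or.inr hpC)
    have hn2 : ‖p.coord + (3 * δ) • w + (3 * δ) • m‖ ≤ R := by
      have h1 := norm_add_le p.coord ((3 * δ) • w)
      have h2 := norm_add_le (p.coord + (3 * δ) • w) ((3 * δ) • m)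
      rw [norm_smul, hw.norm_eq, Real.norm_of_nonneg (by positivity)] at h1
      rw [norm_smul (3 * δ) m, hm, Real.norm_of_nonneg (by positivity)] at h2
      linarith
    have hh : ∀ s : ℝ, ⟪w, p.coord + (3 * δ) • w + s • m - k₀⟫ = 3 * δ := by
      intro s
      rw [add_sub_right_comm, add_sub_right_comm, inner_add_right, inner_add_right,
        inner_smul_right, inner_smul_right, real_inner_self_eq_norm_sq, hw.norm_eq,
        hw.inner_eq _ hpC, real_inner_comm, hmw]
      ring
    refine ⟨hn2, (h.lenDist_le_of_high hw hn1 hn2 ?_ ?_).trans (h.edist_le hn1 hn2 ?_)⟩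
    · have := hh 0
      rw [zero_smul, add_zero] at this
      linarith
    · linarith [hh (3 * δ)]
    · rw [sub_add_cancel_left, norm_neg, norm_smul, hm, Real.norm_of_nonneg (by positivity),
        mul_one]
  obtain ⟨hn1, hl1⟩ := hleg w hw hmw
  obtain ⟨hn2, hl2⟩ := hleg (-w) hw.neg (by rw [inner_neg_right, hmw, neg_zero])
  -- The vertical segment between the sides lies at `m`-height `3 δ`, while the body has `m`-height
  -- at most `δ`.
  have hmid : lenDist (interior K')ᶜ (ofCoord (p.coord + (3 * δ) • w + (3 * δ) • m))
      (ofCoord (p.coord + (3 * δ) • -w + (3 * δ) • m))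
        ≤ ENNReal.ofReal ((1 - R ^ 2)⁻¹ * (6 * δ)) := by
    refine (lenDist_le_of_halfspace (m := m) (b := p.coord) (c := δ) (fun a ha => ?_)
      (hn1.trans_lt h.lt_one) (hn2.trans_lt h.lt_one) ?_ ?_).trans (h.edist_le hn1 hn2 ?_)
    · obtain ⟨k, hk, hak⟩ := h.near.1 a ha
      have h1 := real_inner_le_norm m (a - k)
      rw [hm, one_mul] at h1
      have h2 := hmK k hk
      rw [← sub_add_sub_cancel a k p.coord, inner_add_right]
      linarith
    · rw [add_assoc, add_sub_cancel_left, inner_add_right, inner_smul_right, inner_smul_right, hmw,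
        real_inner_self_eq_norm_sq, hm]
      linarith
    · rw [add_assoc, add_sub_cancel_left, inner_add_right, inner_smul_right, inner_smul_right,
        inner_neg_right, hmw, real_inner_self_eq_norm_sq, hm]
      linarith
    · have e : p.coord + (3 * δ) • w + (3 * δ) • m - (p.coord + (3 * δ) • -w + (3 * δ) • m)
          = (6 * δ) • w := by module
      rw [e, norm_smul, hw.norm_eq, Real.norm_of_nonneg (by positivity), mul_one]
  rw [lenDist_comm] at hl2
  calc _ ≤ _ := (lenDist_triangle _ _ _ _).trans
        (add_le_add hl1 ((lenDist_triangle _ _ _ _).trans (add_le_add hmid hl2)))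
    _ = _ := by
      rw [← ENNReal.ofReal_add (by positivity) (by positivity),
        ← ENNReal.ofReal_add (by positivity) (by positivity)]
      congr 1
      ring

/-- The change of sides happens at a point `e` within `δ` of `z` where a relative normal is
available; replacing `z` by `e` costs `2 δ`. -/
theorem lenDist_lift_opposite_le (h : CloseBody K' K δ R) (hK : IsCompact K)
    (hc : Convex ℝ (coord '' K)) (hw : IsUnitNormal K k₀ w) {p q z : HypSpace n}
    (hp : p ∈ K) (hq : q ∈ K) (hz : z ∈ relBoundary K) :
    lenDist (interior K')ᶜ (ofCoord (p.coord + (3 * δ) • w)) (ofCoord (q.coord + (3 * δ) • -w))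
      ≤ edist p z + edist z q + ENNReal.ofReal ((1 - R ^ 2)⁻¹ * (26 * δ)) := by
  have hδ := h.pos
  have hM := h.const_pos
  obtain ⟨_, ⟨e, he, rfl⟩, hez, m, hmd, hm, hmK⟩ :=
    exists_relative_normal_near hc (isCompact_image_coord hK).isClosed hz hδ
  have hzK := relBoundary_subset hK hz
  have hze : edist z e ≤ ENNReal.ofReal ((1 - R ^ 2)⁻¹ * δ) :=
    h.edist_le_of_norm_sub_le (Or.inr (Set.mem_image_of_mem _ hzK))
      (Or.inr (Set.mem_image_of_mem _ he)) (by rwa [norm_sub_rev])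
  have h1 := h.lenDist_lift_le hw hp he
  have h2 := h.lenDist_around_edge_le hw he hm hmK (inner_eq_zero_of_mem_direction hw hmd)
  have h3 := h.lenDist_lift_le hw.neg he hq
  have h4 : edist p e ≤ edist p z + ENNReal.ofReal ((1 - R ^ 2)⁻¹ * δ) :=
    (edist_triangle _ z _).trans (add_le_add le_rfl hze)
  have h5 : edist e q ≤ ENNReal.ofReal ((1 - R ^ 2)⁻¹ * δ) + edist z q :=
    (edist_triangle _ z _).trans (add_le_add (by rwa [edist_comm]) le_rfl)
  calc _ ≤ _ := (lenDist_triangle _ _ _ _).trans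
        (add_le_add h1 ((lenDist_triangle _ _ _ _).trans (add_le_add h2 h3)))
    _ ≤ (edist p z + ENNReal.ofReal ((1 - R ^ 2)⁻¹ * δ)
        + ENNReal.ofReal ((1 - R ^ 2)⁻¹ * (6 * δ))) + (ENNReal.ofReal ((1 - R ^ 2)⁻¹ * (12 * δ))
        + (ENNReal.ofReal ((1 - R ^ 2)⁻¹ * δ) + edist z q
          + ENNReal.ofReal ((1 - R ^ 2)⁻¹ * (6 * δ)))) := by gcongr
    _ = edist p z + edist z q + (ENNReal.ofReal ((1 - R ^ 2)⁻¹ * δ)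
        + ENNReal.ofReal ((1 - R ^ 2)⁻¹ * (6 * δ)) + ENNReal.ofReal ((1 - R ^ 2)⁻¹ * (12 * δ))
        + ENNReal.ofReal ((1 - R ^ 2)⁻¹ * δ) + ENNReal.ofReal ((1 - R ^ 2)⁻¹ * (6 * δ))) := by
      ring
    _ = _ := by
      rw [← ENNReal.ofReal_add (by positivity) (by positivity),
        ← ENNReal.ofReal_add (by positivity) (by positivity),
        ← ENNReal.ofReal_add (by positivity) (by positivity),
        ← ENNReal.ofReal_add (by positivity) (by positivity)]
      congr 2
      ring

/-- Paths in the boundary of the body from the upper to the lower side pass near the relative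
boundary of `K`. -/
theorem iInf_le_lenDist_of_opposite (h : CloseBody K' K δ R) (hdim : dim K + 1 = n)
    (hw : IsUnitNormal K k₀ w) {u v : HypSpace n}
    (hu : ∀ s > (0 : ℝ), u.coord + s • w ∉ coord '' K')
    (hv : ∀ s > (0 : ℝ), v.coord + s • -w ∉ coord '' K') :
    ⨅ z ∈ relBoundary K, edist u z + edist z v
      ≤ lenDist (frontier K') u v + ENNReal.ofReal ((1 - R ^ 2)⁻¹ * (8 * δ)) := by
  have hδ := h.pos
  have hM := h.const_pos
  rw [lenDist, ENNReal.iInf_add]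
  refine le_iInf fun γ => ?_
  rw [ENNReal.iInf_add]
  refine le_iInf fun hγ => ?_
  -- The crossing point `γ t` is within `4 δ` of the relative boundary, and the path is at least as
  -- long as the detour through it.
  obtain ⟨t, ht⟩ := exists_line_notMem_interior h.convex (w := w) (c := fun t => (γ t).coord)
    (continuous_coord.comp γ.continuous) (fun t => (h.coord_mem_of_mem_frontier (hγ t)).2)
    (fun s hs hi => hu s hs (by simpa using interior_subset hi))
    (fun s hs hi => hv s hs (by simpa using interior_subset hi))
  have hγt := (h.coord_mem_of_mem_frontier (hγ t)).1
  obtain ⟨p, hp, hpt⟩ := h.near.1 _ hγt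
  obtain ⟨z, hz, hzt⟩ := exists_mem_intrinsicFrontier_near h.convex h.interior_nonempty hδ
    (fun m hm => mem_direction_of_inner_eq_zero hdim hw hm) h.near.2 hp hpt ht
  have hzR : ‖z‖ ≤ R := by
    have := norm_le_norm_add_norm_sub' z (γ t).coord
    linarith [h.norm_le' _ hγt]
  have hz1 : ‖z‖ < 1 := hzR.trans_lt h.lt_one
  have hzrel : ofCoord z ∈ relBoundary K := by
    change (ofCoord z).coord ∈ intrinsicFrontier ℝ (coord '' K)
    rwa [coord_ofCoord hz1]
  have he : edist (γ t) (ofCoord z) ≤ ENNReal.ofReal ((1 - R ^ 2)⁻¹ * (4 * δ)) := by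
    have := h.edist_le (u := (γ t).coord) (by linarith [h.norm_le' _ hγt]) hzR
      ((norm_sub_rev _ _).trans_le hzt)
    rwa [ofCoord_coord] at this
  calc _ ≤ edist u (ofCoord z) + edist (ofCoord z) v := iInf₂_le _ hzrel
    _ ≤ (edist u (γ t) + edist (γ t) (ofCoord z))
        + (edist (ofCoord z) (γ t) + edist (γ t) v) :=
      add_le_add (edist_triangle _ _ _) (edist_triangle _ _ _)
    _ = (edist u (γ t) + edist (γ t) v)
        + (edist (γ t) (ofCoord z) + edist (γ t) (ofCoord z)) := by
      rw [edist_comm (ofCoord z)]; ring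
    _ ≤ eVariationOn γ Set.univ + (ENNReal.ofReal ((1 - R ^ 2)⁻¹ * (4 * δ))
        + ENNReal.ofReal ((1 - R ^ 2)⁻¹ * (4 * δ))) :=
      add_le_add (edist_add_edist_le_eVariationOn_path γ t) (add_le_add he he)
    _ = _ := by
      rw [← ENNReal.ofReal_add (by positivity) (by positivity)]
      congr 2
      ring

end CloseBody

/-- The normal `w` on one side, `-w` on the other. -/
def sideNormal (w : EuclideanSpace ℝ (Fin n)) (b : Bool) : EuclideanSpace ℝ (Fin n) :=
  if b then w else -w

theorem sideNormal_of_ne (w : EuclideanSpace ℝ (Fin n)) {a b : Bool} (h : a ≠ b) :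
    sideNormal w b = -sideNormal w a := by
  cases a <;> cases b <;> simp_all [sideNormal]

theorem IsUnitNormal.sideNormal {K : Set (HypSpace n)} {k₀ w : EuclideanSpace ℝ (Fin n)}
    (h : IsUnitNormal K k₀ w) (b : Bool) : IsUnitNormal K k₀ (sideNormal w b) := by
  cases b
  · exact h.neg
  · exact h

/-- A point in one of the copies goes to a boundary point over it on the corresponding side of the
hyperplane. Lifting beyond the slab gives the upper bound, and the forced passage near the relative
boundary the lower one. -/
theorem ghTendsto_double (hn : 2 ≤ n) {Ks : ℕ → Set (HypSpace n)}
    {K : Set (HypSpace n)} (hKs : ∀ i, IsCompact (Ks i)) (hK : IsCompact K) (hne : K.Nonempty)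
    (hcs : ∀ i, Convex ℝ (coord '' Ks i)) (hc : Convex ℝ (coord '' K))
    (hints : ∀ i, (interior (coord '' Ks i)).Nonempty) (hdim : dim K + 1 = n)
    (hlim : Tendsto (fun i => Metric.hausdorffEDist (Ks i) K) atTop (𝓝 0)) :
    GHTendsto (fun i (x y : frontier (Ks i)) => innerEDist x y) (doubleEDist K) := by
  have hbd := relBoundary_nonempty hK hne (by omega)
  refine ghTendsto_of_approx (fun i => isCompactMetric_frontier hn (hKs i) (hcs i) (hints i))
    (isCompactMetric_double hK hne hbd) fun ε hε => ?_
  -- The scale is chosen for `ε / 2` because the density error below, `16 δ + 38 δ`, exceeds `40 δ`.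
  obtain ⟨δ, R, hδR, hev⟩ := exists_eventually_closeBody hKs hK hcs hints hlim
    (half_pos hε)
  filter_upwards [hev] with i h
  have hδ := h.pos
  have hM := h.const_pos
  have hMδ := mul_pos hM hδ
  obtain ⟨k₀, hk₀⟩ := hne
  obtain ⟨w, hw⟩ := exists_isUnitNormal (Set.mem_image_of_mem coord hk₀) (by omega : dim K < n)
  have hg : ∀ P : K × Bool, ∃ u ∈ frontier (Ks i), ‖u.coord - P.1.1.coord‖ ≤ 3 * δ ∧
      (∀ s > (0 : ℝ), u.coord + s • sideNormal w P.2 ∉ coord '' Ks i) ∧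
      lenDist (interior (Ks i))ᶜ u (ofCoord (P.1.1.coord + (3 * δ) • sideNormal w P.2))
        ≤ ENNReal.ofReal ((1 - R ^ 2)⁻¹ * (6 * δ)) := by
    intro P
    obtain ⟨_, ⟨u, hu, rfl⟩, hup, hlast, hlen⟩ :=
      h.exists_upper (hw.sideNormal P.2) (Set.mem_image_of_mem coord P.1.2)
    rw [ofCoord_coord] at hlen
    exact ⟨u, h.mem_frontier_of_coord (Set.mem_image_of_mem _ hu)
      (notMem_interior_of_forall_notMem hlast), hup, hlast, hlen⟩
  choose g hg hgp hlast hlen using hg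
  have hfr : ∀ x ∈ frontier (Ks i), x.coord ∈ coord '' Ks i ∪ coord '' K := fun x hx =>
    Or.inl (h.coord_mem_of_mem_frontier hx).1
  have hclose : ∀ P : K × Bool, edist (P.1 : HypSpace n) (g P)
      ≤ ENNReal.ofReal ((1 - R ^ 2)⁻¹ * (3 * δ)) := fun P =>
    h.edist_le_of_norm_sub_le (Or.inr (Set.mem_image_of_mem _ P.1.2)) (hfr _ (hg P))
      ((norm_sub_rev _ _).trans_le (hgp P))
  -- The constant is `6 + 26 + 6`: up to the lift, between the lifts, and back down.
  have hupper : ∀ P Q : K × Bool, lenDist (frontier (Ks i)) (g P) (g Q)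
      ≤ preDoubleEDist K P Q + ENNReal.ofReal ((1 - R ^ 2)⁻¹ * (38 * δ)) := by
    intro P Q
    have hmid : lenDist (interior (Ks i))ᶜ
        (ofCoord (P.1.1.coord + (3 * δ) • sideNormal w P.2))
        (ofCoord (Q.1.1.coord + (3 * δ) • sideNormal w Q.2))
        ≤ preDoubleEDist K P Q + ENNReal.ofReal ((1 - R ^ 2)⁻¹ * (26 * δ)) := by
      rw [preDoubleEDist]
      split_ifs with hPQ
      · rw [hPQ]
        refine (h.lenDist_lift_le (hw.sideNormal Q.2) P.1.2 Q.1.2).trans ?_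
        refine add_le_add le_rfl (ENNReal.ofReal_le_ofReal ?_)
        linarith
      · rw [ENNReal.iInf_add]
        refine le_iInf fun z => ?_
        rw [ENNReal.iInf_add]
        refine le_iInf fun hz => ?_
        rw [sideNormal_of_ne w hPQ]
        exact h.lenDist_lift_opposite_le hK hc (hw.sideNormal P.2) P.1.2 Q.1.2 hz
    have hQ := hlen Q
    rw [lenDist_comm] at hQ
    calc _ ≤ _ := h.lenDist_frontier_le (hg P) (hg Q)
      _ ≤ _ := (lenDist_triangle _ _ _ _).trans
        (add_le_add (hlen P) ((lenDist_triangle _ _ _ _).trans (add_le_add hmid hQ)))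
      _ = preDoubleEDist K P Q + (ENNReal.ofReal ((1 - R ^ 2)⁻¹ * (6 * δ))
          + ENNReal.ofReal ((1 - R ^ 2)⁻¹ * (26 * δ))
          + ENNReal.ofReal ((1 - R ^ 2)⁻¹ * (6 * δ))) := by ring
      _ = _ := by
        rw [← ENNReal.ofReal_add (by positivity) (by positivity),
          ← ENNReal.ofReal_add (by positivity) (by positivity)]
        congr 2
        ring
  have hlower : ∀ P Q : K × Bool, preDoubleEDist K P Q
      ≤ lenDist (frontier (Ks i)) (g P) (g Q) + ENNReal.ofReal ((1 - R ^ 2)⁻¹ * (14 * δ)) := by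
    intro P Q
    have hP := hclose P
    have hQ := hclose Q
    rw [edist_comm] at hQ
    rw [preDoubleEDist]
    split_ifs with hPQ
    · calc edist (P.1 : HypSpace n) Q.1 ≤ _ := (edist_triangle _ (g P) _).trans
            (add_le_add hP ((edist_triangle _ (g Q) _).trans
              (add_le_add (edist_le_lenDist (frontier (Ks i)) _ _) hQ)))
        _ = lenDist (frontier (Ks i)) (g P) (g Q) + (ENNReal.ofReal ((1 - R ^ 2)⁻¹ * (3 * δ))
            + ENNReal.ofReal ((1 - R ^ 2)⁻¹ * (3 * δ))) := by ring
        _ ≤ _ := by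
          rw [← ENNReal.ofReal_add (by positivity) (by positivity)]
          refine add_le_add le_rfl (ENNReal.ofReal_le_ofReal ?_)
          linarith
    · have hv := hlast Q
      rw [sideNormal_of_ne w hPQ] at hv
      have h1 := h.iInf_le_lenDist_of_opposite hdim (hw.sideNormal P.2) (hlast P) hv
      calc ⨅ z ∈ relBoundary K, edist (P.1 : HypSpace n) z + edist z (Q.1 : HypSpace n)
          ≤ ⨅ z ∈ relBoundary K, (ENNReal.ofReal ((1 - R ^ 2)⁻¹ * (3 * δ))
            + ENNReal.ofReal ((1 - R ^ 2)⁻¹ * (3 * δ))) + (edist (g P) z + edist z (g Q)) := by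
            refine iInf₂_mono fun z _ => ?_
            calc _ ≤ (ENNReal.ofReal ((1 - R ^ 2)⁻¹ * (3 * δ)) + edist (g P) z)
                  + (edist z (g Q) + ENNReal.ofReal ((1 - R ^ 2)⁻¹ * (3 * δ))) :=
                  add_le_add ((edist_triangle _ (g P) _).trans (add_le_add hP le_rfl))
                    ((edist_triangle _ (g Q) _).trans (add_le_add le_rfl hQ))
              _ = _ := by ring
        _ = (ENNReal.ofReal ((1 - R ^ 2)⁻¹ * (3 * δ))
            + ENNReal.ofReal ((1 - R ^ 2)⁻¹ * (3 * δ)))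
            + ⨅ z ∈ relBoundary K, edist (g P) z + edist z (g Q) := by
          simp only [ENNReal.add_iInf]
        _ ≤ _ := add_le_add le_rfl h1
        _ = lenDist (frontier (Ks i)) (g P) (g Q) + (ENNReal.ofReal ((1 - R ^ 2)⁻¹ * (3 * δ))
            + ENNReal.ofReal ((1 - R ^ 2)⁻¹ * (3 * δ))
            + ENNReal.ofReal ((1 - R ^ 2)⁻¹ * (8 * δ))) := by ring
        _ = _ := by
          rw [← ENNReal.ofReal_add (by positivity) (by positivity),
            ← ENNReal.ofReal_add (by positivity) (by positivity)]
          congr 2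
          ring
  -- A boundary point leaves the slab on the side where its displacement along the outer normal
  -- ends, and is then compared with the lift of a nearby point of `K`: `5 + 5 + 6`.
  have hdense : ∀ x ∈ frontier (Ks i), ∃ P : K × Bool, lenDist (frontier (Ks i)) x (g P)
      ≤ ENNReal.ofReal ((1 - R ^ 2)⁻¹ * (16 * δ)) := by
    intro x hx
    obtain ⟨hxA, hxi⟩ := h.coord_mem_of_mem_frontier hx
    obtain ⟨ν, hν, hνA⟩ := h.convex.exists_unit_normal h.interior_nonempty hxi
    obtain ⟨_, ⟨p, hp, rfl⟩, hxp⟩ := h.near.1 _ hxA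
    obtain ⟨b, hb⟩ : ∃ b, 0 ≤ ⟪sideNormal w b, x.coord + (3 * δ) • ν - k₀.coord⟫ := by
      rcases le_total 0 ⟪w, x.coord + (3 * δ) • ν - k₀.coord⟫ with h0 | h0
      · exact ⟨true, h0⟩
      · refine ⟨false, ?_⟩
        change 0 ≤ ⟪-w, _⟫
        rw [inner_neg_left]
        linarith
    refine ⟨(⟨p, hp⟩, b), ?_⟩
    have hw' := hw.sideNormal b
    have h3 := hlen (⟨p, hp⟩, b)
    simp only at h3
    set v := sideNormal w b with hv
    have h1 := h.lenDist_exit_le hw' hxA hxi hν hνA hb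
    rw [ofCoord_coord] at h1
    have hpC := Set.mem_image_of_mem coord hp
    have hdiff : ‖x.coord + (3 * δ) • ν + (2 * δ) • v - (p.coord + (3 * δ) • v)‖ ≤ 5 * δ := by
      have e : x.coord + (3 * δ) • ν + (2 * δ) • v - (p.coord + (3 * δ) • v)
          = (x.coord - p.coord) + ((3 * δ) • ν + (-δ) • v) := by module
      rw [e]
      refine (norm_add_le _ _).trans ?_
      have := norm_add_le ((3 * δ) • ν) ((-δ) • v)
      rw [norm_smul, norm_smul, hν, hw'.norm_eq, norm_neg, Real.norm_of_nonneg (by positivity),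
        Real.norm_of_nonneg hδ.le] at this
      linarith
    have hn1 : ‖x.coord + (3 * δ) • ν + (2 * δ) • v‖ ≤ R := by
      have e1 := norm_add_le (x.coord + (3 * δ) • ν) ((2 * δ) • v)
      have e2 := norm_add_le x.coord ((3 * δ) • ν)
      rw [norm_smul, hw'.norm_eq, Real.norm_of_nonneg (by positivity)] at e1
      rw [norm_smul (3 * δ) ν, hν, Real.norm_of_nonneg (by positivity)] at e2
      linarith [h.norm_le' _ hxA]
    have hn2 := h.norm_lift_le hw'.norm_eq (Or.inr hpC)
    have h2 : lenDist (interior (Ks i))ᶜ (ofCoord (x.coord + (3 * δ) • ν + (2 * δ) • v))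
        (ofCoord (p.coord + (3 * δ) • v)) ≤ ENNReal.ofReal ((1 - R ^ 2)⁻¹ * (5 * δ)) := by
      refine (h.lenDist_le_of_high hw' hn1 hn2 ?_ ?_).trans (h.edist_le hn1 hn2 hdiff)
      · rw [add_sub_right_comm, inner_add_right, inner_smul_right, real_inner_self_eq_norm_sq,
          hw'.norm_eq]
        linarith
      · rw [add_sub_right_comm, inner_add_right, inner_smul_right, real_inner_self_eq_norm_sq,
          hw'.norm_eq, hw'.inner_eq _ hpC]
        linarith
    rw [lenDist_comm] at h3
    calc _ ≤ _ := h.lenDist_frontier_le hx (hg _)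
      _ ≤ _ := (lenDist_triangle _ _ _ _).trans
        (add_le_add h1 ((lenDist_triangle _ _ _ _).trans (add_le_add h2 h3)))
      _ = _ := by
        rw [← ENNReal.ofReal_add (by positivity) (by positivity),
          ← ENNReal.ofReal_add (by positivity) (by positivity)]
        congr 1
        ring
  -- `g` depends on the representative for glued points, so one is fixed for each point of the
  -- double.
  obtain ⟨out, hout⟩ := (Double.surjective_mk K).hasRightInverse
  refine ⟨fun y => ⟨g (out y), hg _⟩, fun y y' => ?_, fun x => ?_⟩
  · simp only [innerEDist_subtype]
    have e : doubleEDist K y y' = preDoubleEDist K (out y) (out y') := by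
      rw [← doubleEDist_mk, hout, hout]
    rw [e]
    constructor
    · refine (hupper _ _).trans (add_le_add le_rfl (ENNReal.ofReal_le_ofReal ?_))
      linarith
    · refine (hlower _ _).trans (add_le_add le_rfl (ENNReal.ofReal_le_ofReal ?_))
      linarith
  · obtain ⟨P, hP⟩ := hdense x x.2
    refine ⟨Double.mk K P, ?_⟩
    simp only [innerEDist_subtype]
    -- The fixed representative may differ from `P`, but it is at distance 0 from it, so `hupper`
    -- bounds the distance of the two images.
    have e : preDoubleEDist K P (out (Double.mk K P)) = 0 := by
      rw [← doubleEDist_mk, hout, doubleEDist_mk, preDoubleEDist_self]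
    have h1 := hupper P (out (Double.mk K P))
    rw [e, zero_add] at h1
    refine (lenDist_triangle _ _ (g P) _).trans ((add_le_add hP h1).trans ?_)
    rw [← ENNReal.ofReal_add (by positivity) (by positivity)]
    apply ENNReal.ofReal_le_ofReal
    linarith

end HypSpace

end

/-! ### The four cases assembled -/

theorem propositionP (n : ℕ) (hn : 2 ≤ n) (Ks : ℕ → Set (HypSpace n)) (K : Set (HypSpace n))
    (hKs_convex : ∀ i, HypSpace.IsConvex (Ks i)) (hKs_compact : ∀ i, IsCompact (Ks i))
    (hKs_dim : ∀ i, HypSpace.dim (Ks i) = n)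
    (hK_convex : HypSpace.IsConvex K) (hK_compact : IsCompact K)
    (hlim : Tendsto (fun i => Metric.hausdorffEDist (Ks i) K) atTop (𝓝 0)) :
    (HypSpace.dim K = n →
      GHTendsto (fun i (x y : frontier (Ks i)) => innerEDist x y)
        (fun x y : frontier K => innerEDist x y)) ∧
    (HypSpace.dim K + 1 = n →
      IsIntrinsicMetric (HypSpace.doubleEDist K) ∧
      GHTendsto (fun i (x y : frontier (Ks i)) => innerEDist x y) (HypSpace.doubleEDist K)) ∧
    (HypSpace.dim K + 2 ≤ n →
      (∀ x y : K, innerEDist x y = edist x y) ∧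
      GHTendsto (fun i (x y : frontier (Ks i)) => innerEDist x y) (fun x y : K => edist x y)) ∧
    (HypSpace.dim K + 2 ≤ n →
      Tendsto (fun i => ⨆ (x : frontier (Ks i)) (y : frontier (Ks i)),
        max (innerEDist x y - edist x y) (edist x y - innerEDist x y)) atTop (𝓝 0)) := by
  have hn0 : n ≠ 0 := by omega
  have hcs := fun i => (hKs_convex i).convex
  have hc := hK_convex.convex
  have hints := fun i => HypSpace.interior_nonempty_of_dim hn0 (hcs i) (hKs_dim i)
  -- Hausdorff closeness to the nonempty sets `Ks i` provides a point of `K`.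
  have hne : K.Nonempty := by
    obtain ⟨i, hi⟩ := (HypSpace.eventually_near hlim one_pos).exists
    obtain ⟨v, hv⟩ := hints i
    obtain ⟨_, ⟨k, hk, -⟩, -⟩ := hi.1 v (interior_subset hv)
    exact ⟨k, hk⟩
  refine ⟨fun hdim => ?_, fun hdim => ⟨?_, ?_⟩, fun hdim => ⟨fun x y => ?_, ?_⟩, fun hdim => ?_⟩
  · exact HypSpace.ghTendsto_frontier hn hKs_compact hK_compact hcs hc hints
      (HypSpace.interior_nonempty_of_dim hn0 hc hdim) hlim
  · exact HypSpace.isIntrinsicMetric_double hK_compact hc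
      (HypSpace.relBoundary_nonempty hK_compact hne (by omega))
  · exact HypSpace.ghTendsto_double hn hKs_compact hK_compact hne hcs hc hints hdim hlim
  · rw [innerEDist_subtype, HypSpace.lenDist_eq_edist_of_convex hc x.2 y.2, Subtype.edist_eq]
  · exact HypSpace.ghTendsto_frontier_of_dim_add_two_le hn hKs_compact hK_compact hne hcs hints hdim
      hlim
  · exact HypSpace.tendsto_iSup_innerEDist_sub_edist hKs_compact hK_compact hcs hints hdim hlim
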